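/- All plane curve germs are complex analytic germs $(X,0)\subset(\mathbb C^2,0)$. Let $(X,0)=(V(h),0)$ be irreducible, with $h\in\mathbb C\{x,y\}$ irreducible. Its multiplicity is the order of vanishing of $h$ at $0$, and its Milnor number is $$\mu(X,0)=\dim_{\mathbb C}\mathbb C\{x,y\}/\langle \partial h/\partial x,\partial h/\partial y\rangle .$$ If $(X,0)$ has multiplicity $m$, choose linear coordinates in which it has a Puiseux parametrization $u\mapsto(u^m,\,a_1u^{\alpha_1}+a_2u^{\alpha_2}+\cdots)$ with $a_j\neq0$ and $m<\alpha_1<\alpha_2<\cdots$. Put $b_0=m$ and $b_j=\gcd(m,\alpha_1,\dots,\alpha_j)$. The characteristic exponents of $(X,0)$ are $m$ and those $\alpha_j$ with $b_j<b_{j-1}$; in particular, $m$ itself is counted among them. Let $\Lambda_{m,k}$ be the set of irreducible plane curve germs of multiplicity $m$ with exactly $k$ characteristic exponents. A germ $(X,0)\in\Lambda_{m,k}$ is $\mu_{m,k}$-minimal if $\mu(X,0)\le\mu(Y,0)$ for all $(Y,0)\in\Lambda_{m,k}$. Two germs $(X,0),(Y,0)$ are topologically equivalent if some germ of a homeomorphism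 $(\mathbb C^2,0)\to(\mathbb C^2,0)$ maps $(X,0)$ onto $(Y,0)$. **Theorem.** Let $m\ge4$ be a composite integer with prime factorization $m=p_1p_2\cdots p_r$, $p_1\le p_2\le\cdots\le p_r$, and let $3\le k\le r+1$. Put $d_0=m$ and $d_i=p_1p_2\cdots p_{k-1-i}$ for $1\le i\le k-1$, where the empty product $d_{k-1}$ is $1$. Then $m=d_0>d_1>\cdots>d_{k-2}>d_{k-1}=1$ and $d_{i+1}\mid d_i$ for $0\le i<k-1$. The map germ $$\varphi(u)=\bigl(u^m,\;u^{m+d_1}+u^{m+d_1+d_2}+\cdots+u^{m+d_1+\cdots+d_{k-2}}+u^{m+d_1+\cdots+d_{k-2}+1}\bigr)$$ parametrizes an irreducible plane curve germ $(N,0)$ that is $\mu_{m,k}$-minimal, and it is a (topological) normal form of all $\mu_{m,k}$-minimal germs: every $\mu_{m,k}$-minimal irreducible plane curve germ $(X,0)$ is topologically equivalent to $(N,0)$, and its characteristic exponents are exactly $$m,\quad m+d_1,\quad m+d_1+d_2,\quad\dots,\quad m+d_1+\cdots+d_{k-2},\quad m+d_1+\cdots+d_{k-2}+1 .$$ -/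

import Mathlib

open Filter Topology

noncomputable section

/-- The local ring `ℂ{x, y}` of convergent power series, as the ring of germs at the origin
of functions `ℂ × ℂ → ℂ` that are analytic at the origin. -/
def analyticGerms : Subring (Germ (𝓝 (0 : ℂ × ℂ)) ℂ) where
  carrier := {g | ∃ f : ℂ × ℂ → ℂ, AnalyticAt ℂ f 0 ∧ (f : Germ (𝓝 (0 : ℂ × ℂ)) ℂ) = g}
  mul_mem' := by
    rintro _ _ ⟨f, hf, rfl⟩ ⟨g, hg, rfl⟩
    exact ⟨f * g, hf.mul hg, rfl⟩
  one_mem' := ⟨fun _ => 1, analyticAt_const, rfl⟩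
  add_mem' := by
    rintro _ _ ⟨f, hf, rfl⟩ ⟨g, hg, rfl⟩
    exact ⟨f + g, hf.add hg, rfl⟩
  zero_mem' := ⟨fun _ => 0, analyticAt_const, rfl⟩
  neg_mem' := by
    rintro _ ⟨f, hf, rfl⟩
    exact ⟨-f, hf.neg, rfl⟩

/-- The germ at the origin of a function analytic at the origin. -/
def analyticGerms.of (f : ℂ × ℂ → ℂ) (hf : AnalyticAt ℂ f 0) : analyticGerms :=
  ⟨(f : Germ (𝓝 (0 : ℂ × ℂ)) ℂ), f, hf, rfl⟩

/-- The constants `ℂ → ℂ{x, y}`. -/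
def analyticGerms.const : ℂ →+* analyticGerms where
  toFun c := analyticGerms.of (fun _ => c) analyticAt_const
  map_one' := rfl
  map_mul' _ _ := rfl
  map_zero' := rfl
  map_add' _ _ := rfl

instance : Algebra ℂ analyticGerms := analyticGerms.const.toAlgebra

/-- An irreducible plane curve germ `(X, 0) ⊆ (ℂ², 0)`, given by an irreducible equation
in `ℂ{x, y}`: it is the germ at `0` of the zero set of `eqn`. -/
structure PlaneBranch where
  eqn : ℂ × ℂ → ℂ
  analytic : AnalyticAt ℂ eqn 0
  irreducible : Irreducible (analyticGerms.of eqn analytic)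

/-- The partial derivative of `f` at `p` in the direction `v`. -/
def partialDeriv (v : ℂ × ℂ) (f : ℂ × ℂ → ℂ) (p : ℂ × ℂ) : ℂ := fderiv ℂ f p v

theorem analyticAt_partialDeriv (v : ℂ × ℂ) {f : ℂ × ℂ → ℂ} (hf : AnalyticAt ℂ f 0) :
    AnalyticAt ℂ (partialDeriv v f) 0 :=
  ((ContinuousLinearMap.apply ℂ ℂ v).analyticAt _).comp hf.fderiv

/-- The exponents `n` with a nonzero coefficient in the power series of `φ` at `0`. -/
def powerSupport (φ : ℂ → ℂ) : Set ℕ := {n | iteratedDeriv n φ 0 ≠ 0}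

open Classical in
/-- The greatest common divisor of `m` and of all the exponents smaller than `n` that
occur in the power series of `φ`. -/
def gcdBelow (m : ℕ) (φ : ℂ → ℂ) (n : ℕ) : ℕ :=
  Nat.gcd m (((Finset.range n).filter (fun i => i ∈ powerSupport φ)).gcd id)

/-- The characteristic exponents read off from `u ↦ (u ^ m, φ u)`: the number `m`, and all
the exponents of `φ` at which the greatest common divisor drops. -/
def puiseuxExponents (m : ℕ) (φ : ℂ → ℂ) : Set ℕ :=
  insert m {n | n ∈ powerSupport φ ∧ gcdBelow m φ (n + 1) < gcdBelow m φ n}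

namespace PlaneBranch

/-- The Jacobian ideal `(∂h/∂x, ∂h/∂y)` of `ℂ{x, y}`. -/
def jacobianIdeal (X : PlaneBranch) : Ideal analyticGerms :=
  Ideal.span
    {analyticGerms.of (partialDeriv (1, 0) X.eqn) (analyticAt_partialDeriv _ X.analytic),
     analyticGerms.of (partialDeriv (0, 1) X.eqn) (analyticAt_partialDeriv _ X.analytic)}

/-- The Milnor number: the dimension of `ℂ{x, y} / (∂h/∂x, ∂h/∂y)`. -/
def milnor (X : PlaneBranch) : ℕ∞ :=
  Cardinal.toENat (Module.rank ℂ (analyticGerms ⧸ X.jacobianIdeal))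

/-- `(X, 0)` has multiplicity `m`: its equation vanishes to order exactly `m` at `0`. -/
def HasMultiplicity (X : PlaneBranch) (m : ℕ) : Prop :=
  (∀ n < m, iteratedFDeriv ℂ n X.eqn 0 = 0) ∧ iteratedFDeriv ℂ m X.eqn 0 ≠ 0

/-- `γ : (ℂ, 0) → (X, 0)` is a parametrization of the curve germ: it is analytic, and it is
a bijection between germs. -/
structure IsParametrizedBy (X : PlaneBranch) (γ : ℂ → ℂ × ℂ) : Prop where
  analytic : AnalyticAt ℂ γ 0
  map_zero : γ 0 = 0
  vanishes : ∀ᶠ u in 𝓝 0, X.eqn (γ u) = 0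
  injective : ∃ U ∈ 𝓝 (0 : ℂ), Set.InjOn γ U
  surjective : ∀ U ∈ 𝓝 (0 : ℂ), ∀ᶠ q in 𝓝 (0 : ℂ × ℂ), X.eqn q = 0 → q ∈ γ '' U

/-- In the linear coordinates `L` of `ℂ²`, the map `u ↦ (u ^ m, φ u)` is a Puiseux
parametrization of `(X, 0)`, where only exponents larger than `m` occur in `φ`. -/
structure IsPuiseuxParametrization (X : PlaneBranch) (L : (ℂ × ℂ) ≃L[ℂ] (ℂ × ℂ))
    (m : ℕ) (φ : ℂ → ℂ) : Prop where
  pos : 0 < m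
  analytic : AnalyticAt ℂ φ 0
  lt_of_mem : ∀ n ∈ powerSupport φ, m < n
  parametrizes : X.IsParametrizedBy (fun u => L (u ^ m, φ u))

/-- `E` is the set of characteristic exponents of `(X, 0)`. -/
def HasCharExponents (X : PlaneBranch) (E : Set ℕ) : Prop :=
  ∃ (L : (ℂ × ℂ) ≃L[ℂ] (ℂ × ℂ)) (m : ℕ) (φ : ℂ → ℂ),
    X.IsPuiseuxParametrization L m φ ∧ E = puiseuxExponents m φ

/-- The class of irreducible plane curve germs of multiplicity `m` with exactly `k`
characteristic exponents. -/
def Lam (m k : ℕ) : Set PlaneBranch :=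
  {X | X.HasMultiplicity m ∧ ∃ E : Set ℕ, X.HasCharExponents E ∧ E.encard = k}

/-- `(X, 0)` is `μ_{m,k}`-minimal. -/
def IsMuMinimal (X : PlaneBranch) (m k : ℕ) : Prop :=
  X ∈ Lam m k ∧ ∀ Y ∈ Lam m k, X.milnor ≤ Y.milnor

/-- `(X, 0)` and `(Y, 0)` are topologically equivalent: a germ of a homeomorphism
`(ℂ², 0) → (ℂ², 0)` maps `(X, 0)` onto `(Y, 0)`. -/
def TopEquivalent (X Y : PlaneBranch) : Prop :=
  ∃ Φ : OpenPartialHomeomorph (ℂ × ℂ) (ℂ × ℂ), (0 : ℂ × ℂ) ∈ Φ.source ∧ Φ 0 = 0 ∧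
    ∀ᶠ q in 𝓝 (0 : ℂ × ℂ), X.eqn q = 0 ↔ Y.eqn (Φ q) = 0

end PlaneBranch

/-- `d_0 = m` and `d_i = p_1 p_2 ⋯ p_{k-1-i}` for `1 ≤ i ≤ k - 1`; the product is empty,
so that `d_i = 1`, for `i = k - 1`. -/
def nestedDivisor (m k : ℕ) (p : ℕ → ℕ) (i : ℕ) : ℕ :=
  if i = 0 then m else ∏ l ∈ Finset.Icc 1 (k - 1 - i), p l

/-- The exponent `m + d_1 + d_2 + ⋯ + d_i`. -/
def normalExponent (m k : ℕ) (p : ℕ → ℕ) (i : ℕ) : ℕ :=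
  m + ∑ j ∈ Finset.Icc 1 i, nestedDivisor m k p j

/-- `u ↦ (u^m, u^{m+d_1} + u^{m+d_1+d_2} + ⋯ + u^{m+d_1+⋯+d_{k-2}} + u^{m+d_1+⋯+d_{k-2}+1})`. -/
def normalForm (m k : ℕ) (p : ℕ → ℕ) (u : ℂ) : ℂ × ℂ :=
  (u ^ m, ∑ i ∈ Finset.Icc 1 (k - 2), u ^ normalExponent m k p i +
    u ^ (normalExponent m k p (k - 2) + 1))

end

/-!
The proof expresses both the Milnor number and the topological type of a branch through one
sequence of integers. For a Puiseux parametrization `u ↦ (u ^ m, φ u)`, let `gₙ` be the greatest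
common divisor of `m` and the exponents of `φ` below `n` (`gcdBelow m φ n`); the characteristic
exponents are `m` and the places where `gₙ` drops.

*Milnor number.* The equation of the branch is a unit times the product of the conjugates
`y - φ(ζ x ^ (1 / m))`, `ζ ^ m = 1` (`PlaneBranch.IsPuiseuxParametrization.exists_eq_unit_mul`).
Intersection multiplicities may be computed in `ℂ⟦x⟧⟦y⟧` instead of `ℂ{x, y}`
(`analyticGerms.rank_quotient_span_eq`), where, after a ramification `x = t ^ e`, the polar
`∂h/∂y` splits into smooth branches by the Newton–Puiseux theorem (`splitsAfterRamification`).
Comparing `h`, `∂h/∂x` and `∂h/∂y` on these branches and on those of `h` gives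
`μ + (m - 1) = ∑ ord (φ(ζ u) - φ(u))`, the sum over the `m`-th roots of unity `ζ ≠ 1`
(`exists_rank_quotient_eq`). The order of `φ(ζ u) - φ(u)` is at least `n` exactly when
`ζ ^ gₙ = 1`, so the sum equals `∑ (gₙ - 1)` over `n ≥ 1` (`exists_sum_contactOrder_eq`): the
Milnor number is strictly monotone in the sequence `gₙ`.

*Minimality.* If `gₙ` drops `k - 1` times, each drop loses a prime factor of `m`, so after `j` drops
`gₙ` retains at least `k - 1 - j` of them and is at least the product `dⱼ` of the smallest ones. All
exponents up to the `j`-th drop are multiples of the value of `gₙ` after it, hence consecutive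
drops are at least `d₁, d₂, …` apart. The normal form attains both bounds simultaneously, so its
sequence is termwise the smallest one (`le_gcdBelow_of_encard`), and a branch is minimal if and only
if it has the same sequence.

*Invariance.* The sequence `gₙ` does not depend on the parametrization or on the linear coordinates,
because two parametrizations differ by a change of parameter `u ↦ u κ(u)` which commutes with the
multiplication by `ζ` up to a sufficiently high order
(`PlaneBranch.IsPuiseuxParametrization.gcdBelow_eq`).

*Topological type.* Branches with the same sequence are topologically equivalent
(`curveEquivalent_of_gcdBelow_eq`). If the coefficients of `φ` and `ψ` at the characteristic
exponents are close, then `ψ - φ` varies, among the points `φ(ζ u)` of a line `x = u ^ m`, by at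
most a quarter of the distance between these points. It therefore extends to a function of `(x, y)`,
contracting in `y`, and adding this function to `y` is a homeomorphism from one curve to the other
(`curveEquivalent_of_norm_sub_le`). The coefficients at the characteristic exponents range over a
power of `ℂ \ {0}`, which is connected, so the closeness assumption can be dropped.
-/

/-! ### Taylor expansion of analytic germs -/

noncomputable section

open PowerSeries

/-- The Taylor homomorphism `a ↦ ∑ Dⁿ a / n! Xⁿ` of a derivation `D` of a `ℂ`-algebra. -/
def Derivation.taylor {R : Type*} [CommRing R] [Algebra ℂ R] (D : Derivation ℂ R R) :
    R →+* R⟦X⟧ where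
  toFun a := PowerSeries.mk fun n => ((n.factorial : ℂ)⁻¹) • (D^[n] a)
  map_one' := by
    ext n
    cases n with
    | zero => simp
    | succ n =>
      have h : D^[n + 1] (1 : R) = 0 := by
        rw [Function.iterate_succ_apply, D.map_one_eq_zero, iterate_map_zero]
      simp [PowerSeries.coeff_one, h]
  map_zero' := by
    ext n
    simp [iterate_map_zero]
  map_add' a b := by
    ext n
    simp [iterate_map_add]
  map_mul' a b := by
    -- Both sides have the same `X`-derivative, by the Leibniz rule for `D`.
    ext n
    induction n generalizing a b with
    | zero => simp [PowerSeries.coeff_mul]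
    | succ n ih =>
      set E : R → R⟦X⟧ := fun a => PowerSeries.mk fun n => ((n.factorial : ℂ)⁻¹) • (D^[n] a) with hE
      have hd : ∀ a, d⁄dX R (E a) = E (D a) := by
        intro a
        ext k
        have hk : ((k + 1 : ℕ) : ℂ) ≠ 0 := by exact_mod_cast Nat.succ_ne_zero k
        have h1 : ((k : R) + 1) = algebraMap ℂ R ((k + 1 : ℕ) : ℂ) := by simp
        rw [PowerSeries.coeff_derivative]
        simp only [hE, PowerSeries.coeff_mk, Function.iterate_succ_apply]
        rw [h1, mul_comm, ← Algebra.smul_def, smul_smul]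
        congr 1
        rw [Nat.factorial_succ]
        push_cast at hk ⊢
        field_simp
      have hadd : ∀ a b, E (a + b) = E a + E b := by
        intro a b
        ext n
        simp [hE, iterate_map_add]
      have h1 : ((n : R) + 1) = algebraMap ℂ R ((n + 1 : ℕ) : ℂ) := by simp
      have hunit : IsUnit ((n : R) + 1) := by
        rw [h1]
        exact (IsUnit.mk0 _ (by exact_mod_cast Nat.succ_ne_zero n)).map _
      apply hunit.mul_left_injective
      change coeff (n + 1) (E (a * b)) * ((n : R) + 1) = coeff (n + 1) (E a * E b) * ((n : R) + 1)
      rw [← PowerSeries.coeff_derivative, ← PowerSeries.coeff_derivative, hd, Derivation.leibniz,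
        Derivation.leibniz, hd, hd, smul_eq_mul, smul_eq_mul, smul_eq_mul, smul_eq_mul,
        hadd, map_add, map_add]
      congr 1
      · exact ih a (D b)
      · exact ih b (D a)

theorem Derivation.coeff_taylor {R : Type*} [CommRing R] [Algebra ℂ R] (D : Derivation ℂ R R)
    (n : ℕ) (a : R) : coeff n (D.taylor a) = ((n.factorial : ℂ)⁻¹) • (D^[n] a) := by
  simp [Derivation.taylor]

namespace analyticGerms

theorem exists_of (g : analyticGerms) :
    ∃ (f : ℂ × ℂ → ℂ) (hf : AnalyticAt ℂ f 0), g = of f hf := by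
  obtain ⟨g, f, hf, rfl⟩ := g
  exact ⟨f, hf, rfl⟩

theorem of_eq_of {f g : ℂ × ℂ → ℂ} (hf : AnalyticAt ℂ f 0) (hg : AnalyticAt ℂ g 0) :
    of f hf = of g hg ↔ f =ᶠ[𝓝 0] g := by
  rw [Subtype.ext_iff]
  exact Germ.coe_eq

theorem of_mul {f g : ℂ × ℂ → ℂ} (hf : AnalyticAt ℂ f 0) (hg : AnalyticAt ℂ g 0) :
    of f hf * of g hg = of (f * g) (hf.mul hg) := rfl

theorem of_add {f g : ℂ × ℂ → ℂ} (hf : AnalyticAt ℂ f 0) (hg : AnalyticAt ℂ g 0) :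
    of f hf + of g hg = of (f + g) (hf.add hg) := rfl

theorem of_sub {f g : ℂ × ℂ → ℂ} (hf : AnalyticAt ℂ f 0) (hg : AnalyticAt ℂ g 0) :
    of f hf - of g hg = of (f - g) (hf.sub hg) := by
  rw [sub_eq_iff_eq_add, of_add, of_eq_of]
  exact Eventually.of_forall fun _ => by simp

theorem smul_of (c : ℂ) {f : ℂ × ℂ → ℂ} (hf : AnalyticAt ℂ f 0) :
    c • of f hf = of (fun p => c * f p) (analyticAt_const.mul hf) := rfl

/-- The value of a germ at the origin. -/
def eval : analyticGerms →ₐ[ℂ] ℂ where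
  toFun g := (g : Germ (𝓝 (0 : ℂ × ℂ)) ℂ).value
  map_one' := rfl
  map_zero' := rfl
  map_add' a b := by
    obtain ⟨f, hf, rfl⟩ := exists_of a
    obtain ⟨g, hg, rfl⟩ := exists_of b
    rfl
  map_mul' a b := by
    obtain ⟨f, hf, rfl⟩ := exists_of a
    obtain ⟨g, hg, rfl⟩ := exists_of b
    rfl
  commutes' _ := rfl

theorem eval_of {f : ℂ × ℂ → ℂ} (hf : AnalyticAt ℂ f 0) : eval (of f hf) = f 0 := rfl

theorem partialDeriv_congr (v : ℂ × ℂ) {f g : ℂ × ℂ → ℂ} (h : f =ᶠ[𝓝 0] g) :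
    partialDeriv v f =ᶠ[𝓝 0] partialDeriv v g := by
  filter_upwards [h.fderiv (𝕜 := ℂ)] with p hp
  simp [partialDeriv, hp]

theorem eventually_differentiableAt {f : ℂ × ℂ → ℂ} (hf : AnalyticAt ℂ f 0) :
    ∀ᶠ p in 𝓝 (0 : ℂ × ℂ), DifferentiableAt ℂ f p :=
  hf.eventually_analyticAt.mono fun _ h => h.differentiableAt

/-- The partial derivative of a germ, on a chosen representative. -/
def derivFun (v : ℂ × ℂ) (g : analyticGerms) : analyticGerms :=
  of (partialDeriv v (exists_of g).choose) (analyticAt_partialDeriv v (exists_of g).choose_spec.choose)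

theorem derivFun_of (v : ℂ × ℂ) {f : ℂ × ℂ → ℂ} (hf : AnalyticAt ℂ f 0) :
    derivFun v (of f hf) = of (partialDeriv v f) (analyticAt_partialDeriv v hf) := by
  rw [derivFun, of_eq_of]
  apply partialDeriv_congr
  have h := (exists_of (of f hf)).choose_spec.choose_spec
  exact ((of_eq_of _ _).1 h).symm

/-- The partial derivative in the direction `v`, as a derivation of `ℂ{x, y}`. -/
def deriv (v : ℂ × ℂ) : Derivation ℂ analyticGerms analyticGerms :=
  Derivation.mk'
    { toFun := derivFun v
      map_add' := by
        intro a b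
        obtain ⟨f, hf, rfl⟩ := exists_of a
        obtain ⟨g, hg, rfl⟩ := exists_of b
        rw [of_add, derivFun_of, derivFun_of, derivFun_of, of_add, of_eq_of]
        filter_upwards [eventually_differentiableAt hf, eventually_differentiableAt hg] with p h1 h2
        simp [partialDeriv, fderiv_add h1 h2]
      map_smul' := by
        intro c a
        obtain ⟨f, hf, rfl⟩ := exists_of a
        rw [smul_of, derivFun_of, derivFun_of, RingHom.id_apply, smul_of, of_eq_of]
        filter_upwards [eventually_differentiableAt hf] with p h1
        simp [partialDeriv, fderiv_const_mul h1] }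
    (by
      intro a b
      obtain ⟨f, hf, rfl⟩ := exists_of a
      obtain ⟨g, hg, rfl⟩ := exists_of b
      change derivFun v _ = _ • derivFun v _ + _ • derivFun v _
      rw [of_mul, derivFun_of, derivFun_of, derivFun_of, smul_eq_mul, smul_eq_mul, of_mul, of_mul,
        of_add, of_eq_of]
      filter_upwards [eventually_differentiableAt hf, eventually_differentiableAt hg] with p h1 h2
      simp [partialDeriv, fderiv_mul h1 h2])

theorem deriv_of (v : ℂ × ℂ) {f : ℂ × ℂ → ℂ} (hf : AnalyticAt ℂ f 0) :
    deriv v (of f hf) = of (partialDeriv v f) (analyticAt_partialDeriv v hf) :=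
  derivFun_of v hf

theorem deriv_comm (v w : ℂ × ℂ) (g : analyticGerms) :
    deriv v (deriv w g) = deriv w (deriv v g) := by
  obtain ⟨f, hf, rfl⟩ := exists_of g
  simp only [deriv_of]
  rw [of_eq_of]
  filter_upwards [hf.eventually_analyticAt] with p hp
  have h2 : DifferentiableAt ℂ (fderiv ℂ f) p := hp.fderiv.differentiableAt
  have hs : IsSymmSndFDerivAt ℂ f p :=
    (hp.contDiffAt (n := ⊤)).isSymmSndFDerivAt (by simp)
  have key : ∀ v w, partialDeriv v (partialDeriv w f) p = fderiv ℂ (fderiv ℂ f) p v w := by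
    intro v w
    change fderiv ℂ (fun q => fderiv ℂ f q w) p v = _
    rw [fderiv_clm_apply h2 (differentiableAt_const w)]
    simp
  rw [key, key]
  exact hs v w

theorem deriv_eq (v : ℂ × ℂ) (g : analyticGerms) :
    deriv v g = v.1 • deriv (1, 0) g + v.2 • deriv (0, 1) g := by
  obtain ⟨f, hf, rfl⟩ := exists_of g
  simp only [deriv_of, smul_of, of_add]
  rw [of_eq_of]
  refine Eventually.of_forall fun p => ?_
  have : v = v.1 • ((1, 0) : ℂ × ℂ) + v.2 • ((0, 1) : ℂ × ℂ) := by ext <;> simp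
  change fderiv ℂ f p v = v.1 * fderiv ℂ f p (1, 0) + v.2 * fderiv ℂ f p (0, 1)
  conv_lhs => rw [this]
  rw [map_add, map_smul, map_smul, smul_eq_mul, smul_eq_mul]

/-- The iterated Fréchet derivative at the origin is an iterated partial derivative. -/
theorem iteratedFDeriv_succ_apply {f : ℂ × ℂ → ℂ} (hf : AnalyticAt ℂ f 0) (n : ℕ)
    (m : Fin (n + 1) → ℂ × ℂ) :
    iteratedFDeriv ℂ (n + 1) f 0 m =
      iteratedFDeriv ℂ n (partialDeriv (m (Fin.last n)) f) 0 (Fin.init m) := by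
  rw [iteratedFDeriv_succ_apply_right]
  have h := ContinuousLinearMap.iteratedFDeriv_comp_left (𝕜 := ℂ) (n := ⊤)
    (ContinuousLinearMap.apply ℂ ℂ (m (Fin.last n))) (f := fderiv ℂ f) (x := 0)
    hf.fderiv.contDiffAt (i := n) (by simp)
  change _ = iteratedFDeriv ℂ n (⇑(ContinuousLinearMap.apply ℂ ℂ (m (Fin.last n))) ∘ fderiv ℂ f)
    0 (Fin.init m)
  rw [h]
  rfl

theorem iteratedFDeriv_const {f : ℂ × ℂ → ℂ} (hf : AnalyticAt ℂ f 0) (n : ℕ) (v : ℂ × ℂ) :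
    iteratedFDeriv ℂ n f 0 (fun _ => v) = eval ((deriv v)^[n] (of f hf)) := by
  induction n generalizing f with
  | zero => simp [eval_of]
  | succ n ih =>
    rw [iteratedFDeriv_succ_apply hf]
    change iteratedFDeriv ℂ n (partialDeriv v f) 0 (fun _ => v) = _
    rw [ih (analyticAt_partialDeriv v hf), Function.iterate_succ_apply, deriv_of]

theorem iteratedFDeriv_mixed {f : ℂ × ℂ → ℂ} (hf : AnalyticAt ℂ f 0) (i j : ℕ) :
    iteratedFDeriv ℂ (i + j) f 0 (fun k => if (k : ℕ) < i then ((1, 0) : ℂ × ℂ) else (0, 1)) =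
      eval ((deriv (1, 0))^[i] ((deriv (0, 1))^[j] (of f hf))) := by
  induction j generalizing f with
  | zero =>
    rw [Function.iterate_zero, id, ← iteratedFDeriv_const]
    congr 1
    funext k
    simp
  | succ j ih =>
    have h := iteratedFDeriv_succ_apply hf (i + j)
      (fun k => if (k : ℕ) < i then ((1, 0) : ℂ × ℂ) else (0, 1))
    refine h.trans ?_
    have h1 : (if ((Fin.last (i + j) : Fin (i + j + 1)) : ℕ) < i then ((1, 0) : ℂ × ℂ)
        else (0, 1)) = (0, 1) := by simp
    rw [h1, Function.iterate_succ_apply, deriv_of, ← ih]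
    rfl

/-- The Taylor expansion of a germ at the origin, a power series in `y` whose coefficients are
power series in `x`. -/
def taylor : analyticGerms →+* ℂ⟦X⟧⟦X⟧ :=
  (PowerSeries.map ((PowerSeries.map (eval : analyticGerms →+* ℂ)).comp
    (deriv (1, 0)).taylor)).comp (deriv (0, 1)).taylor

theorem iterate_deriv_smul (v : ℂ × ℂ) (n : ℕ) (c : ℂ) (g : analyticGerms) :
    (deriv v)^[n] (c • g) = c • (deriv v)^[n] g := by
  induction n generalizing g with
  | zero => rfl
  | succ n ih =>
    rw [Function.iterate_succ_apply, (deriv v).map_smul, ih, Function.iterate_succ_apply]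

theorem coeff_taylor (g : analyticGerms) (i j : ℕ) :
    coeff i (coeff j (taylor g)) = ((i.factorial : ℂ)⁻¹ * (j.factorial : ℂ)⁻¹) *
      eval ((deriv (1, 0))^[i] ((deriv (0, 1))^[j] g)) := by
  simp only [taylor, RingHom.comp_apply, coeff_map, Derivation.coeff_taylor]
  rw [iterate_deriv_smul, smul_smul]
  exact (map_smul eval _ _)

theorem taylor_smul (c : ℂ) (g : analyticGerms) : taylor (c • g) = c • taylor g := by
  ext j i
  simp only [coeff_taylor, PowerSeries.coeff_smul, iterate_deriv_smul, map_smul, smul_eq_mul]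
  ring

/-- Expansion of the power of a directional derivative by the binomial theorem. -/
theorem iterate_deriv_eq_sum (v : ℂ × ℂ) (n : ℕ) (g : analyticGerms) :
    ((n.factorial : ℂ)⁻¹) • eval ((deriv v)^[n] g) =
      ∑ p ∈ Finset.HasAntidiagonal.antidiagonal n,
        coeff p.1 (coeff p.2 (taylor g)) * v.1 ^ p.1 * v.2 ^ p.2 := by
  set A : Module.End ℂ analyticGerms := (deriv (1, 0) : analyticGerms →ₗ[ℂ] analyticGerms)
  set B : Module.End ℂ analyticGerms := (deriv (0, 1) : analyticGerms →ₗ[ℂ] analyticGerms)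
  have hAB : Commute A B := by
    ext1 g
    exact deriv_comm _ _ g
  have hcomm : Commute (v.1 • A) (v.2 • B) := (hAB.smul_left _).smul_right _
  have hV : (deriv v : analyticGerms →ₗ[ℂ] analyticGerms) = v.1 • A + v.2 • B := by
    ext1 g
    exact deriv_eq v g
  have h1 : (deriv v)^[n] g = ((v.1 • A + v.2 • B) ^ n) g := by
    rw [← hV, Module.End.pow_apply]
    rfl
  rw [h1, hcomm.add_pow', LinearMap.sum_apply, map_sum, Finset.smul_sum]
  refine Finset.sum_congr rfl fun p hp => ?_
  rw [Finset.HasAntidiagonal.mem_antidiagonal] at hp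
  have h2 : (((v.1 • A) ^ p.1 * (v.2 • B) ^ p.2) : Module.End ℂ analyticGerms) g =
      (v.1 ^ p.1 * v.2 ^ p.2) • ((deriv (1, 0))^[p.1] ((deriv (0, 1))^[p.2] g)) := by
    rw [smul_pow, smul_pow, smul_mul_smul_comm, LinearMap.smul_apply, Module.End.mul_apply,
      Module.End.pow_apply, Module.End.pow_apply]
    rfl
  rw [LinearMap.smul_apply, h2, map_nsmul, map_smul, coeff_taylor, smul_eq_mul, smul_eq_mul,
    nsmul_eq_mul]
  have h3 := Nat.add_choose_mul_factorial_mul_factorial p.1 p.2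
  rw [hp, ← Nat.choose_symm_of_eq_add hp.symm] at h3
  have h4 : ((n.choose p.1 : ℕ) : ℂ) * (p.1.factorial : ℂ) * (p.2.factorial : ℂ) = n.factorial := by
    exact_mod_cast h3
  have e1 : (p.1.factorial : ℂ) ≠ 0 := by exact_mod_cast p.1.factorial_ne_zero
  have e2 : (p.2.factorial : ℂ) ≠ 0 := by exact_mod_cast p.2.factorial_ne_zero
  have e3 : (n.factorial : ℂ) ≠ 0 := by exact_mod_cast n.factorial_ne_zero
  field_simp
  rw [← h4]
  ring

end analyticGerms

end

noncomputable section

open PowerSeries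

/-- The coefficients of a double power series grow at most geometrically, that is, the series
converges in a neighbourhood of the origin. -/
def IsGeometric (s : ℂ⟦X⟧⟦X⟧) : Prop :=
  ∃ C R : ℝ, 0 < C ∧ 0 < R ∧ ∀ i j, ‖coeff i (coeff j s)‖ ≤ C * R ^ (i + j)

/-- The value at `p` of the monomial of index `n` of a double power series. -/
def monomialTerm (s : ℂ⟦X⟧⟦X⟧) (p : ℂ × ℂ) (n : ℕ × ℕ) : ℂ :=
  coeff n.1 (coeff n.2 s) * p.1 ^ n.1 * p.2 ^ n.2

theorem IsGeometric.summable {s : ℂ⟦X⟧⟦X⟧} (hs : IsGeometric s) :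
    ∀ᶠ p in 𝓝 (0 : ℂ × ℂ), Summable (monomialTerm s p) := by
  obtain ⟨C, R, hC, hR, h⟩ := hs
  have h0 : ∀ᶠ p in 𝓝 (0 : ℂ × ℂ), p ∈ Metric.ball (0 : ℂ × ℂ) (1 / (2 * R)) :=
    Metric.ball_mem_nhds _ (by positivity)
  filter_upwards [h0] with p hp
  rw [mem_ball_zero_iff] at hp
  have hg : Summable (fun n : ℕ => ((1 : ℝ) / 2) ^ n) := summable_geometric_two
  have hgg := (hg.mul_of_nonneg hg (fun _ => by positivity) (fun _ => by positivity)).mul_left C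
  refine Summable.of_norm_bounded hgg fun n => ?_
  have h1 : R * ‖p.1‖ ≤ 1 / 2 := by
    have := (norm_fst_le p).trans hp.le
    calc R * ‖p.1‖ ≤ R * (1 / (2 * R)) := by gcongr
      _ = 1 / 2 := by field_simp
  have h2 : R * ‖p.2‖ ≤ 1 / 2 := by
    have := (norm_snd_le p).trans hp.le
    calc R * ‖p.2‖ ≤ R * (1 / (2 * R)) := by gcongr
      _ = 1 / 2 := by field_simp
  rw [monomialTerm, norm_mul, norm_mul, norm_pow, norm_pow]
  calc ‖coeff n.1 (coeff n.2 s)‖ * ‖p.1‖ ^ n.1 * ‖p.2‖ ^ n.2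
      ≤ (C * R ^ (n.1 + n.2)) * ‖p.1‖ ^ n.1 * ‖p.2‖ ^ n.2 := by gcongr; exact h _ _
    _ = C * ((R * ‖p.1‖) ^ n.1 * (R * ‖p.2‖) ^ n.2) := by rw [mul_pow, mul_pow, pow_add]; ring
    _ ≤ C * ((1 / 2) ^ n.1 * (1 / 2) ^ n.2) := by gcongr

theorem hasSum_monomialTerm {s : ℂ⟦X⟧⟦X⟧} {p : ℂ × ℂ} (hs : Summable (monomialTerm s p)) {a : ℂ}
    (h : HasSum (fun n => ∑ q ∈ Finset.HasAntidiagonal.antidiagonal n, monomialTerm s p q) a) :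
    HasSum (monomialTerm s p) a := by
  have h1 := hs.hasSum
  rw [← Finset.HasAntidiagonal.sigmaAntidiagonalEquivProd.hasSum_iff] at h1
  have h2 := h1.sigma (fun n => hasSum_fintype _)
  have h3 : ∀ n : ℕ, ∑ c : ↥(Finset.HasAntidiagonal.antidiagonal n),
      (monomialTerm s p ∘ Finset.HasAntidiagonal.sigmaAntidiagonalEquivProd) ⟨n, c⟩ =
      ∑ q ∈ Finset.HasAntidiagonal.antidiagonal n, monomialTerm s p q := by
    intro n
    rw [← Finset.sum_coe_sort _ (monomialTerm s p)]
    exact Finset.sum_congr rfl fun c _ => rfl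
  simp only [h3] at h2
  rw [h.unique h2]
  exact hs.hasSum

namespace analyticGerms

theorem isGeometric_taylor (g : analyticGerms) : IsGeometric (taylor g) := by
  obtain ⟨f, hf, rfl⟩ := exists_of g
  obtain ⟨p, r, hp⟩ := id hf
  obtain ⟨C, a, hC, ha, hb⟩ := p.le_mul_pow_of_radius_pos (hp.r_pos.trans_le hp.r_le)
  refine ⟨C, 2 * a, hC, by positivity, fun i j => ?_⟩
  rw [coeff_taylor, ← iteratedFDeriv_mixed, hp.iteratedFDeriv_eq_sum_of_completeSpace]
  have h1 : ‖∑ σ : Equiv.Perm (Fin (i + j)), p (i + j) (fun k =>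
      (fun k : Fin (i + j) => if (k : ℕ) < i then ((1, 0) : ℂ × ℂ) else (0, 1)) (σ k))‖ ≤
      ((i + j).factorial : ℝ) * (C * a ^ (i + j)) := by
    refine (norm_sum_le _ _).trans
      ((Finset.sum_le_sum (g := fun _ => C * a ^ (i + j)) fun σ _ => ?_).trans ?_)
    · refine ((p (i + j)).le_opNorm _).trans ?_
      rw [Finset.prod_eq_one, mul_one]
      · exact hb _
      · intro k _
        dsimp only
        split_ifs <;> simp [Prod.norm_def]
    · simp [Fintype.card_perm]
  rw [norm_mul, norm_mul, norm_inv, norm_inv, Complex.norm_natCast, Complex.norm_natCast]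
  have h2 : ((i + j).choose i : ℝ) ≤ 2 ^ (i + j) := by
    exact_mod_cast Nat.choose_le_two_pow (i + j) i
  have h3 : ((i + j).choose i : ℝ) * i.factorial * j.factorial = (i + j).factorial := by
    have := Nat.add_choose_mul_factorial_mul_factorial i j
    rw [← Nat.choose_symm_add] at this
    exact_mod_cast this
  have e1 : (0 : ℝ) < i.factorial := by exact_mod_cast i.factorial_pos
  have e2 : (0 : ℝ) < j.factorial := by exact_mod_cast j.factorial_pos
  calc _ ≤ ((i.factorial : ℝ)⁻¹ * (j.factorial : ℝ)⁻¹) *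
        (((i + j).factorial : ℝ) * (C * a ^ (i + j))) := by gcongr
    _ = ((i + j).choose i : ℝ) * (C * a ^ (i + j)) := by rw [← h3]; field_simp
    _ ≤ 2 ^ (i + j) * (C * a ^ (i + j)) := by gcongr
    _ = C * (2 * a) ^ (i + j) := by rw [mul_pow]; ring

/-- An analytic function is the sum of its Taylor series. -/
theorem hasSum_taylor {f : ℂ × ℂ → ℂ} (hf : AnalyticAt ℂ f 0) :
    ∀ᶠ p in 𝓝 (0 : ℂ × ℂ), HasSum (monomialTerm (taylor (of f hf)) p) (f p) := by
  obtain ⟨q, r, hq⟩ := id hf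
  have h0 : ∀ᶠ p in 𝓝 (0 : ℂ × ℂ), p ∈ Metric.eball (0 : ℂ × ℂ) r :=
    Metric.eball_mem_nhds _ hq.r_pos
  filter_upwards [h0, (isGeometric_taylor (of f hf)).summable] with p hp hs
  apply hasSum_monomialTerm hs
  have h := hq.hasSum_iteratedFDeriv hp
  rw [zero_add] at h
  simp only [iteratedFDeriv_const hf, iterate_deriv_eq_sum] at h
  exact h

theorem taylor_injective : Function.Injective taylor := by
  rw [injective_iff_map_eq_zero]
  intro g hg
  obtain ⟨f, hf, rfl⟩ := exists_of g
  have h : of f hf = of (fun _ => 0) analyticAt_const := by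
    rw [of_eq_of]
    filter_upwards [hasSum_taylor hf] with p hp
    rw [hg] at hp
    have : monomialTerm 0 p = fun _ => 0 := by
      funext n
      simp [monomialTerm]
    rw [this] at hp
    exact hp.unique hasSum_zero
  rw [h]
  rfl

instance : IsDomain analyticGerms := taylor_injective.isDomain taylor

/-- Uniqueness of the Taylor series: a homogeneous expansion determines the coefficients. -/
theorem coeff_eq_of_sum_eq (a b : ℕ × ℕ → ℂ) (n : ℕ)
    (h : ∀ x : ℂ, ∑ q ∈ Finset.HasAntidiagonal.antidiagonal n, a q * x ^ q.1 =
      ∑ q ∈ Finset.HasAntidiagonal.antidiagonal n, b q * x ^ q.1) {i j : ℕ} (hij : i + j = n) :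
    a (i, j) = b (i, j) := by
  let P : (ℕ × ℕ → ℂ) → Polynomial ℂ := fun c =>
    ∑ q ∈ Finset.HasAntidiagonal.antidiagonal n, Polynomial.C (c q) * Polynomial.X ^ q.1
  have hP : P a = P b := by
    apply Polynomial.funext
    intro x
    simpa [P, Polynomial.eval_finsetSum] using h x
  have hc : ∀ c : ℕ × ℕ → ℂ, (P c).coeff i = c (i, j) := by
    intro c
    simp only [P, Polynomial.finsetSum_coeff, Polynomial.coeff_C_mul_X_pow]
    rw [Finset.sum_eq_single (i, j)]
    · simp
    · intro q hq hne
      rw [Finset.HasAntidiagonal.mem_antidiagonal] at hq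
      rw [if_neg]
      rintro rfl
      apply hne
      ext
      · rfl
      · change q.2 = j
        omega
    · intro hq
      exact absurd (Finset.HasAntidiagonal.mem_antidiagonal.2 hij) hq
  rw [← hc a, ← hc b, hP]

/-- The homogeneous part of degree `n` of a double power series, as a multilinear map. -/
def homogeneousPart (s : ℂ⟦X⟧⟦X⟧) (n : ℕ) :
    ContinuousMultilinearMap ℂ (fun _ : Fin n => ℂ × ℂ) ℂ :=
  ∑ q ∈ Finset.HasAntidiagonal.antidiagonal n, coeff q.1 (coeff q.2 s) •
    (ContinuousMultilinearMap.mkPiAlgebra ℂ (Fin n) ℂ).compContinuousLinearMap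
      (fun k => if (k : ℕ) < q.1 then ContinuousLinearMap.fst ℂ ℂ ℂ
        else ContinuousLinearMap.snd ℂ ℂ ℂ)

theorem homogeneousPart_apply (s : ℂ⟦X⟧⟦X⟧) (n : ℕ) (p : ℂ × ℂ) :
    homogeneousPart s n (fun _ => p) =
      ∑ q ∈ Finset.HasAntidiagonal.antidiagonal n, monomialTerm s p q := by
  simp only [homogeneousPart, _root_.sum_apply]
  refine Finset.sum_congr rfl fun q hq => ?_
  rw [Finset.HasAntidiagonal.mem_antidiagonal] at hq
  subst hq
  simp only [_root_.smul_apply, monomialTerm, smul_eq_mul, mul_assoc,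
    ContinuousMultilinearMap.compContinuousLinearMap_apply,
    ContinuousMultilinearMap.mkPiAlgebra_apply]
  congr 1
  have h : ∀ k : Fin (q.1 + q.2), ((if (k : ℕ) < q.1 then ContinuousLinearMap.fst ℂ ℂ ℂ
      else ContinuousLinearMap.snd ℂ ℂ ℂ) p) = if (k : ℕ) < q.1 then p.1 else p.2 := by
    intro k
    split_ifs <;> rfl
  simp only [h]
  rw [Fin.prod_univ_add]
  simp

theorem norm_homogeneousPart_le (s : ℂ⟦X⟧⟦X⟧) (n : ℕ) {C R : ℝ}
    (h : ∀ i j, ‖coeff i (coeff j s)‖ ≤ C * R ^ (i + j)) :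
    ‖homogeneousPart s n‖ ≤ (n + 1) * (C * R ^ n) := by
  rw [homogeneousPart]
  refine (norm_sum_le _ _).trans
    ((Finset.sum_le_sum (g := fun _ => C * R ^ n) fun q hq => ?_).trans ?_)
  · rw [Finset.HasAntidiagonal.mem_antidiagonal] at hq
    rw [norm_smul]
    have h1 := h q.1 q.2
    rw [hq] at h1
    refine (mul_le_of_le_one_right (norm_nonneg _) ?_).trans h1
    refine (ContinuousMultilinearMap.norm_compContinuousLinearMap_le _ _).trans ?_
    rw [ContinuousMultilinearMap.norm_mkPiAlgebra, one_mul]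
    apply Finset.prod_le_one (fun _ _ => norm_nonneg _)
    intro k _
    split_ifs
    · exact ContinuousLinearMap.norm_fst_le _ _ _
    · exact ContinuousLinearMap.norm_snd_le _ _ _
  · simp

/-- A convergent double power series is the Taylor series of an analytic function. -/
theorem exists_taylor_eq {s : ℂ⟦X⟧⟦X⟧} (hs : IsGeometric s) :
    ∃ (f : ℂ × ℂ → ℂ) (hf : AnalyticAt ℂ f 0), taylor (of f hf) = s := by
  obtain ⟨C, R, hC, hR, h⟩ := hs
  let p : FormalMultilinearSeries ℂ (ℂ × ℂ) ℂ := fun n => homogeneousPart s n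
  have hrad : 0 < p.radius := by
    let r : NNReal := ⟨1 / (2 * R), by positivity⟩
    have hr : (0 : ENNReal) < r := by
      rw [ENNReal.coe_pos]
      exact NNReal.coe_pos.1 (by change (0 : ℝ) < 1 / (2 * R); positivity)
    refine hr.trans_le (p.le_radius_of_bound C fun n => ?_)
    change ‖homogeneousPart s n‖ * (1 / (2 * R)) ^ n ≤ C
    have h1 := norm_homogeneousPart_le s n h
    have h2 : ((n : ℝ) + 1) ≤ 2 ^ n := by
      exact_mod_cast Nat.lt_two_pow_self (n := n)
    calc ‖homogeneousPart s n‖ * (1 / (2 * R)) ^ n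
        ≤ (2 ^ n * (C * R ^ n)) * (1 / (2 * R)) ^ n := by
          gcongr
          exact h1.trans (by gcongr)
      _ = C := by
          rw [one_div, inv_pow, mul_pow]
          field_simp
  have hp := p.hasFPowerSeriesOnBall hrad
  refine ⟨p.sum, hp.analyticAt, ?_⟩
  ext j i
  refine coeff_eq_of_sum_eq (fun q => coeff q.1 (coeff q.2 (taylor (of p.sum hp.analyticAt))))
    (fun q => coeff q.1 (coeff q.2 s)) (i + j) (fun x => ?_) rfl
  have h1 := iterate_deriv_eq_sum (x, 1) (i + j) (of p.sum hp.analyticAt)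
  rw [← iteratedFDeriv_const hp.analyticAt, ← hp.factorial_smul] at h1
  have h2 : p (i + j) (fun _ => (x, 1)) = _ := homogeneousPart_apply s (i + j) (x, 1)
  rw [h2] at h1
  have h3 : (((i + j).factorial : ℂ)) ≠ 0 := by exact_mod_cast (i + j).factorial_ne_zero
  rw [nsmul_eq_mul, smul_eq_mul, inv_mul_cancel_left₀ h3] at h1
  simp only [monomialTerm, one_pow, mul_one] at h1
  exact h1.symm

/-- The sum of a convergent double power series is analytic, and its Taylor series is the given
series. -/
theorem analyticAt_and_taylor_eq {s : ℂ⟦X⟧⟦X⟧} (hs : IsGeometric s) {f : ℂ × ℂ → ℂ}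
    (hf : ∀ᶠ p in 𝓝 (0 : ℂ × ℂ), HasSum (monomialTerm s p) (f p)) :
    ∃ h : AnalyticAt ℂ f 0, taylor (of f h) = s := by
  obtain ⟨g, hg, h⟩ := exists_taylor_eq hs
  have hfg : g =ᶠ[𝓝 0] f := by
    filter_upwards [hf, hasSum_taylor hg] with p h1 h2
    rw [h] at h2
    exact h2.unique h1
  have hfa := hg.congr hfg
  refine ⟨hfa, ?_⟩
  rw [← h]
  congr 1
  rw [of_eq_of]
  exact hfg.symm

/-- The formal partial derivative with respect to `x`. -/
def _root_.PowerSeries.derivX (s : ℂ⟦X⟧⟦X⟧) : ℂ⟦X⟧⟦X⟧ :=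
  PowerSeries.mk fun j => d⁄dX ℂ (coeff j s)

theorem taylor_deriv_snd (g : analyticGerms) :
    taylor (deriv (0, 1) g) = d⁄dX (ℂ⟦X⟧) (taylor g) := by
  ext j i
  have h : ((j : ℂ⟦X⟧) + 1) = C ((j : ℂ) + 1) := by simp
  rw [coeff_derivative, h, mul_comm, coeff_C_mul, coeff_taylor, coeff_taylor,
    Function.iterate_succ_apply, Nat.factorial_succ]
  have e1 : (i.factorial : ℂ) ≠ 0 := by exact_mod_cast i.factorial_ne_zero
  have e2 : (j.factorial : ℂ) ≠ 0 := by exact_mod_cast j.factorial_ne_zero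
  have e3 : (j : ℂ) + 1 ≠ 0 := by exact_mod_cast Nat.succ_ne_zero j
  push_cast
  field_simp

theorem taylor_deriv_fst (g : analyticGerms) :
    taylor (deriv (1, 0) g) = (taylor g).derivX := by
  ext j i
  have hc : (deriv (0, 1))^[j] (deriv (1, 0) g) = deriv (1, 0) ((deriv (0, 1))^[j] g) :=
    (Function.Commute.iterate_left (f := deriv (0, 1)) (g := deriv (1, 0))
      (fun g => deriv_comm _ _ g) j) g
  rw [derivX, coeff_mk, coeff_derivative, coeff_taylor, coeff_taylor, hc,
    ← Function.iterate_succ_apply, Nat.factorial_succ]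
  have e1 : (i.factorial : ℂ) ≠ 0 := by exact_mod_cast i.factorial_ne_zero
  have e2 : (j.factorial : ℂ) ≠ 0 := by exact_mod_cast j.factorial_ne_zero
  have e3 : (i : ℂ) + 1 ≠ 0 := by exact_mod_cast Nat.succ_ne_zero i
  push_cast
  field_simp

end analyticGerms

end

/-! ### Division and descent for analytic germs -/

noncomputable section

open PowerSeries

theorem IsGeometric.exists_one_le {s : ℂ⟦X⟧⟦X⟧} (hs : IsGeometric s) :
    ∃ C R : ℝ, 0 < C ∧ 1 ≤ R ∧ ∀ i j, ‖coeff i (coeff j s)‖ ≤ C * R ^ (i + j) := by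
  obtain ⟨C, R, hC, hR, h⟩ := hs
  refine ⟨C, max R 1, hC, le_max_right _ _, fun i j => (h i j).trans ?_⟩
  gcongr
  exact le_max_left _ _

/-- The shift `∑ c_{i,j} xⁱ yʲ ↦ ∑ c_{i+a,j+b} xⁱ yʲ`. -/
def PowerSeries.shift (a b : ℕ) (s : ℂ⟦X⟧⟦X⟧) : ℂ⟦X⟧⟦X⟧ :=
  PowerSeries.mk fun j => PowerSeries.mk fun i => coeff (i + a) (coeff (j + b) s)

theorem IsGeometric.shift {s : ℂ⟦X⟧⟦X⟧} (hs : IsGeometric s) (a b : ℕ) :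
    IsGeometric (s.shift a b) := by
  obtain ⟨C, R, hC, hR, h⟩ := hs
  refine ⟨C * R ^ (a + b), R, by positivity, hR, fun i j => ?_⟩
  simp only [PowerSeries.shift, coeff_mk]
  refine (h _ _).trans (le_of_eq ?_)
  ring

/-- The power series expansion at the origin of a function of one variable. -/
def taylorSeries (φ : ℂ → ℂ) : ℂ⟦X⟧ :=
  PowerSeries.mk fun n => (n.factorial : ℂ)⁻¹ * iteratedDeriv n φ 0

theorem AnalyticAt.comp_of_map_zero {E F G : Type*} [NormedAddCommGroup E] [NormedSpace ℂ E]
    [NormedAddCommGroup F] [NormedSpace ℂ F] [NormedAddCommGroup G] [NormedSpace ℂ G]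
    {f : F → G} {g : E → F} (hf : AnalyticAt ℂ f 0) (hg : AnalyticAt ℂ g 0) (h0 : g 0 = 0) :
    AnalyticAt ℂ (fun p => f (g p)) 0 :=
  AnalyticAt.fun_comp (by rw [h0]; exact hf) hg

theorem ContinuousAt.tendsto_of_map_zero {E F : Type*} [TopologicalSpace E] [Zero E]
    [TopologicalSpace F] [Zero F] {g : E → F} (hg : ContinuousAt g 0) (h0 : g 0 = 0) :
    Tendsto g (𝓝 0) (𝓝 0) := by
  simpa only [ContinuousAt, h0] using hg

/-- The substitution `x = t ^ m` in double power series. -/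
def PowerSeries.expandX (m : ℕ) (hm : m ≠ 0) : ℂ⟦X⟧⟦X⟧ →+* ℂ⟦X⟧⟦X⟧ :=
  PowerSeries.map ((expand m hm : ℂ⟦X⟧ →ₐ[ℂ] ℂ⟦X⟧) : ℂ⟦X⟧ →+* ℂ⟦X⟧)

theorem PowerSeries.coeff_expandX (m : ℕ) (hm : m ≠ 0) (s : ℂ⟦X⟧⟦X⟧) (j : ℕ) :
    coeff j (expandX m hm s) = expand m hm (coeff j s) := by
  rw [expandX, coeff_map]
  rfl

theorem analyticAt_comp_fst {φ : ℂ → ℂ} (hφ : AnalyticAt ℂ φ 0) :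
    AnalyticAt ℂ (fun p : ℂ × ℂ => φ p.1) 0 :=
  AnalyticAt.comp_of_map_zero hφ analyticAt_fst rfl

namespace analyticGerms

theorem coeff_taylor_comp_fst {φ : ℂ → ℂ} (hφ : AnalyticAt ℂ φ 0) :
    taylor (of (fun p => φ p.1) (analyticAt_comp_fst hφ)) = C (taylorSeries φ) := by
  have hy : deriv (0, 1) (of (fun p => φ p.1) (analyticAt_comp_fst hφ)) = 0 := by
    rw [deriv_of]
    change _ = of (fun _ => 0) analyticAt_const
    rw [of_eq_of]
    have h := (tendsto_fst (f := 𝓝 (0 : ℂ)) (g := 𝓝 (0 : ℂ))).eventually hφ.eventually_analyticAt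
    rw [← nhds_prod_eq] at h
    filter_upwards [h] with p hp
    have hc : (fun q : ℂ × ℂ => φ q.1) = φ ∘ Prod.fst := rfl
    simp only [partialDeriv]
    rw [hc, fderiv_comp _ hp.differentiableAt differentiableAt_fst]
    simp [fderiv_fst]
  have hx : ∀ i, ∀ {φ : ℂ → ℂ} (hφ : AnalyticAt ℂ φ 0),
      eval ((deriv (1, 0))^[i] (of (fun p => φ p.1) (analyticAt_comp_fst hφ))) =
        iteratedDeriv i φ 0 := by
    intro i
    induction i with
    | zero => intro φ hφ; simp [eval_of]
    | succ i ih =>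
      intro φ hφ
      rw [Function.iterate_succ_apply, deriv_of, iteratedDeriv_succ', ← ih hφ.deriv]
      congr 2
      rw [of_eq_of]
      have h := (tendsto_fst (f := 𝓝 (0 : ℂ)) (g := 𝓝 (0 : ℂ))).eventually hφ.eventually_analyticAt
      rw [← nhds_prod_eq] at h
      filter_upwards [h] with p hp
      have hc : (fun q : ℂ × ℂ => φ q.1) = φ ∘ Prod.fst := rfl
      simp only [partialDeriv]
      rw [hc, fderiv_comp _ hp.differentiableAt differentiableAt_fst]
      simp [fderiv_fst]
  ext j i
  rw [coeff_taylor]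
  cases j with
  | zero => simp [hx i hφ, taylorSeries]
  | succ j =>
    rw [Function.iterate_succ_apply, hy, iterate_map_zero, iterate_map_zero, map_zero, mul_zero,
      coeff_C, if_neg (Nat.succ_ne_zero j), map_zero]

theorem taylor_fst : taylor (of (fun p => p.1) analyticAt_fst) = C X := by
  refine (coeff_taylor_comp_fst (φ := id) analyticAt_id).trans ?_
  congr 1
  ext n
  rw [taylorSeries, coeff_mk, coeff_X]
  rcases n with _ | _ | n
  · simp
  · simp
  · rw [iteratedDeriv_succ', iteratedDeriv_succ']
    have h : _root_.deriv (id : ℂ → ℂ) = fun _ => 1 := by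
      funext x
      simp
    have h2 : _root_.deriv (fun _ : ℂ => (1 : ℂ)) = fun _ => 0 := by
      funext x
      simp
    rw [h, h2, iteratedDeriv_const]
    simp

theorem taylor_snd : taylor (of (fun p => p.2) analyticAt_snd) = X := by
  have hs : IsGeometric X := by
    refine ⟨1, 1, one_pos, one_pos, fun i j => ?_⟩
    rw [coeff_X]
    split_ifs
    · rw [coeff_one]
      split_ifs <;> simp
    · simp
  obtain ⟨h, h2⟩ := analyticAt_and_taylor_eq hs (f := fun p => p.2) (by
    refine Eventually.of_forall fun p => ?_
    have := hasSum_single (f := monomialTerm X p) (0, 1) (fun n hn => ?_)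
    · simpa [monomialTerm] using this
    · rw [monomialTerm, coeff_X]
      split_ifs with h1
      · rw [coeff_one, if_neg, zero_mul, zero_mul]
        intro h0
        exact hn (Prod.ext h0 h1)
      · simp)
  exact h2

/-- A germ whose Taylor coefficients at `xⁱ yʲ` with `i < a` and `j < b` vanish lies in the ideal
generated by `x ^ a` and `y ^ b`. -/
theorem exists_eq_mul_add_mul (g : analyticGerms) (a b : ℕ)
    (h : ∀ i < a, ∀ j < b, coeff i (coeff j (taylor g)) = 0) :
    ∃ u v : analyticGerms, g = of (fun p => p.1) analyticAt_fst ^ a * u +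
      of (fun p => p.2) analyticAt_snd ^ b * v := by
  -- The monomials with `i ≥ a` go to the first summand, the remaining ones to the second.
  set s := taylor g with hs
  let s' : ℂ⟦X⟧⟦X⟧ := PowerSeries.mk fun j => PowerSeries.mk fun i =>
    if i < a then coeff i (coeff j s) else 0
  have hg : IsGeometric s := isGeometric_taylor g
  have hg' : IsGeometric s' := by
    obtain ⟨C, R, hC, hR, h⟩ := hg
    refine ⟨C, R, hC, hR, fun i j => ?_⟩
    simp only [s', coeff_mk]
    split_ifs
    · exact h i j
    · rw [norm_zero]
      positivity
  obtain ⟨u, hu, hu'⟩ := exists_taylor_eq (hg.shift a 0)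
  obtain ⟨v, hv, hv'⟩ := exists_taylor_eq (hg'.shift 0 b)
  refine ⟨of u hu, of v hv, taylor_injective ?_⟩
  rw [map_add, map_mul, map_mul, map_pow, map_pow, taylor_fst, taylor_snd, hu', hv', ← hs]
  ext j i
  rw [map_add, map_add, ← map_pow, coeff_C_mul, coeff_X_pow_mul', coeff_X_pow_mul']
  simp only [PowerSeries.shift, coeff_mk, s']
  by_cases hi : i < a
  · by_cases hj : j < b
    · rw [if_neg (by omega), if_neg (by omega), h i hi j hj]
      simp
    · rw [if_neg (by omega), if_pos (by omega), zero_add, coeff_mk, add_zero,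
        Nat.sub_add_cancel (by omega), if_pos hi]
  · rw [if_pos (by omega)]
    have h1 : i - a + a = i := by omega
    rw [h1, add_zero]
    split_ifs
    · simp [hi]
    · simp

/-- A germ vanishing on the `x`-axis is divisible by `y`. -/
theorem exists_eq_snd_mul {f : ℂ × ℂ → ℂ} (hf : AnalyticAt ℂ f 0)
    (h : ∀ᶠ x in 𝓝 (0 : ℂ), f (x, 0) = 0) :
    ∃ g : ℂ × ℂ → ℂ, AnalyticAt ℂ g 0 ∧ ∀ᶠ p in 𝓝 (0 : ℂ × ℂ), f p = p.2 * g p := by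
  have key : ∀ i, ∀ f : ℂ × ℂ → ℂ, ∀ hf : AnalyticAt ℂ f 0, (∀ᶠ x in 𝓝 (0 : ℂ), f (x, 0) = 0) →
      eval ((deriv (1, 0))^[i] (of f hf)) = 0 := by
    intro i
    induction i with
    | zero => intro f hf h; exact h.self_of_nhds
    | succ i ih =>
      intro f hf h
      rw [Function.iterate_succ_apply, deriv_of]
      apply ih
      have ht : Tendsto (fun x : ℂ => ((x, 0) : ℂ × ℂ)) (𝓝 0) (𝓝 0) := by
        have : Continuous (fun x : ℂ => ((x, 0) : ℂ × ℂ)) := by fun_prop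
        exact this.tendsto 0
      filter_upwards [eventually_eventually_nhds.2 h,
        ht.eventually (eventually_differentiableAt hf)] with x hx hd
      have h1 : HasDerivAt (fun x : ℂ => f (x, 0)) (fderiv ℂ f (x, 0) (1, 0)) x := by
        have h2 : HasDerivAt (fun x : ℂ => ((x, 0) : ℂ × ℂ)) (1, 0) x :=
          (hasDerivAt_id x).prodMk (hasDerivAt_const x 0)
        exact hd.hasFDerivAt.comp_hasDerivAt x h2
      have h3 : HasDerivAt (fun x : ℂ => f (x, 0)) 0 x :=
        (hasDerivAt_const x (0 : ℂ)).congr_of_eventuallyEq hx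
      exact h1.unique h3
  obtain ⟨g, hg, hg'⟩ := exists_taylor_eq ((isGeometric_taylor (of f hf)).shift 0 1)
  refine ⟨g, hg, ?_⟩
  have h1 : of f hf = of (fun p => p.2) analyticAt_snd * of g hg := by
    apply taylor_injective
    rw [map_mul, taylor_snd, hg']
    ext j i
    cases j with
    | zero =>
      rw [coeff_zero_X_mul, coeff_taylor, Function.iterate_zero, id, key i f hf h, mul_zero, map_zero]
    | succ j =>
      rw [coeff_succ_X_mul]
      simp [PowerSeries.shift]
  rw [of_mul, of_eq_of] at h1
  exact h1

/-- A germ vanishing on the graph of `ψ` is divisible by `y - ψ(x)`. -/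
theorem exists_eq_sub_mul {f : ℂ × ℂ → ℂ} (hf : AnalyticAt ℂ f 0) {ψ : ℂ → ℂ}
    (hψ : AnalyticAt ℂ ψ 0) (h0 : ψ 0 = 0) (h : ∀ᶠ x in 𝓝 (0 : ℂ), f (x, ψ x) = 0) :
    ∃ g : ℂ × ℂ → ℂ, AnalyticAt ℂ g 0 ∧
      ∀ᶠ p in 𝓝 (0 : ℂ × ℂ), f p = (p.2 - ψ p.1) * g p := by
  have ha1 : AnalyticAt ℂ (fun p : ℂ × ℂ => (p.1, p.2 + ψ p.1)) 0 :=
    analyticAt_fst.prod (analyticAt_snd.add (analyticAt_comp_fst hψ))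
  have ha2 : AnalyticAt ℂ (fun p : ℂ × ℂ => (p.1, p.2 - ψ p.1)) 0 :=
    analyticAt_fst.prod (analyticAt_snd.sub (analyticAt_comp_fst hψ))
  have hz1 : (fun p : ℂ × ℂ => (p.1, p.2 + ψ p.1)) 0 = 0 := by simp [h0]
  have hz2 : (fun p : ℂ × ℂ => (p.1, p.2 - ψ p.1)) 0 = 0 := by simp [h0]
  have hf1 : AnalyticAt ℂ (fun p : ℂ × ℂ => f (p.1, p.2 + ψ p.1)) 0 :=
    hf.comp_of_map_zero ha1 hz1
  obtain ⟨g, hg, hfg⟩ := exists_eq_snd_mul hf1 (by simpa using h)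
  refine ⟨fun p => g (p.1, p.2 - ψ p.1), hg.comp_of_map_zero ha2 hz2, ?_⟩
  have ht : Tendsto (fun p : ℂ × ℂ => (p.1, p.2 - ψ p.1)) (𝓝 0) (𝓝 0) :=
    ha2.continuousAt.tendsto_of_map_zero hz2
  filter_upwards [ht.eventually hfg] with p hp
  simpa using hp

theorem tendsto_pow_prod {m : ℕ} (hm : m ≠ 0) :
    Tendsto (fun p : ℂ × ℂ => (p.1 ^ m, p.2)) (𝓝 0) (𝓝 0) := by
  have h : Continuous (fun p : ℂ × ℂ => (p.1 ^ m, p.2)) := by fun_prop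
  exact h.continuousAt.tendsto_of_map_zero (by simp [hm])

theorem analyticAt_comp_pow {f : ℂ × ℂ → ℂ} (hf : AnalyticAt ℂ f 0) {m : ℕ} (hm : m ≠ 0) :
    AnalyticAt ℂ (fun p : ℂ × ℂ => f (p.1 ^ m, p.2)) 0 := by
  have h : (fun p : ℂ × ℂ => (p.1 ^ m, p.2)) 0 = 0 := by simp [hm]
  exact hf.comp_of_map_zero ((analyticAt_fst.pow m).prod analyticAt_snd) h

/-- A property holds near the origin if it does after the substitution `x = u ^ m`. -/
theorem eventually_of_pow {m : ℕ} (hm : m ≠ 0) {P : ℂ × ℂ → Prop}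
    (h : ∀ᶠ p in 𝓝 (0 : ℂ × ℂ), P (p.1 ^ m, p.2)) : ∀ᶠ p in 𝓝 (0 : ℂ × ℂ), P p := by
  have hc : ContinuousAt (fun x : ℂ => x ^ ((m : ℂ)⁻¹)) 0 := by
    apply Complex.continuousAt_cpow_const_of_re_pos
    · left; simp
    · rw [← Complex.ofReal_natCast, ← Complex.ofReal_inv, Complex.ofReal_re]
      positivity
  have h0 : (0 : ℂ) ^ ((m : ℂ)⁻¹) = 0 := Complex.zero_cpow (by simpa using hm)
  have ht : Tendsto (fun p : ℂ × ℂ => (p.1 ^ ((m : ℂ)⁻¹), p.2)) (𝓝 0) (𝓝 0) := by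
    have h1 : Tendsto (fun p : ℂ × ℂ => p.1 ^ ((m : ℂ)⁻¹)) (𝓝 (0 : ℂ × ℂ)) (𝓝 0) := by
      have := hc.tendsto.comp (continuous_fst.tendsto (0 : ℂ × ℂ))
      rwa [h0] at this
    rw [Prod.zero_eq_mk, nhds_prod_eq] at h1 ⊢
    exact h1.prodMk tendsto_snd
  filter_upwards [ht.eventually h] with p hp
  simpa [Complex.cpow_nat_inv_pow _ hm] using hp

theorem taylor_comp_pow {f : ℂ × ℂ → ℂ} (hf : AnalyticAt ℂ f 0) {m : ℕ} (hm : m ≠ 0) :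
    taylor (of _ (analyticAt_comp_pow hf hm)) =
      expandX m hm (taylor (of f hf)) := by
  set s := taylor (of f hf) with hs
  have hc : ∀ i j, coeff i (coeff j (expandX m hm s)) =
      if m ∣ i then coeff (i / m) (coeff j s) else 0 := by
    intro i j
    rw [coeff_expandX, coeff_expand]
  have hg : IsGeometric (expandX m hm s) := by
    obtain ⟨C, R, hC, hR, h⟩ := (isGeometric_taylor (of f hf)).exists_one_le
    refine ⟨C, R, hC, by positivity, fun i j => ?_⟩
    rw [hc]
    split_ifs
    · refine (h _ _).trans ?_
      have hi := Nat.div_le_self i m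
      gcongr
    · rw [norm_zero]
      positivity
  obtain ⟨h, h2⟩ := analyticAt_and_taylor_eq hg (f := fun p => f (p.1 ^ m, p.2)) (by
    filter_upwards [(tendsto_pow_prod hm).eventually (hasSum_taylor hf)] with p hp
    have hinj : Function.Injective (fun n : ℕ × ℕ => (m * n.1, n.2)) := by
      rintro ⟨a, b⟩ ⟨c, d⟩ h
      simp only [Prod.mk.injEq] at h
      exact Prod.ext (Nat.eq_of_mul_eq_mul_left (Nat.pos_of_ne_zero hm) h.1) h.2
    rw [← hinj.hasSum_iff]
    · convert hp using 1
      funext n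
      simp only [Function.comp_apply, monomialTerm]
      rw [hc, if_pos (dvd_mul_right _ _), Nat.mul_div_cancel_left _ (Nat.pos_of_ne_zero hm), pow_mul]
    · intro n hn
      rw [monomialTerm, hc, if_neg, zero_mul, zero_mul]
      rintro ⟨k, hk⟩
      exact hn ⟨(k, n.2), Prod.ext hk.symm rfl⟩)
  exact h2

/-- A germ invariant under `u ↦ ω u`, for a primitive `m`-th root of unity `ω`, is a germ in
`u ^ m`. -/
theorem exists_eq_comp_pow {f : ℂ × ℂ → ℂ} (hf : AnalyticAt ℂ f 0) {m : ℕ} (hm : m ≠ 0)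
    {ω : ℂ} (hω : IsPrimitiveRoot ω m) (h : ∀ᶠ p in 𝓝 (0 : ℂ × ℂ), f (ω * p.1, p.2) = f p) :
    ∃ g : ℂ × ℂ → ℂ, AnalyticAt ℂ g 0 ∧ ∀ᶠ p in 𝓝 (0 : ℂ × ℂ), f p = g (p.1 ^ m, p.2) := by
  set s := taylor (of f hf) with hs
  have hgeo : IsGeometric s := isGeometric_taylor _
  -- The Taylor coefficients of `f (ω u, y)` are `ωⁱ c_{i,j}`.
  let s' : ℂ⟦X⟧⟦X⟧ := PowerSeries.mk fun j => PowerSeries.mk fun i => ω ^ i * coeff i (coeff j s)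
  have hω1 : ‖ω‖ = 1 := hω.norm'_eq_one hm
  have hgeo' : IsGeometric s' := by
    obtain ⟨C, R, hC, hR, h⟩ := hgeo
    exact ⟨C, R, hC, hR, fun i j => by simpa [s', hω1] using h i j⟩
  have ht : Tendsto (fun p : ℂ × ℂ => (ω * p.1, p.2)) (𝓝 0) (𝓝 0) := by
    have h : Continuous (fun p : ℂ × ℂ => (ω * p.1, p.2)) := by fun_prop
    exact h.continuousAt.tendsto_of_map_zero (by simp)
  obtain ⟨h1, h2⟩ := analyticAt_and_taylor_eq hgeo' (f := f) (by
    filter_upwards [ht.eventually (hasSum_taylor hf), h] with p hp hp2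
    rw [hp2] at hp
    convert hp using 1
    funext n
    simp only [monomialTerm, s', coeff_mk, ← hs, mul_pow]
    ring)
  have hss : s = s' := h2
  have hzero : ∀ i j, ¬ m ∣ i → coeff i (coeff j s) = 0 := by
    intro i j hi
    have h3 : coeff i (coeff j s) = ω ^ i * coeff i (coeff j s) := by
      conv_lhs => rw [hss]
      simp [s']
    have h4 : ω ^ i ≠ 1 := fun h => hi (hω.dvd_of_pow_eq_one i h)
    by_contra hne
    apply h4
    exact mul_right_cancel₀ hne (by rw [← h3, one_mul])
  let t : ℂ⟦X⟧⟦X⟧ := PowerSeries.mk fun j => PowerSeries.mk fun i => coeff (m * i) (coeff j s)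
  have ht : IsGeometric t := by
    obtain ⟨C, R, hC, hR, h⟩ := hgeo.exists_one_le
    refine ⟨C, R ^ m, hC, by positivity, fun i j => ?_⟩
    simp only [t, coeff_mk]
    refine (h _ _).trans ?_
    rw [← pow_mul]
    have hmij : m * i + j ≤ m * (i + j) := by
      rw [mul_add]
      gcongr
      exact Nat.le_mul_of_pos_left j (Nat.pos_of_ne_zero hm)
    gcongr
  obtain ⟨g, hg, hg'⟩ := exists_taylor_eq ht
  refine ⟨g, hg, ?_⟩
  have h5 : of f hf = of _ (analyticAt_comp_pow hg hm) := by
    apply taylor_injective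
    rw [taylor_comp_pow hg hm, hg', ← hs]
    ext j i
    rw [coeff_expandX, coeff_expand]
    split_ifs with hd
    · simp only [t, coeff_mk, Nat.mul_div_cancel' hd]
    · exact hzero i j hd
  rw [of_eq_of] at h5
  exact h5

end analyticGerms

end

/-! ### The equation of a parametrized branch -/

noncomputable section

open PowerSeries

theorem AnalyticAt.eventually_eq_zero_or_of_mul {f g : ℂ → ℂ} (hf : AnalyticAt ℂ f 0)
    (hg : AnalyticAt ℂ g 0) (h : ∀ᶠ u in 𝓝 (0 : ℂ), f u * g u = 0) :
    (∀ᶠ u in 𝓝 (0 : ℂ), f u = 0) ∨ ∀ᶠ u in 𝓝 (0 : ℂ), g u = 0 := by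
  rcases hf.eventually_eq_zero_or_eventually_ne_zero with h1 | h1
  · exact Or.inl h1
  · right
    rcases hg.eventually_eq_zero_or_eventually_ne_zero with h2 | h2
    · exact h2
    · exfalso
      have h3 := h.filter_mono (nhdsWithin_le_nhds (s := {0}ᶜ))
      obtain ⟨u, h4, h5, h6⟩ := (h1.and (h2.and h3)).exists
      exact (mul_ne_zero h4 h5) h6

namespace analyticGerms

theorem of_prod {ι : Type*} (s : Finset ι) (f : ι → ℂ × ℂ → ℂ) (hf : ∀ i, AnalyticAt ℂ (f i) 0)
    (h : AnalyticAt ℂ (fun p => ∏ i ∈ s, f i p) 0) :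
    of (fun p => ∏ i ∈ s, f i p) h = ∏ i ∈ s, of (f i) (hf i) := by
  classical
  induction s using Finset.induction_on with
  | empty => rfl
  | insert a s ha ih =>
    have hs : AnalyticAt ℂ (fun p => ∏ i ∈ s, f i p) 0 :=
      Finset.analyticAt_fun_prod s fun i _ => hf i
    rw [Finset.prod_insert ha, ← ih hs, of_mul, of_eq_of]
    exact Eventually.of_forall fun p => by simp [Finset.prod_insert ha]

theorem isUnit_of_eval_ne_zero {g : analyticGerms} (h : eval g ≠ 0) : IsUnit g := by
  obtain ⟨f, hf, rfl⟩ := exists_of g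
  rw [eval_of] at h
  refine IsUnit.of_mul_eq_one (of _ (hf.inv h)) ?_
  rw [of_mul]
  change _ = of (fun _ => 1) analyticAt_const
  rw [of_eq_of]
  filter_upwards [hf.continuousAt.eventually_ne h] with p hp
  simp [hp]

/-- A germ vanishing on the graphs of several distinct functions is divisible by the product of
their equations. -/
theorem exists_eq_prod_sub_mul {ι : Type*} (s : Finset ι) (ψ : ι → ℂ → ℂ)
    (hψ : ∀ i, AnalyticAt ℂ (ψ i) 0) (h0 : ∀ i, ψ i 0 = 0)
    (hne : ∀ i ∈ s, ∀ j ∈ s, i ≠ j → ¬ ∀ᶠ u in 𝓝 (0 : ℂ), ψ i u = ψ j u)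
    {f : ℂ × ℂ → ℂ} (hf : AnalyticAt ℂ f 0) (h : ∀ i ∈ s, ∀ᶠ u in 𝓝 (0 : ℂ), f (u, ψ i u) = 0) :
    ∃ g : ℂ × ℂ → ℂ, AnalyticAt ℂ g 0 ∧
      ∀ᶠ p in 𝓝 (0 : ℂ × ℂ), f p = (∏ i ∈ s, (p.2 - ψ i p.1)) * g p := by
  classical
  induction s using Finset.induction_on generalizing f with
  | empty => exact ⟨f, hf, by simp⟩
  | insert a s ha ih =>
    obtain ⟨g, hg, hfg⟩ := exists_eq_sub_mul hf (hψ a) (h0 a) (h a (Finset.mem_insert_self a s))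
    have hgz : ∀ i ∈ s, ∀ᶠ u in 𝓝 (0 : ℂ), g (u, ψ i u) = 0 := by
      intro i hi
      have hpair : AnalyticAt ℂ (fun u : ℂ => (u, ψ i u)) 0 := analyticAt_id.prod (hψ i)
      have hp0 : (fun u : ℂ => (u, ψ i u)) 0 = 0 := by simp [h0]
      have hmul : ∀ᶠ u in 𝓝 (0 : ℂ), (ψ i u - ψ a u) * g (u, ψ i u) = 0 := by
        filter_upwards [h i (Finset.mem_insert_of_mem hi),
          (hpair.continuousAt.tendsto_of_map_zero hp0).eventually hfg] with u h1 h2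
        rw [h1] at h2
        exact h2.symm
      rcases ((hψ i).sub (hψ a)).eventually_eq_zero_or_of_mul (hg.comp_of_map_zero hpair hp0) hmul
        with h1 | h1
      · exfalso
        refine hne i (Finset.mem_insert_of_mem hi) a (Finset.mem_insert_self a s) ?_ ?_
        · rintro rfl
          exact ha hi
        · exact h1.mono fun u hu => sub_eq_zero.1 hu
      · exact h1
    obtain ⟨k, hk, hgk⟩ := ih (fun i hi j hj => hne i (Finset.mem_insert_of_mem hi) j
      (Finset.mem_insert_of_mem hj)) hg hgz
    refine ⟨k, hk, ?_⟩
    filter_upwards [hfg, hgk] with p h1 h2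
    rw [Finset.prod_insert ha, h1, h2, mul_assoc]

end analyticGerms

/-- The product `∏ (y - φ (ζ u))` over the `m`-th roots of unity `ζ`, as a function of `(u, y)`. -/
def conjProd (m : ℕ) (φ : ℂ → ℂ) (p : ℂ × ℂ) : ℂ :=
  ∏ ζ ∈ Polynomial.nthRootsFinset m (1 : ℂ), (p.2 - φ (ζ * p.1))

/-- `F` is an equation of the image of `u ↦ (u ^ m, φ u)`, obtained by multiplying the conjugates
of `y - φ (x ^ (1 / m))`. -/
structure IsBranchEquation (m : ℕ) (φ : ℂ → ℂ) (F : ℂ × ℂ → ℂ) : Prop where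
  analytic : AnalyticAt ℂ F 0
  eq_conjProd : ∀ᶠ p in 𝓝 (0 : ℂ × ℂ), F (p.1 ^ m, p.2) = conjProd m φ p

theorem AnalyticAt.comp_const_mul {φ : ℂ → ℂ} (hφ : AnalyticAt ℂ φ 0) (ζ : ℂ) :
    AnalyticAt ℂ (fun u => φ (ζ * u)) 0 :=
  hφ.comp_of_map_zero (analyticAt_const.mul analyticAt_id) (mul_zero ζ)

theorem analyticAt_conjProd (m : ℕ) {φ : ℂ → ℂ} (hφ : AnalyticAt ℂ φ 0) :
    AnalyticAt ℂ (conjProd m φ) 0 :=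
  Finset.analyticAt_fun_prod _ fun ζ _ =>
    analyticAt_snd.sub (analyticAt_comp_fst (hφ.comp_const_mul ζ))

theorem mem_rootsOfUnity_iff {m : ℕ} (hm : m ≠ 0) {ζ : ℂ} :
    ζ ∈ Polynomial.nthRootsFinset m (1 : ℂ) ↔ ζ ^ m = 1 :=
  Polynomial.mem_nthRootsFinset (Nat.pos_of_ne_zero hm) 1

theorem conjProd_mul {m : ℕ} (hm : m ≠ 0) (φ : ℂ → ℂ) {ω : ℂ} (hω : ω ^ m = 1) (p : ℂ × ℂ) :
    conjProd m φ (ω * p.1, p.2) = conjProd m φ p := by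
  have hω0 : ω ≠ 0 := by
    rintro rfl
    rw [zero_pow hm] at hω
    exact zero_ne_one hω
  refine Finset.prod_nbij' (fun ζ => ζ * ω) (fun ζ => ζ * ω⁻¹) ?_ ?_ ?_ ?_ ?_
  · intro ζ hζ
    rw [mem_rootsOfUnity_iff hm] at hζ ⊢
    rw [mul_pow, hζ, hω, one_mul]
  · intro ζ hζ
    rw [mem_rootsOfUnity_iff hm] at hζ ⊢
    rw [mul_pow, inv_pow, hζ, hω, one_mul, inv_one]
  · intro ζ _
    simp [hω0]
  · intro ζ _
    simp [hω0]
  · intro ζ _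
    simp [mul_assoc]

theorem exists_isBranchEquation {m : ℕ} (hm : m ≠ 0) {φ : ℂ → ℂ} (hφ : AnalyticAt ℂ φ 0) :
    ∃ F, IsBranchEquation m φ F := by
  have hω := Complex.isPrimitiveRoot_exp m hm
  obtain ⟨F, hF, h⟩ := analyticGerms.exists_eq_comp_pow (analyticAt_conjProd m hφ) hm hω
    (Eventually.of_forall fun p => conjProd_mul hm φ hω.pow_eq_one p)
  exact ⟨F, hF, h.mono fun p hp => hp.symm⟩

/-- The map `u ↦ (u ^ m, φ u)` does not factor through a power of `u`: the conjugates of `φ` are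
pairwise distinct. -/
def HasDistinctConjugates (m : ℕ) (φ : ℂ → ℂ) : Prop :=
  ∀ ζ : ℂ, ζ ^ m = 1 → ζ ≠ 1 → ¬ ∀ᶠ u in 𝓝 (0 : ℂ), φ (ζ * u) = φ u

theorem tendsto_const_mul_zero (ζ : ℂ) : Tendsto (fun u : ℂ => ζ * u) (𝓝 0) (𝓝 0) :=
  (continuous_const_mul ζ).continuousAt.tendsto_of_map_zero (mul_zero ζ)

theorem HasDistinctConjugates.pairwise {m : ℕ} (hm : m ≠ 0) {φ : ℂ → ℂ}
    (h : HasDistinctConjugates m φ) {ζ η : ℂ} (hζ : ζ ^ m = 1) (hη : η ^ m = 1) (hne : ζ ≠ η) :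
    ¬ ∀ᶠ u in 𝓝 (0 : ℂ), φ (ζ * u) = φ (η * u) := by
  intro he
  have hη0 : η ≠ 0 := by
    rintro rfl
    rw [zero_pow hm] at hη
    exact zero_ne_one hη
  refine h (ζ * η⁻¹) (by rw [mul_pow, inv_pow, hζ, hη, inv_one, one_mul]) ?_ ?_
  · intro h1
    exact hne (by rwa [mul_inv_eq_one₀ hη0] at h1)
  · filter_upwards [(tendsto_const_mul_zero η⁻¹).eventually he] with u hu
    rw [mul_assoc, hu, ← mul_assoc, mul_inv_cancel₀ hη0, one_mul]

section

variable {m : ℕ} {φ : ℂ → ℂ} {F : ℂ × ℂ → ℂ}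

theorem analyticAt_param (hφ : AnalyticAt ℂ φ 0) :
    AnalyticAt ℂ (fun u : ℂ => (u ^ m, φ u)) 0 :=
  (analyticAt_id.pow m).prod hφ

theorem param_zero (hm : m ≠ 0) (h0 : φ 0 = 0) : (fun u : ℂ => (u ^ m, φ u)) 0 = 0 := by
  simp [hm, h0]

theorem tendsto_param (hm : m ≠ 0) (hφ : AnalyticAt ℂ φ 0) (h0 : φ 0 = 0) :
    Tendsto (fun u : ℂ => (u ^ m, φ u)) (𝓝 0) (𝓝 0) :=
  (analyticAt_param hφ).continuousAt.tendsto_of_map_zero (param_zero hm h0)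

theorem IsBranchEquation.eval_eq_zero (hF : IsBranchEquation m φ F) (hm : m ≠ 0) (h0 : φ 0 = 0) :
    F 0 = 0 := by
  have h := hF.eq_conjProd.self_of_nhds
  have h1 : (((0 : ℂ × ℂ).1 ^ m, (0 : ℂ × ℂ).2) : ℂ × ℂ) = 0 := by simp [hm]
  rw [h1] at h
  rw [h]
  apply Finset.prod_eq_zero (i := 1)
  · exact (mem_rootsOfUnity_iff hm).2 (one_pow m)
  · simp [h0]

theorem IsBranchEquation.eventually_param (hF : IsBranchEquation m φ F) (hm : m ≠ 0)
    (hφ : AnalyticAt ℂ φ 0) (h0 : φ 0 = 0) : ∀ᶠ u in 𝓝 (0 : ℂ), F (u ^ m, φ u) = 0 := by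
  have ht : Tendsto (fun u : ℂ => (u, φ u)) (𝓝 0) (𝓝 0) :=
    (analyticAt_id.prod hφ).continuousAt.tendsto_of_map_zero (by simp [h0])
  filter_upwards [ht.eventually hF.eq_conjProd] with u hu
  rw [hu]
  apply Finset.prod_eq_zero (i := 1)
  · exact (mem_rootsOfUnity_iff hm).2 (one_pow m)
  · simp

theorem conjProd_ne_zero (hφ : AnalyticAt ℂ φ 0) (h0 : φ 0 = 0) :
    analyticGerms.of (conjProd m φ) (analyticAt_conjProd m hφ) ≠ 0 := by
  intro h
  change _ = analyticGerms.of (fun _ => 0) analyticAt_const at h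
  rw [analyticGerms.of_eq_of] at h
  have ht : Tendsto (fun y : ℂ => ((0, y) : ℂ × ℂ)) (𝓝 0) (𝓝 0) := by
    have : Continuous (fun y : ℂ => ((0, y) : ℂ × ℂ)) := by fun_prop
    exact this.continuousAt.tendsto_of_map_zero rfl
  have h1 := (ht.eventually h).filter_mono (nhdsWithin_le_nhds (s := {0}ᶜ))
  obtain ⟨y, h2, h3⟩ := (h1.and self_mem_nhdsWithin).exists
  refine absurd h2 ?_
  rw [conjProd]
  exact Finset.prod_ne_zero_iff.2 fun ζ _ => by simpa [h0] using h3

/-- The branch equation generates the ideal of germs vanishing on the branch. -/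
theorem IsBranchEquation.dvd (hF : IsBranchEquation m φ F) (hm : m ≠ 0)
    (hφ : AnalyticAt ℂ φ 0) (h0 : φ 0 = 0) (hd : HasDistinctConjugates m φ) {h : ℂ × ℂ → ℂ}
    (ha : AnalyticAt ℂ h 0) (hz : ∀ᶠ u in 𝓝 (0 : ℂ), h (u ^ m, φ u) = 0) :
    analyticGerms.of F hF.analytic ∣ analyticGerms.of h ha := by
  have hk := analyticGerms.analyticAt_comp_pow ha hm
  obtain ⟨k, hka, hhk⟩ := analyticGerms.exists_eq_prod_sub_mul
    (Polynomial.nthRootsFinset m (1 : ℂ)) (fun ζ u => φ (ζ * u)) (fun ζ => hφ.comp_const_mul ζ)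
    (fun ζ => by simp [h0])
    (fun ζ hζ η hη hne => hd.pairwise hm ((mem_rootsOfUnity_iff hm).1 hζ)
      ((mem_rootsOfUnity_iff hm).1 hη) hne) hk (fun ζ hζ => by
        filter_upwards [(tendsto_const_mul_zero ζ).eventually hz] with u hu
        rw [mem_rootsOfUnity_iff hm] at hζ
        simpa [mul_pow, hζ] using hu)
  have hω := Complex.isPrimitiveRoot_exp m hm
  set ω := Complex.exp (2 * Real.pi * Complex.I / m)
  have hrot : AnalyticAt ℂ (fun p : ℂ × ℂ => (ω * p.1, p.2)) 0 :=
    (analyticAt_const.mul analyticAt_fst).prod analyticAt_snd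
  have hrot0 : (fun p : ℂ × ℂ => (ω * p.1, p.2)) 0 = 0 := by simp
  have hka' := hka.comp_of_map_zero hrot hrot0
  -- The cofactor inherits the invariance under `u ↦ ω u` from `h (u ^ m, y)`.
  have hinv : ∀ᶠ p in 𝓝 (0 : ℂ × ℂ), k (ω * p.1, p.2) = k p := by
    rw [← EventuallyEq, ← analyticGerms.of_eq_of hka' hka]
    apply mul_left_cancel₀ (conjProd_ne_zero hφ h0)
    rw [analyticGerms.of_mul, analyticGerms.of_mul, analyticGerms.of_eq_of]
    filter_upwards [hhk, (hrot.continuousAt.tendsto_of_map_zero hrot0).eventually hhk] with p h1 h2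
    have h3 : h ((ω * p.1) ^ m, p.2) = conjProd m φ (ω * p.1, p.2) * k (ω * p.1, p.2) := h2
    have h4 : h (p.1 ^ m, p.2) = conjProd m φ p * k p := h1
    rw [conjProd_mul hm φ hω.pow_eq_one, mul_pow, hω.pow_eq_one, one_mul, h4] at h3
    exact h3.symm
  obtain ⟨c, hc, hkc⟩ := analyticGerms.exists_eq_comp_pow hka hm hω hinv
  refine ⟨analyticGerms.of c hc, ?_⟩
  rw [analyticGerms.of_mul, analyticGerms.of_eq_of]
  apply analyticGerms.eventually_of_pow hm
  filter_upwards [hhk, hkc, hF.eq_conjProd] with p h1 h2 h3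
  have h4 : h (p.1 ^ m, p.2) = conjProd m φ p * k p := h1
  rw [h4, h2, ← h3]
  rfl

theorem IsBranchEquation.irreducible (hF : IsBranchEquation m φ F) (hm : m ≠ 0)
    (hφ : AnalyticAt ℂ φ 0) (h0 : φ 0 = 0) (hd : HasDistinctConjugates m φ) :
    Irreducible (analyticGerms.of F hF.analytic) := by
  have hne : analyticGerms.of F hF.analytic ≠ 0 := by
    intro h
    apply conjProd_ne_zero (m := m) hφ h0
    change _ = analyticGerms.of (fun _ => 0) analyticAt_const at h ⊢
    rw [analyticGerms.of_eq_of] at h ⊢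
    filter_upwards [(analyticGerms.tendsto_pow_prod hm).eventually h, hF.eq_conjProd] with p h1 h2
    rw [← h2, h1]
  -- A factor vanishing on the branch is divisible by `F`, so the cofactor is a unit.
  have key : ∀ a b : analyticGerms, analyticGerms.of F hF.analytic = a * b →
      analyticGerms.of F hF.analytic ∣ a → IsUnit b := by
    rintro a b hab ⟨c, hc⟩
    rw [hc, mul_assoc] at hab
    have h1 : c * b = 1 := mul_left_cancel₀ hne (by rw [← hab, mul_one])
    exact IsUnit.of_mul_eq_one c (by rw [mul_comm, h1])
  refine ⟨?_, ?_⟩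
  · intro hu
    have h1 := hu.map analyticGerms.eval
    rw [analyticGerms.eval_of, hF.eval_eq_zero hm h0] at h1
    exact not_isUnit_zero h1
  · intro a b hab
    obtain ⟨f, hf, rfl⟩ := analyticGerms.exists_of a
    obtain ⟨g, hg, rfl⟩ := analyticGerms.exists_of b
    have hab' := hab
    rw [analyticGerms.of_mul, analyticGerms.of_eq_of] at hab
    have hz : ∀ᶠ u in 𝓝 (0 : ℂ), f (u ^ m, φ u) * g (u ^ m, φ u) = 0 := by
      filter_upwards [(tendsto_param hm hφ h0).eventually hab,
        hF.eventually_param hm hφ h0] with u h1 h2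
      rw [h2] at h1
      exact h1.symm
    rcases (hf.comp_of_map_zero (analyticAt_param hφ) (param_zero hm h0)).eventually_eq_zero_or_of_mul
      (hg.comp_of_map_zero (analyticAt_param hφ) (param_zero hm h0)) hz with h1 | h1
    · exact Or.inr (key _ _ hab' (hF.dvd hm hφ h0 hd hf h1))
    · exact Or.inl (key _ _ (by rw [hab', mul_comm]) (hF.dvd hm hφ h0 hd hg h1))

theorem taylorSeries_comp_const_mul (hφ : AnalyticAt ℂ φ 0) (ζ : ℂ) :
    taylorSeries (fun u => φ (ζ * u)) = rescale ζ (taylorSeries φ) := by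
  have key : ∀ n, ∀ {φ : ℂ → ℂ}, AnalyticAt ℂ φ 0 →
      iteratedDeriv n (fun u => φ (ζ * u)) 0 = ζ ^ n * iteratedDeriv n φ 0 := by
    intro n
    induction n with
    | zero => intro φ _; simp
    | succ n ih =>
      intro φ hφ
      have h1 : deriv (fun u => φ (ζ * u)) =ᶠ[𝓝 0] fun u => ζ * deriv φ (ζ * u) := by
        filter_upwards [(tendsto_const_mul_zero ζ).eventually hφ.eventually_analyticAt] with u hu
        have h2 := hu.differentiableAt.hasDerivAt.comp u ((hasDerivAt_id u).const_mul ζ)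
        rw [mul_one, mul_comm] at h2
        exact h2.deriv
      rw [iteratedDeriv_succ', iteratedDeriv_succ', h1.iteratedDeriv_eq,
        iteratedDeriv_const_mul_field, ih hφ.deriv]
      ring
  ext n
  rw [coeff_rescale, taylorSeries, taylorSeries, coeff_mk, coeff_mk, key n hφ]
  ring

/-- The Taylor series of the branch equation, after the substitution `x = t ^ m`. -/
theorem IsBranchEquation.expandX_taylor (hF : IsBranchEquation m φ F) (hm : m ≠ 0)
    (hφ : AnalyticAt ℂ φ 0) :
    expandX m hm (analyticGerms.taylor (analyticGerms.of F hF.analytic)) =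
      ∏ ζ ∈ Polynomial.nthRootsFinset m (1 : ℂ), (X - C (rescale ζ (taylorSeries φ))) := by
  have ha : ∀ ζ : ℂ, AnalyticAt ℂ (fun p : ℂ × ℂ => p.2 - φ (ζ * p.1)) 0 := fun ζ =>
    analyticAt_snd.sub (analyticAt_comp_fst (hφ.comp_const_mul ζ))
  have h1 : analyticGerms.of _ (analyticGerms.analyticAt_comp_pow hF.analytic hm) =
      ∏ ζ ∈ Polynomial.nthRootsFinset m (1 : ℂ), analyticGerms.of _ (ha ζ) :=
    ((analyticGerms.of_eq_of _ (analyticAt_conjProd m hφ)).2 hF.eq_conjProd).trans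
      (analyticGerms.of_prod _ _ ha _)
  rw [← analyticGerms.taylor_comp_pow, h1, map_prod]
  refine Finset.prod_congr rfl fun ζ _ => ?_
  rw [← taylorSeries_comp_const_mul hφ, ← analyticGerms.coeff_taylor_comp_fst (hφ.comp_const_mul ζ),
    ← analyticGerms.taylor_snd, ← map_sub, analyticGerms.of_sub]
  rfl

end

end

/-! ### The Newton–Puiseux theorem -/

noncomputable section

open Polynomial in
/-- After a substitution `x = t ^ e`, the polynomial is a product of linear factors. -/
def SplitsAfterRamification (P : Polynomial (PowerSeries ℂ)) : Prop :=
  ∃ (e : ℕ) (he : e ≠ 0),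
    (P.map ((PowerSeries.expand e he : PowerSeries ℂ →ₐ[ℂ] PowerSeries ℂ) :
      PowerSeries ℂ →+* PowerSeries ℂ)).Splits

/-- The substitution `x = t ^ e` in power series, as a ring homomorphism. -/
abbrev ramify (e : ℕ) (he : e ≠ 0) : PowerSeries ℂ →+* PowerSeries ℂ :=
  ((PowerSeries.expand e he : PowerSeries ℂ →ₐ[ℂ] PowerSeries ℂ) : PowerSeries ℂ →+* PowerSeries ℂ)

theorem ramify_comp (e e' : ℕ) (he : e ≠ 0) (he' : e' ≠ 0) :
    (ramify e he).comp (ramify e' he') = ramify (e * e') (mul_ne_zero he he') := by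
  ext1 f
  exact (PowerSeries.expand_mul e he e' he' f).symm

open IsLocalRing in
instance : IsAdicComplete (maximalIdeal (PowerSeries ℂ)) (PowerSeries ℂ) := by
  rw [PowerSeries.maximalIdeal_eq_span_X]
  infer_instance

theorem mem_maximalIdeal_iff {f : PowerSeries ℂ} :
    f ∈ IsLocalRing.maximalIdeal (PowerSeries ℂ) ↔ PowerSeries.constantCoeff f = 0 := by
  rw [PowerSeries.maximalIdeal_eq_span_X, Ideal.mem_span_singleton, PowerSeries.X_dvd_iff]

namespace SplitsAfterRamification

open Polynomial

theorem of_map {P : Polynomial (PowerSeries ℂ)} (N : ℕ) (hN : N ≠ 0)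
    (h : SplitsAfterRamification (P.map (ramify N hN))) : SplitsAfterRamification P := by
  obtain ⟨e, he, hs⟩ := h
  refine ⟨e * N, mul_ne_zero he hN, ?_⟩
  change (P.map (ramify _ _)).Splits
  rw [← ramify_comp e N he hN, ← Polynomial.map_map]
  exact hs

theorem mul {P Q : Polynomial (PowerSeries ℂ)} (hP : SplitsAfterRamification P)
    (hQ : SplitsAfterRamification Q) : SplitsAfterRamification (P * Q) := by
  obtain ⟨e, he, hs⟩ := hP
  obtain ⟨e', he', hs'⟩ := hQ
  refine ⟨e * e', mul_ne_zero he he', ?_⟩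
  change ((P * Q).map (ramify _ _)).Splits
  rw [Polynomial.map_mul]
  refine Splits.mul ?_ ?_
  · have h : ramify (e * e') (mul_ne_zero he he') = (ramify e' he').comp (ramify e he) := by
      rw [ramify_comp]
      congr 1
      exact mul_comm e e'
    rw [h, ← Polynomial.map_map]
    exact Splits.map hs _
  · rw [← ramify_comp e e' he he', ← Polynomial.map_map]
    exact Splits.map hs' _

theorem of_taylor {P : Polynomial (PowerSeries ℂ)} (c : PowerSeries ℂ)
    (h : SplitsAfterRamification (taylor c P)) : SplitsAfterRamification P := by
  obtain ⟨e, he, hs⟩ := h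
  refine ⟨e, he, ?_⟩
  change ((taylor c P).map (ramify e he)).Splits at hs
  have h2 := hs.taylor (-(ramify e he c))
  rw [Polynomial.map_taylor, taylor_taylor, neg_add_cancel, taylor_zero] at h2
  exact h2

theorem scaleRoots {P : Polynomial (PowerSeries ℂ)} (hP : P.Monic) (c : PowerSeries ℂ)
    (h : SplitsAfterRamification P) : SplitsAfterRamification (P.scaleRoots c) := by
  obtain ⟨e, he, hs⟩ := h
  refine ⟨e, he, ?_⟩
  rw [map_scaleRoots]
  · exact hs.scaleRoots _
  · rw [hP.leadingCoeff, map_one]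
    exact one_ne_zero

end SplitsAfterRamification

open Polynomial in
/-- A monic polynomial of degree `n` whose reduction has a root at the origin, but is not `Xⁿ`,
is a product of monic polynomials of smaller degree. -/
theorem exists_monic_factors {P : Polynomial (PowerSeries ℂ)} (hP : P.Monic)
    (h0 : PowerSeries.constantCoeff (P.coeff 0) = 0)
    (hi : ∃ i < P.natDegree, PowerSeries.constantCoeff (P.coeff i) ≠ 0) :
    ∃ f g : Polynomial (PowerSeries ℂ), P = f * g ∧ f.Monic ∧ g.Monic ∧
      f.natDegree < P.natDegree ∧ g.natDegree < P.natDegree := by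
  obtain ⟨i, hin, hi⟩ := hi
  have hc : ∀ j, PowerSeries.coeff j ((P : PowerSeries (PowerSeries ℂ)).map
      (IsLocalRing.residue (PowerSeries ℂ))) = 0 ↔ PowerSeries.constantCoeff (P.coeff j) = 0 := by
    intro j
    rw [PowerSeries.coeff_map, Polynomial.coeff_coe, IsLocalRing.residue_eq_zero_iff,
      mem_maximalIdeal_iff]
  have hne : (P : PowerSeries (PowerSeries ℂ)).map (IsLocalRing.residue (PowerSeries ℂ)) ≠ 0 := by
    intro h
    apply hi
    rw [← hc, h, map_zero]
  obtain ⟨f, u, hW⟩ := PowerSeries.exists_isWeierstrassFactorization hne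
  have hfm : f.Monic := hW.isDistinguishedAt.monic
  have hdeg := hW.natDegree_eq_toNat_order_map
  have hord : ((P : PowerSeries (PowerSeries ℂ)).map (IsLocalRing.residue (PowerSeries ℂ))).order ≤
      i := PowerSeries.order_le i (by rw [Ne, hc]; exact hi)
  have hfP : f.natDegree < P.natDegree := by
    rw [hdeg]
    exact (ENat.toNat_le_of_le_natCast hord).trans_lt hin
  have hf0 : 0 < f.natDegree := by
    rw [hdeg, Nat.pos_iff_ne_zero]
    intro h
    rw [ENat.toNat_eq_zero] at h
    rcases h with h | h
    · have h1 : PowerSeries.coeff 0 ((P : PowerSeries (PowerSeries ℂ)).map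
          (IsLocalRing.residue (PowerSeries ℂ))) = 0 := (hc 0).2 h0
      have h2 := PowerSeries.coeff_order hne
      rw [h] at h2
      exact h2 h1
    · exact hne (PowerSeries.order_eq_top.1 h)
  -- Uniqueness of Weierstrass division by `f` shows that `f` divides `P` as a polynomial.
  have hfne : (f : PowerSeries (PowerSeries ℂ)).map (IsLocalRing.residue (PowerSeries ℂ)) ≠ 0 := by
    intro h
    have h1 := congrArg (PowerSeries.coeff f.natDegree) h
    rw [PowerSeries.coeff_map, Polynomial.coeff_coe, hfm.coeff_natDegree, map_one, map_zero] at h1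
    exact one_ne_zero h1
  have hfW : (f : PowerSeries (PowerSeries ℂ)).IsWeierstrassFactorization f 1 :=
    ⟨hW.isDistinguishedAt, isUnit_one, by rw [mul_one]⟩
  have hford : ((f : PowerSeries (PowerSeries ℂ)).map
      (IsLocalRing.residue (PowerSeries ℂ))).order.toNat = f.natDegree :=
    hfW.natDegree_eq_toNat_order_map.symm
  have hdiv1 : (P : PowerSeries (PowerSeries ℂ)).IsWeierstrassDivision (f : PowerSeries _) u 0 := by
    refine ⟨?_, ?_⟩
    · rw [Polynomial.degree_zero]
      exact WithBot.bot_lt_coe _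
    · rw [Polynomial.coe_zero, add_zero, hW.eq_mul]
  have hdiv2 : (P : PowerSeries (PowerSeries ℂ)).IsWeierstrassDivision (f : PowerSeries _)
      ((P /ₘ f : Polynomial (PowerSeries ℂ)) : PowerSeries _) (P %ₘ f) := by
    refine ⟨?_, ?_⟩
    · change _ < ((((f : PowerSeries (PowerSeries ℂ)).map
        (IsLocalRing.residue (PowerSeries ℂ))).order.toNat : ℕ) : WithBot ℕ)
      rw [hford, ← Polynomial.degree_eq_natDegree hfm.ne_zero]
      exact Polynomial.degree_modByMonic_lt P hfm
    · rw [← Polynomial.coe_mul, ← Polynomial.coe_add]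
      congr 1
      rw [add_comm]
      exact (Polynomial.modByMonic_add_div P f).symm
  have hmod : P %ₘ f = 0 := (hdiv2.elim hfne hdiv1).2
  have hPfg : P = f * (P /ₘ f) := by
    have h := Polynomial.modByMonic_add_div P f
    rw [hmod, zero_add] at h
    exact h.symm
  have hgm : (P /ₘ f).Monic := hfm.of_mul_monic_left (by rw [← hPfg]; exact hP)
  refine ⟨f, P /ₘ f, hPfg, hfm, hgm, hfP, ?_⟩
  have h := hfm.natDegree_mul hgm
  rw [← hPfg] at h
  omega

open Polynomial in
/-- **Newton–Puiseux theorem.** A monic polynomial over `ℂ⟦x⟧` splits after a substitution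
`x = t ^ e`. -/
theorem splitsAfterRamification (P : Polynomial (PowerSeries ℂ)) (hP : P.Monic) :
    SplitsAfterRamification P := by
  classical
  induction hn : P.natDegree using Nat.strong_induction_on generalizing P with
  | _ n ih =>
  subst hn
  rcases Nat.eq_zero_or_pos P.natDegree with h0 | hpos
  · exact ⟨1, one_ne_zero, (Splits.of_natDegree_eq_zero h0).map _⟩
  -- The Tschirnhaus transformation removes the second highest coefficient.
  set n := P.natDegree with hn
  set c : PowerSeries ℂ := PowerSeries.C (-(n : ℂ)⁻¹) * P.coeff (n - 1) with hc
  apply SplitsAfterRamification.of_taylor c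
  set Q := taylor c P with hQ
  have hQm : Q.Monic := by
    rw [Monic, hQ, leadingCoeff_taylor]
    exact hP
  have hQd : Q.natDegree = n := natDegree_taylor P c
  have hn0 : (n : ℂ) ≠ 0 := by exact_mod_cast hpos.ne'
  have hQ1 : Q.coeff (n - 1) = 0 := by
    have hnn : n = (n - 1) + 1 := by omega
    have hd : (hasseDeriv (n - 1) P).natDegree ≤ 1 :=
      (natDegree_hasseDeriv_le P (n - 1)).trans (by omega)
    have hPn : P.coeff (1 + (n - 1)) = 1 := by
      rw [add_comm, ← hnn]
      exact hP.coeff_natDegree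
    rw [hQ, taylor_coeff, eval_eq_sum_range' (n := 2) (by omega)]
    simp only [Finset.sum_range_succ, Finset.sum_range_zero, zero_add, hasseDeriv_coeff, pow_zero,
      mul_one, pow_one, hPn]
    have h2 : (1 + (n - 1)).choose (n - 1) = n := by
      rw [add_comm, ← hnn]
      have := Nat.choose_symm (n := n) (k := 1) (by omega)
      rw [this, Nat.choose_one_right]
    rw [h2, Nat.choose_self, hc, Nat.cast_one, one_mul, ← mul_assoc]
    have h3 : (n : PowerSeries ℂ) * PowerSeries.C (-(n : ℂ)⁻¹) = -1 := by
      rw [← map_natCast (PowerSeries.C : ℂ →+* PowerSeries ℂ), ← map_mul, mul_neg,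
        mul_inv_cancel₀ hn0, map_neg, map_one]
    rw [h3]
    ring
  by_cases hall : ∀ i < n, Q.coeff i = 0
  · have hX : Q = X ^ n := by
      ext1 i
      rw [coeff_X_pow]
      split_ifs with h
      · rw [h, ← hQd]
        exact hQm.coeff_natDegree
      · rcases lt_or_gt_of_ne h with h | h
        · exact hall i h
        · exact coeff_eq_zero_of_natDegree_lt (by omega)
    rw [hX]
    exact ⟨1, one_ne_zero, (Splits.X_pow n).map _⟩
  push Not at hall
  -- The slope `ord aᵢ / (n - i)` of the Newton polygon is minimal at `i₀`.
  obtain ⟨i₀, hi₀, hmin⟩ := Finset.exists_min_image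
    ((Finset.range n).filter fun i => Q.coeff i ≠ 0)
    (fun i => ((Q.coeff i).order.toNat : ℚ) / ((n - i : ℕ) : ℚ))
    (by
      obtain ⟨i, hi, h⟩ := hall
      exact ⟨i, by simp [hi, h]⟩)
  rw [Finset.mem_filter, Finset.mem_range] at hi₀
  set N := n - i₀ with hN
  have hN0 : N ≠ 0 := by omega
  set s := (Q.coeff i₀).order.toNat with hs
  have hslope : ∀ i < n, Q.coeff i ≠ 0 → s * (n - i) ≤ (Q.coeff i).order.toNat * N := by
    intro i hi hne
    have h := hmin i (by simp [hi, hne])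
    have h1 : (0 : ℚ) < ((n - i₀ : ℕ) : ℚ) := by exact_mod_cast Nat.pos_of_ne_zero hN0
    have h2 : (0 : ℚ) < ((n - i : ℕ) : ℚ) := by exact_mod_cast (by omega : 0 < n - i)
    rw [div_le_div_iff₀ h1 h2] at h
    exact_mod_cast h
  apply SplitsAfterRamification.of_map N hN0
  have hdvd : ∀ i, PowerSeries.X ^ (s * (n - i)) ∣ ramify N hN0 (Q.coeff i) := by
    intro i
    rcases lt_or_ge i n with hi | hi
    · by_cases hne : Q.coeff i = 0
      · rw [hne, map_zero]
        exact dvd_zero _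
      · rw [PowerSeries.X_pow_dvd_iff]
        intro k hk
        change PowerSeries.coeff k (PowerSeries.expand N hN0 (Q.coeff i)) = 0
        rw [PowerSeries.coeff_expand]
        split_ifs with hd
        · apply PowerSeries.coeff_of_lt_order_toNat
          have h1 := hslope i hi hne
          obtain ⟨l, rfl⟩ := hd
          rw [Nat.mul_div_cancel_left _ (Nat.pos_of_ne_zero hN0)]
          by_contra hcon
          push Not at hcon
          have := Nat.mul_le_mul_left N hcon
          rw [mul_comm N] at this
          omega
        · rfl
    · have : n - i = 0 := by omega
      rw [this, mul_zero, pow_zero]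
      exact one_dvd _
  -- After the ramification, the roots are `t ^ s` times the roots of a polynomial `P₁`.
  choose b hb using hdvd
  set P₁ : Polynomial (PowerSeries ℂ) := X ^ n + ∑ i ∈ Finset.range n, C (b i) * X ^ i with hP₁
  have hlow : (∑ i ∈ Finset.range n, C (b i) * X ^ i).degree < (n : WithBot ℕ) := by
    rw [← mem_degreeLT]
    refine Submodule.sum_mem _ fun i hi => ?_
    rw [mem_degreeLT]
    exact (degree_C_mul_X_pow_le i (b i)).trans_lt (by exact_mod_cast Finset.mem_range.1 hi)
  have hP₁m : P₁.Monic := monic_X_pow_add hlow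
  have hP₁d : P₁.natDegree = n := by
    rw [hP₁, natDegree_add_eq_left_of_degree_lt, natDegree_X_pow]
    rw [degree_X_pow]
    exact hlow
  have hP₁c : ∀ i < n, P₁.coeff i = b i := by
    intro i hi
    rw [hP₁, coeff_add, coeff_X_pow, if_neg hi.ne, zero_add, finsetSum_coeff,
      Finset.sum_eq_single i]
    · simp
    · intro j _ hj
      rw [coeff_C_mul_X_pow, if_neg hj.symm]
    · intro h
      exact absurd (Finset.mem_range.2 hi) h
  have hscale : Q.map (ramify N hN0) = P₁.scaleRoots (PowerSeries.X ^ s) := by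
    ext1 i
    rw [coeff_map, coeff_scaleRoots, hP₁d, ← pow_mul, hb i, mul_comm]
    rcases lt_trichotomy i n with hi | hi | hi
    · rw [hP₁c i hi]
    · subst hi
      have h1 : P₁.coeff n = 1 := by rw [← hP₁d]; exact hP₁m.coeff_natDegree
      have h2 := hb n
      have h3 : Q.coeff n = 1 := by rw [← hQd]; exact hQm.coeff_natDegree
      rw [h3, map_one, Nat.sub_self, mul_zero, pow_zero, one_mul] at h2
      rw [h1, ← h2]
    · have h1 : P₁.coeff i = 0 := coeff_eq_zero_of_natDegree_lt (by omega)
      have h2 := hb i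
      have h3 : Q.coeff i = 0 := coeff_eq_zero_of_natDegree_lt (by omega)
      rw [h3, map_zero] at h2
      rw [h1, zero_mul, mul_comm, ← h2]
  rw [hscale]
  apply SplitsAfterRamification.scaleRoots hP₁m
  have hXs : ∀ k, (PowerSeries.X ^ k : PowerSeries ℂ) ≠ 0 := fun k =>
    pow_ne_zero k PowerSeries.X_ne_zero
  have hb1 : b (n - 1) = 0 := by
    have h := hb (n - 1)
    rw [hQ1, map_zero] at h
    exact (mul_eq_zero.1 h.symm).resolve_left (hXs _)
  have hb0 : PowerSeries.constantCoeff (b i₀) ≠ 0 := by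
    have h := congrArg (PowerSeries.coeff (s * N)) (hb i₀)
    have h1 : PowerSeries.coeff (s * N) (ramify N hN0 (Q.coeff i₀)) =
        PowerSeries.coeff s (Q.coeff i₀) := by
      rw [mul_comm]
      exact PowerSeries.coeff_expand_mul N hN0 _ s
    rw [h1, ← hN] at h
    have h2 := PowerSeries.coeff_X_pow_mul (b i₀) (s * N) 0
    rw [zero_add] at h2
    rw [h2] at h
    rw [← PowerSeries.coeff_zero_eq_constantCoeff_apply, ← h]
    exact PowerSeries.coeff_order hi₀.2
  -- The reduction of `P₁` is not a power of a linear polynomial; move one of its roots to `0`.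
  set R := P₁.map (PowerSeries.constantCoeff : PowerSeries ℂ →+* ℂ) with hR
  have hRm : R.Monic := hP₁m.map _
  have hRd : R.natDegree = n := (hP₁m.natDegree_map _).trans hP₁d
  obtain ⟨z, hz⟩ := IsAlgClosed.exists_root R (by
    rw [degree_eq_natDegree hRm.ne_zero, hRd]
    exact_mod_cast hpos.ne')
  apply SplitsAfterRamification.of_taylor (PowerSeries.C z)
  set P₂ := taylor (PowerSeries.C z) P₁ with hP₂
  have hP₂m : P₂.Monic := by
    rw [Monic, hP₂, leadingCoeff_taylor]
    exact hP₁m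
  have hP₂d : P₂.natDegree = n := (natDegree_taylor _ _).trans hP₁d
  have hP₂R : P₂.map (PowerSeries.constantCoeff : PowerSeries ℂ →+* ℂ) = taylor z R := by
    rw [hP₂, Polynomial.map_taylor, PowerSeries.constantCoeff_C]
  have hcoef : ∀ i, PowerSeries.constantCoeff (P₂.coeff i) = (taylor z R).coeff i := by
    intro i
    rw [← hP₂R, coeff_map]
  obtain ⟨f, g, hfg, hfm, hgm, hfd, hgd⟩ := exists_monic_factors hP₂m (by
    rw [hcoef, taylor_coeff_zero]
    exact hz) (by
    by_contra hcon
    push Not at hcon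
    rw [hP₂d] at hcon
    have h1 : taylor z R = X ^ n := by
      ext1 i
      rw [coeff_X_pow]
      split_ifs with h
      · rw [h, ← hRd, ← natDegree_taylor R z]
        exact (show (taylor z R).leadingCoeff = 1 by rw [leadingCoeff_taylor]; exact hRm)
      · rcases lt_or_gt_of_ne h with h | h
        · rw [← hcoef]
          exact hcon i h
        · exact coeff_eq_zero_of_natDegree_lt (by rw [natDegree_taylor]; omega)
    have h2 : R = (X - C z) ^ n := by
      have h3 := congrArg (taylor (-z)) h1
      rw [taylor_taylor, neg_add_cancel, taylor_zero, taylor_pow, taylor_X, C_neg,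
        ← sub_eq_add_neg] at h3
      exact h3
    have h4 : R.nextCoeff = -((n : ℂ) * z) := by
      rw [h2, (monic_X_sub_C z).nextCoeff_pow, nextCoeff_X_sub_C, nsmul_eq_mul, mul_neg]
    rw [nextCoeff_of_natDegree_pos (by omega), hRd, hR, coeff_map, hP₁c _ (by omega), hb1,
      map_zero] at h4
    have h5 : z = 0 := by
      have := neg_eq_zero.1 h4.symm
      exact (mul_eq_zero.1 this).resolve_left hn0
    rw [h5, C_0, sub_zero] at h2
    apply hb0
    have h6 : R.coeff i₀ = PowerSeries.constantCoeff (b i₀) := by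
      rw [hR, coeff_map, hP₁c _ hi₀.1]
    rw [← h6, h2, coeff_X_pow, if_neg (by omega)])
  rw [hfg]
  exact (ih _ (hfd.trans_eq hP₂d) f hfm rfl).mul (ih _ (hgd.trans_eq hP₂d) g hgm rfl)

end

/-! ### Intersection multiplicities in `ℂ⟦x⟧⟦y⟧` -/

noncomputable section

open PowerSeries

theorem derivative_mul_eq {R : Type*} [CommRing R] (a b : R⟦X⟧) :
    d⁄dX R (a * b) = a * d⁄dX R b + b * d⁄dX R a := by
  rw [Derivation.leibniz, smul_eq_mul, smul_eq_mul]

theorem derivative_add_eq {R : Type*} [CommRing R] (a b : R⟦X⟧) :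
    d⁄dX R (a + b) = d⁄dX R a + d⁄dX R b := map_add _ a b

theorem derivative_X_sub_C {R : Type*} [CommRing R] (a : R) : d⁄dX R (X - C a) = 1 := by
  rw [map_sub, derivative_X, derivative_C, sub_zero]

theorem derivative_sum_eq {R : Type*} [CommRing R] {ι : Type*} (s : Finset ι) (a : ι → R⟦X⟧) :
    d⁄dX R (∑ i ∈ s, a i) = ∑ i ∈ s, d⁄dX R (a i) := map_sum _ a s

section restrict

variable {ψ : ℂ⟦X⟧}

theorem map_residue_X_sub_C (hψ : constantCoeff ψ = 0) :
    (X - C ψ : ℂ⟦X⟧⟦X⟧).map (IsLocalRing.residue ℂ⟦X⟧) = X := by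
  rw [map_sub, map_X, map_C, (IsLocalRing.residue_eq_zero_iff ψ).2 (mem_maximalIdeal_iff.2 hψ),
    map_zero, sub_zero]

theorem exists_eq_X_sub_C_mul_add (hψ : constantCoeff ψ = 0) (g : ℂ⟦X⟧⟦X⟧) :
    ∃ r : ℂ⟦X⟧, ∃ q : ℂ⟦X⟧⟦X⟧, g = (X - C ψ) * q + C r := by
  obtain ⟨q, r, h⟩ := exists_isWeierstrassDivision g (g := X - C ψ)
    (by rw [map_residue_X_sub_C hψ]; exact X_ne_zero)
  have hd : r.degree < ((((X - C ψ : ℂ⟦X⟧⟦X⟧).map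
    (IsLocalRing.residue ℂ⟦X⟧)).order.toNat : ℕ) : WithBot ℕ) := h.1
  rw [map_residue_X_sub_C hψ, order_X] at hd
  have hr : r = Polynomial.C (r.coeff 0) :=
    Polynomial.eq_C_of_degree_le_zero (Polynomial.degree_le_iff_coeff_zero _ _ |>.2 fun k hk =>
      Polynomial.coeff_eq_zero_of_degree_lt (hd.trans_le (by
        have : 0 < k := by exact_mod_cast hk
        exact_mod_cast this)))
  refine ⟨r.coeff 0, q, ?_⟩
  have h2 := h.2
  rw [hr, Polynomial.coe_C] at h2
  exact h2

theorem eq_zero_of_X_sub_C_mul_eq (hψ : constantCoeff ψ = 0) {q : ℂ⟦X⟧⟦X⟧} {r : ℂ⟦X⟧}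
    (h : (X - C ψ) * q = C r) : r = 0 := by
  have h1 : IsWeierstrassDivision 0 (X - C ψ) q (Polynomial.C (-r)) := by
    refine ⟨?_, ?_⟩
    · change _ < ((((X - C ψ : ℂ⟦X⟧⟦X⟧).map
        (IsLocalRing.residue ℂ⟦X⟧)).order.toNat : ℕ) : WithBot ℕ)
      rw [map_residue_X_sub_C hψ, order_X]
      exact Polynomial.degree_C_le.trans_lt (by norm_num)
    · rw [h, Polynomial.coe_C, map_neg, add_neg_cancel]
  have h2 := (h1.eq_zero (by rw [map_residue_X_sub_C hψ]; exact X_ne_zero)).2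
  rw [← Polynomial.C_0] at h2
  exact neg_eq_zero.1 (Polynomial.C_injective h2)

theorem eq_of_X_sub_C_mul_add_eq (hψ : constantCoeff ψ = 0) {q q' : ℂ⟦X⟧⟦X⟧} {r r' : ℂ⟦X⟧}
    (h : (X - C ψ) * q + C r = (X - C ψ) * q' + C r') : r = r' := by
  have h1 : (X - C ψ) * (q - q') = C (r' - r) := by
    rw [map_sub]
    linear_combination h
  exact (sub_eq_zero.1 (eq_zero_of_X_sub_C_mul_eq hψ h1)).symm

/-- Restriction of a double power series to the smooth branch `y = ψ(x)`: the remainder of the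
Weierstrass division by `y - ψ(x)`. -/
def restrict (ψ : ℂ⟦X⟧) (hψ : constantCoeff ψ = 0) : ℂ⟦X⟧⟦X⟧ →+* ℂ⟦X⟧ where
  toFun g := (exists_eq_X_sub_C_mul_add hψ g).choose
  map_one' := by
    obtain ⟨q, hq⟩ := (exists_eq_X_sub_C_mul_add hψ 1).choose_spec
    refine (eq_of_X_sub_C_mul_add_eq hψ (q := 0) (q' := q) ?_).symm
    rw [← hq]
    simp
  map_zero' := by
    obtain ⟨q, hq⟩ := (exists_eq_X_sub_C_mul_add hψ 0).choose_spec
    refine (eq_of_X_sub_C_mul_add_eq hψ (q := 0) (q' := q) ?_).symm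
    rw [← hq]
    simp
  map_add' a b := by
    obtain ⟨q, hq⟩ := (exists_eq_X_sub_C_mul_add hψ a).choose_spec
    obtain ⟨q', hq'⟩ := (exists_eq_X_sub_C_mul_add hψ b).choose_spec
    obtain ⟨q'', hq''⟩ := (exists_eq_X_sub_C_mul_add hψ (a + b)).choose_spec
    refine (eq_of_X_sub_C_mul_add_eq hψ (q := q + q') (q' := q'') ?_).symm
    rw [← hq'', map_add]
    linear_combination -hq - hq'
  map_mul' a b := by
    obtain ⟨q, hq⟩ := (exists_eq_X_sub_C_mul_add hψ a).choose_spec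
    obtain ⟨q', hq'⟩ := (exists_eq_X_sub_C_mul_add hψ b).choose_spec
    obtain ⟨q'', hq''⟩ := (exists_eq_X_sub_C_mul_add hψ (a * b)).choose_spec
    refine (eq_of_X_sub_C_mul_add_eq hψ (q' := q'')
      (q := q * b + q' * C (exists_eq_X_sub_C_mul_add hψ a).choose) ?_).symm
    rw [← hq'', map_mul]
    linear_combination -b * hq - C (exists_eq_X_sub_C_mul_add hψ a).choose * hq'

theorem exists_eq_mul_add_restrict (hψ : constantCoeff ψ = 0) (g : ℂ⟦X⟧⟦X⟧) :
    ∃ q, g = (X - C ψ) * q + C (restrict ψ hψ g) :=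
  (exists_eq_X_sub_C_mul_add hψ g).choose_spec

theorem restrict_eq (hψ : constantCoeff ψ = 0) {g q : ℂ⟦X⟧⟦X⟧} {r : ℂ⟦X⟧}
    (h : g = (X - C ψ) * q + C r) : restrict ψ hψ g = r := by
  obtain ⟨q', hq'⟩ := exists_eq_mul_add_restrict hψ g
  exact eq_of_X_sub_C_mul_add_eq hψ (hq'.symm.trans h)

theorem restrict_C (hψ : constantCoeff ψ = 0) (a : ℂ⟦X⟧) : restrict ψ hψ (C a) = a :=
  restrict_eq hψ (q := 0) (by simp)

theorem restrict_X (hψ : constantCoeff ψ = 0) : restrict ψ hψ X = ψ :=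
  restrict_eq hψ (q := 1) (by simp)

theorem restrict_eq_zero_iff (hψ : constantCoeff ψ = 0) {g : ℂ⟦X⟧⟦X⟧} :
    restrict ψ hψ g = 0 ↔ X - C ψ ∣ g := by
  constructor
  · intro h
    obtain ⟨q, hq⟩ := exists_eq_mul_add_restrict hψ g
    rw [h, map_zero, add_zero] at hq
    exact ⟨q, hq⟩
  · rintro ⟨q, rfl⟩
    exact restrict_eq hψ (q := q) (by simp)

theorem constantCoeff_restrict (hψ : constantCoeff ψ = 0) (g : ℂ⟦X⟧⟦X⟧) :
    constantCoeff (restrict ψ hψ g) = constantCoeff (constantCoeff g) := by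
  obtain ⟨q, hq⟩ := exists_eq_mul_add_restrict hψ g
  conv_rhs => rw [hq]
  simp [hψ]

theorem derivX_add (a b : ℂ⟦X⟧⟦X⟧) : (a + b).derivX = a.derivX + b.derivX := by
  ext1 j
  simp [derivX]

theorem derivX_C (a : ℂ⟦X⟧) : derivX (C a) = C (d⁄dX ℂ a) := by
  ext1 j
  simp only [derivX, coeff_mk, coeff_C]
  split_ifs <;> simp

theorem derivX_mul (a b : ℂ⟦X⟧⟦X⟧) : (a * b).derivX = a.derivX * b + a * b.derivX := by
  ext1 j
  rw [derivX, coeff_mk, coeff_mul, derivative_sum_eq, map_add, coeff_mul, coeff_mul,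
    ← Finset.sum_add_distrib]
  refine Finset.sum_congr rfl fun p _ => ?_
  rw [derivative_mul_eq, derivX, derivX, coeff_mk, coeff_mk]
  ring

/-- The chain rule for the restriction to `y = ψ(x)`. -/
theorem derivative_restrict (hψ : constantCoeff ψ = 0) (g : ℂ⟦X⟧⟦X⟧) :
    d⁄dX ℂ (restrict ψ hψ g) =
      restrict ψ hψ g.derivX + d⁄dX ℂ ψ * restrict ψ hψ (d⁄dX (ℂ⟦X⟧) g) := by
  obtain ⟨q, hq⟩ := exists_eq_mul_add_restrict hψ g
  have h0 : restrict ψ hψ (X - C ψ) = 0 := (restrict_eq_zero_iff hψ).2 dvd_rfl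
  have hX : derivX (X - C ψ) = - C (d⁄dX ℂ ψ) := by
    ext1 j
    simp only [derivX, coeff_mk, map_sub, coeff_X, coeff_C, map_neg]
    split_ifs <;> simp
  have hx : restrict ψ hψ g.derivX =
      - d⁄dX ℂ ψ * restrict ψ hψ q + d⁄dX ℂ (restrict ψ hψ g) := by
    conv_lhs => rw [hq]
    rw [derivX_add, derivX_mul, derivX_C, hX, map_add, map_add, map_mul, map_mul, h0, zero_mul,
      add_zero, map_neg, restrict_C, restrict_C]
  have hy : restrict ψ hψ (d⁄dX (ℂ⟦X⟧) g) = restrict ψ hψ q := by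
    conv_lhs => rw [hq]
    rw [derivative_add_eq, derivative_mul_eq, derivative_C, add_zero, derivative_X_sub_C,
      map_add, map_mul, h0, zero_mul, zero_add, mul_one]
  rw [hx, hy]
  ring

end restrict

section rank

/-- The dimension of `R / I`, computed by a surjective linear map with kernel `I`. -/
theorem rank_quotient_eq_of_surjective {R V : Type} [CommRing R] [Algebra ℂ R] [AddCommGroup V]
    [Module ℂ V] (I : Ideal R) (f : R →ₗ[ℂ] V) (hf : Function.Surjective f)
    (h : ∀ g, f g = 0 ↔ g ∈ I) : Module.rank ℂ (R ⧸ I) = Module.rank ℂ V := by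
  have hk : LinearMap.ker f = I.restrictScalars ℂ := by
    ext g
    exact h g
  have e1 := f.quotKerEquivOfSurjective hf
  have e2 : (R ⧸ I.restrictScalars ℂ) ≃ₗ[ℂ] (R ⧸ I) := Submodule.Quotient.restrictScalarsEquiv ℂ I
  exact ((e2.symm.trans (Submodule.quotEquivOfEq _ _ hk.symm)).trans e1).rank_eq

/-- Additivity of the dimension in one of two generators, when the other one is not a zero divisor
modulo one of the factors. -/
theorem rank_quotient_span_mul {R : Type} [CommRing R] [IsDomain R] [Algebra ℂ R] (f g k : R)
    (hg : g ≠ 0) (h : ∀ c, g ∣ k * c → g ∣ c) :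
    Module.rank ℂ (R ⧸ Ideal.span {f * g, k}) =
      Module.rank ℂ (R ⧸ Ideal.span {g, k}) + Module.rank ℂ (R ⧸ Ideal.span {f, k}) := by
  have hle : Ideal.span {f * g, k} ≤ Ideal.span {g, k} := by
    rw [Ideal.span_le]
    rintro x (rfl | rfl)
    · exact Ideal.mul_mem_left _ _ (Ideal.subset_span (by simp))
    · exact Ideal.subset_span (by simp)
  let π : (R ⧸ Ideal.span {f * g, k}) →ₗ[ℂ] (R ⧸ Ideal.span {g, k}) :=
    (Ideal.Quotient.factorₐ ℂ hle).toLinearMap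
  have hπ : Function.Surjective π := Ideal.Quotient.factor_surjective hle
  -- Multiplication by `g` identifies `R / (f, k)` with the kernel of `π`.
  let μ : R →ₗ[ℂ] LinearMap.ker π :=
    LinearMap.codRestrict _ ((Ideal.Quotient.mkₐ ℂ (Ideal.span {f * g, k})).toLinearMap.comp
      (LinearMap.mulLeft ℂ g)) (fun a => by
        rw [LinearMap.mem_ker]
        change Ideal.Quotient.mk (Ideal.span {g, k}) (g * a) = 0
        rw [Ideal.Quotient.eq_zero_iff_mem]
        exact Ideal.mul_mem_right _ _ (Ideal.subset_span (by simp)))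
  have hμ : Function.Surjective μ := by
    rintro ⟨x, hx⟩
    obtain ⟨b, rfl⟩ := Ideal.Quotient.mk_surjective x
    rw [LinearMap.mem_ker] at hx
    change Ideal.Quotient.mk (Ideal.span {g, k}) b = 0 at hx
    rw [Ideal.Quotient.eq_zero_iff_mem, Ideal.mem_span_pair] at hx
    obtain ⟨u, v, rfl⟩ := hx
    refine ⟨u, Subtype.ext ?_⟩
    change Ideal.Quotient.mk (Ideal.span {f * g, k}) (g * u) = Ideal.Quotient.mk _ _
    rw [Ideal.Quotient.eq, Ideal.mem_span_pair]
    exact ⟨0, -v, by ring⟩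
  have hker : ∀ a, μ a = 0 ↔ a ∈ Ideal.span {f, k} := by
    intro a
    rw [Subtype.ext_iff]
    change Ideal.Quotient.mk (Ideal.span {f * g, k}) (g * a) = 0 ↔ _
    rw [Ideal.Quotient.eq_zero_iff_mem, Ideal.mem_span_pair, Ideal.mem_span_pair]
    constructor
    · rintro ⟨u, v, huv⟩
      obtain ⟨w, rfl⟩ := h v ⟨a - u * f, by linear_combination huv⟩
      refine ⟨u, w, mul_left_cancel₀ hg ?_⟩
      linear_combination huv
    · rintro ⟨u, v, rfl⟩
      exact ⟨u, g * v, by ring⟩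
  rw [rank_quotient_eq_of_surjective _ μ hμ hker, ← LinearMap.rank_range_add_rank_ker π,
    rank_range_of_surjective π hπ]

/-- The intersection multiplicity of the smooth branch `y = ψ(x)` with `k = 0`. -/
theorem rank_quotient_span_X_sub_C {ψ : ℂ⟦X⟧} (hψ : constantCoeff ψ = 0) {k : ℂ⟦X⟧⟦X⟧}
    (hk : restrict ψ hψ k ≠ 0) :
    Module.rank ℂ (ℂ⟦X⟧⟦X⟧ ⧸ Ideal.span {X - C ψ, k}) = ((restrict ψ hψ k).order.toNat : ℕ) := by
  set r := restrict ψ hψ k with hr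
  set n := r.order.toNat with hn
  have hsm : ∀ (c : ℂ) (g : ℂ⟦X⟧⟦X⟧), restrict ψ hψ (c • g) = c • restrict ψ hψ g := by
    intro c g
    have h1 : c • g = C (C c) * g := by
      ext j i
      simp
    rw [h1, map_mul, restrict_C, smul_eq_C_mul]
  let f : ℂ⟦X⟧⟦X⟧ →ₗ[ℂ] (Fin n → ℂ) :=
    { toFun := fun g i => coeff (i : ℕ) (restrict ψ hψ g)
      map_add' := fun a b => by
        funext i
        simp
      map_smul' := fun c a => by
        funext i
        simp [hsm] }
  have hf : Function.Surjective f := by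
    intro v
    refine ⟨C (PowerSeries.mk fun i => if h : i < n then v ⟨i, h⟩ else 0), ?_⟩
    funext i
    change coeff (i : ℕ) (restrict ψ hψ (C _)) = v i
    rw [restrict_C, coeff_mk, dif_pos i.2]
  have hrX : ∃ u, IsUnit u ∧ r = X ^ n * u := by
    refine ⟨r.divXPowOrder, ?_, (X_pow_order_mul_divXPowOrder (f := r)).symm⟩
    rw [isUnit_iff_constantCoeff, isUnit_iff_ne_zero, Ne, constantCoeff_divXPowOrder_eq_zero_iff]
    exact hk
  obtain ⟨u, hu, hru⟩ := hrX
  have hker : ∀ g, f g = 0 ↔ g ∈ Ideal.span {X - C ψ, k} := by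
    intro g
    have h1 : f g = 0 ↔ X ^ n ∣ restrict ψ hψ g := by
      rw [X_pow_dvd_iff]
      constructor
      · intro h i hi
        exact congrFun h ⟨i, hi⟩
      · intro h
        funext i
        exact h i i.2
    rw [h1, Ideal.mem_span_pair]
    constructor
    · rintro ⟨c, hc⟩
      obtain ⟨u', hu'⟩ := hu
      have h2 : restrict ψ hψ (g - C (c * (u'⁻¹ : Units _)) * k) = 0 := by
        rw [map_sub, map_mul, restrict_C, hc, ← hr, hru, ← hu']
        have : ((u'⁻¹ : Units _) : ℂ⟦X⟧) * u' = 1 := u'.inv_mul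
        linear_combination -(X ^ n * c) * this
      obtain ⟨q, hq⟩ := (restrict_eq_zero_iff hψ).1 h2
      exact ⟨q, C (c * (u'⁻¹ : Units _)), by linear_combination -hq⟩
    · rintro ⟨a, b, rfl⟩
      have h0 : restrict ψ hψ (X - C ψ) = 0 := (restrict_eq_zero_iff hψ).2 dvd_rfl
      rw [map_add, map_mul, map_mul, h0, mul_zero, zero_add, ← hr, hru]
      exact ⟨restrict ψ hψ b * u, by ring⟩
  rw [rank_quotient_eq_of_surjective _ f hf hker, rank_fin_fun]

open Classical in
/-- The order of vanishing of `k` on the branch `y = ψ(x)`; the value is `0` when `ψ(0) ≠ 0`. -/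
def branchOrder (k : ℂ⟦X⟧⟦X⟧) (ψ : ℂ⟦X⟧) : ℕ :=
  if hψ : constantCoeff ψ = 0 then (restrict ψ hψ k).order.toNat else 0

theorem branchOrder_eq {k : ℂ⟦X⟧⟦X⟧} {ψ : ℂ⟦X⟧} (hψ : constantCoeff ψ = 0) :
    branchOrder k ψ = (restrict ψ hψ k).order.toNat := dif_pos hψ

/-- The intersection multiplicity of a union of smooth branches `y = ψ(x)` with `k = 0`. -/
theorem rank_quotient_span_prod (s : Multiset ℂ⟦X⟧) (hs : ∀ ψ ∈ s, constantCoeff ψ = 0)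
    {k : ℂ⟦X⟧⟦X⟧} (hk : ∀ ψ ∈ s, ∀ hψ : constantCoeff ψ = 0, restrict ψ hψ k ≠ 0) :
    Module.rank ℂ (ℂ⟦X⟧⟦X⟧ ⧸ Ideal.span {(s.map fun ψ => X - C ψ).prod, k}) =
      ((s.map (branchOrder k)).sum : ℕ) := by
  induction s using Multiset.induction_on with
  | empty =>
    have h : Ideal.span {((0 : Multiset ℂ⟦X⟧).map fun ψ => (X - C ψ : ℂ⟦X⟧⟦X⟧)).prod, k} = ⊤ := by
      rw [Ideal.eq_top_iff_one]
      exact Ideal.subset_span (by simp)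
    rw [h, Multiset.map_zero, Multiset.sum_zero, Nat.cast_zero]
    exact rank_subsingleton' _ _
  | cons ψ s ih =>
    have hψ := hs ψ (Multiset.mem_cons_self ψ s)
    have h1 := hk ψ (Multiset.mem_cons_self ψ s) hψ
    rw [Multiset.map_cons, Multiset.prod_cons, mul_comm, rank_quotient_span_mul,
      rank_quotient_span_X_sub_C hψ h1, ← branchOrder_eq hψ,
      ih (fun η hη => hs η (Multiset.mem_cons_of_mem hη))
        (fun η hη => hk η (Multiset.mem_cons_of_mem hη)),
      Multiset.map_cons, Multiset.sum_cons, Nat.cast_add]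
    · intro h
      have h3 := congrArg (coeff 1) h
      simp at h3
    · intro c hc
      rw [← restrict_eq_zero_iff hψ, map_mul] at hc
      rw [← restrict_eq_zero_iff hψ]
      exact (mul_eq_zero.1 hc).resolve_left h1

theorem span_pair_eq_of_unit_mul {R : Type*} [CommRing R] {u a b : R} (hu : IsUnit u) :
    Ideal.span {u * a, b} = Ideal.span {a, b} := by
  rw [Ideal.span_insert, Ideal.span_insert, Ideal.span_singleton_mul_left_unit hu]

end rank

section ramification

variable {e : ℕ} (he : e ≠ 0)

/-- The part of a double power series with exponents of `x` congruent to `i` modulo `e`. -/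
def residuePart (e i : ℕ) : ℂ⟦X⟧⟦X⟧ →ₗ[ℂ] ℂ⟦X⟧⟦X⟧ where
  toFun s := PowerSeries.mk fun j => PowerSeries.mk fun n => coeff (e * n + i) (coeff j s)
  map_add' a b := by
    ext j n
    simp
  map_smul' c a := by
    ext j n
    simp

theorem sum_residuePart (s : ℂ⟦X⟧⟦X⟧) :
    s = ∑ i : Fin e, C (X ^ (i : ℕ)) * expandX e he (residuePart e i s) := by
  ext j n
  simp only [map_sum, coeff_C_mul, coeff_expandX, coeff_X_pow_mul', coeff_expand]
  have hpos := Nat.pos_of_ne_zero he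
  rw [Finset.sum_eq_single ⟨n % e, Nat.mod_lt n hpos⟩]
  · have h1 : n - n % e = e * (n / e) := by
      have := Nat.mod_add_div n e
      omega
    rw [if_pos (Nat.mod_le n e), h1, if_pos (dvd_mul_right _ _), Nat.mul_div_cancel_left _ hpos]
    simp only [residuePart, LinearMap.coe_mk, AddHom.coe_mk, coeff_mk]
    rw [Nat.div_add_mod]
  · intro i _ hi
    split_ifs with h1 h2
    · exfalso
      apply hi
      ext
      obtain ⟨c, hc⟩ := h2
      have h3 : n = i + e * c := by omega
      rw [h3]
      simp [Nat.mod_eq_of_lt i.2]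
    · rfl
    · rfl
  · simp

theorem residuePart_sum (c : Fin e → ℂ⟦X⟧⟦X⟧) (i : Fin e) :
    residuePart e i (∑ j : Fin e, C (X ^ (j : ℕ)) * expandX e he (c j)) = c i := by
  have hpos := Nat.pos_of_ne_zero he
  ext j n
  simp only [residuePart, LinearMap.coe_mk, AddHom.coe_mk, coeff_mk, map_sum, coeff_C_mul,
    coeff_expandX, coeff_X_pow_mul', coeff_expand]
  rw [Finset.sum_eq_single i]
  · rw [if_pos (by omega), Nat.add_sub_cancel, if_pos (dvd_mul_right _ _),
      Nat.mul_div_cancel_left _ hpos]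
  · intro k _ hk
    split_ifs with h1 h2
    · exfalso
      apply hk
      ext
      obtain ⟨a, ha⟩ := h2
      have h3 : e * n + i = k + e * a := by omega
      have h4 := congrArg (· % e) h3
      simp only [Nat.mul_add_mod, Nat.add_mul_mod_self_left, Nat.mod_eq_of_lt i.2,
        Nat.mod_eq_of_lt k.2] at h4
      exact h4.symm
    · rfl
    · rfl
  · simp

theorem residuePart_expandX_mul (a b : ℂ⟦X⟧⟦X⟧) (i : Fin e) :
    residuePart e i (expandX e he a * b) = a * residuePart e i b := by
  conv_lhs => rw [sum_residuePart he b, Finset.mul_sum]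
  have h : ∀ j : Fin e, expandX e he a * (C (X ^ (j : ℕ)) * expandX e he (residuePart e j b)) =
      C (X ^ (j : ℕ)) * expandX e he (a * residuePart e j b) := by
    intro j
    rw [map_mul]
    ring
  simp only [h]
  exact residuePart_sum he (fun j => a * residuePart e j b) i

/-- A ramification `x = t ^ e` multiplies intersection multiplicities by `e`. -/
theorem rank_quotient_span_expandX (f g : ℂ⟦X⟧⟦X⟧) :
    Module.rank ℂ (ℂ⟦X⟧⟦X⟧ ⧸ Ideal.span {expandX e he f, expandX e he g}) =
      e * Module.rank ℂ (ℂ⟦X⟧⟦X⟧ ⧸ Ideal.span {f, g}) := by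
  let Φ : ℂ⟦X⟧⟦X⟧ →ₗ[ℂ] (Fin e → ℂ⟦X⟧⟦X⟧ ⧸ Ideal.span {f, g}) :=
    LinearMap.pi fun i => (Ideal.Quotient.mkₐ ℂ (Ideal.span {f, g})).toLinearMap.comp
      (residuePart e i)
  have hΦ : ∀ s i, Φ s i = Ideal.Quotient.mk (Ideal.span {f, g}) (residuePart e i s) :=
    fun _ _ => rfl
  have hsurj : Function.Surjective Φ := by
    intro v
    choose c hc using fun i => Ideal.Quotient.mk_surjective (v i)
    refine ⟨∑ j : Fin e, C (X ^ (j : ℕ)) * expandX e he (c j), ?_⟩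
    funext i
    rw [hΦ, residuePart_sum he, hc]
  rw [rank_quotient_eq_of_surjective _ Φ hsurj, rank_fun, Fintype.card_fin]
  intro s
  constructor
  · intro h
    rw [sum_residuePart he s]
    refine Ideal.sum_mem _ fun i _ => Ideal.mul_mem_left _ _ ?_
    have h1 := congrFun h i
    rw [hΦ, Pi.zero_apply, Ideal.Quotient.eq_zero_iff_mem, Ideal.mem_span_pair] at h1
    obtain ⟨a, b, hab⟩ := h1
    rw [← hab, map_add, map_mul, map_mul, Ideal.mem_span_pair]
    exact ⟨_, _, rfl⟩
  · intro h
    rw [Ideal.mem_span_pair] at h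
    obtain ⟨a, b, rfl⟩ := h
    funext i
    rw [hΦ, Pi.zero_apply, Ideal.Quotient.eq_zero_iff_mem, Ideal.mem_span_pair, map_add,
      mul_comm a, mul_comm b, residuePart_expandX_mul, residuePart_expandX_mul]
    exact ⟨residuePart e i a, residuePart e i b, by ring⟩

end ramification

end

/-! ### The Milnor number of an irreducible double power series -/

noncomputable section

open PowerSeries

theorem derivative_expand (e : ℕ) (he : e ≠ 0) (f : ℂ⟦X⟧) :
    d⁄dX ℂ (expand e he f) = (e : ℂ⟦X⟧) * X ^ (e - 1) * expand e he (d⁄dX ℂ f) := by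
  rw [expand_apply, expand_apply, derivative_subst (HasSubst.X_pow he), derivative_pow,
    derivative_X, mul_one, mul_comm]

theorem derivX_expandX (e : ℕ) (he : e ≠ 0) (g : ℂ⟦X⟧⟦X⟧) :
    (expandX e he g).derivX = C ((e : ℂ⟦X⟧) * X ^ (e - 1)) * expandX e he g.derivX := by
  ext1 j
  rw [derivX, coeff_mk, coeff_expandX, derivative_expand, coeff_C_mul, coeff_expandX, derivX,
    coeff_mk]

theorem derivative_expandX (e : ℕ) (he : e ≠ 0) (g : ℂ⟦X⟧⟦X⟧) :
    d⁄dX (ℂ⟦X⟧) (expandX e he g) = expandX e he (d⁄dX (ℂ⟦X⟧) g) := by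
  ext1 j
  rw [coeff_derivative, coeff_expandX, coeff_expandX, coeff_derivative, map_mul, map_add,
    map_natCast, map_one]

theorem expandX_X_sub_C (e : ℕ) (he : e ≠ 0) (a : ℂ⟦X⟧) :
    expandX e he (X - C a) = X - C (expand e he a) := by
  rw [map_sub, expandX, map_X, map_C]
  rfl

theorem expandX_expandX (a b : ℕ) (ha : a ≠ 0) (hb : b ≠ 0) (g : ℂ⟦X⟧⟦X⟧) :
    expandX a ha (expandX b hb g) = expandX (a * b) (mul_ne_zero ha hb) g := by
  ext1 j
  rw [coeff_expandX, coeff_expandX, coeff_expandX, expand_mul]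

theorem expandX_comm (a b : ℕ) (ha : a ≠ 0) (hb : b ≠ 0) (g : ℂ⟦X⟧⟦X⟧) :
    expandX a ha (expandX b hb g) = expandX b hb (expandX a ha g) := by
  rw [expandX_expandX, expandX_expandX]
  have h : ∀ n n' (hn : n ≠ 0) (hn' : n' ≠ 0), n = n' → expandX n hn g = expandX n' hn' g := by
    rintro n _ hn hn' rfl
    rfl
  exact h _ _ _ _ (mul_comm a b)

/-- The reduction of a double power series modulo `x`. -/
abbrev reduceX : ℂ⟦X⟧⟦X⟧ →+* ℂ⟦X⟧ := PowerSeries.map (constantCoeff : ℂ⟦X⟧ →+* ℂ)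

theorem reduceX_expandX (e : ℕ) (he : e ≠ 0) (g : ℂ⟦X⟧⟦X⟧) :
    reduceX (expandX e he g) = reduceX g := by
  ext1 j
  rw [coeff_map, coeff_map, coeff_expandX, constantCoeff_expand]

theorem reduceX_derivative (g : ℂ⟦X⟧⟦X⟧) :
    reduceX (d⁄dX (ℂ⟦X⟧) g) = d⁄dX ℂ (reduceX g) := by
  ext1 j
  rw [coeff_map, coeff_derivative, coeff_derivative, coeff_map, map_mul, map_add, map_natCast,
    map_one]

theorem order_map_residue (g : ℂ⟦X⟧⟦X⟧) :
    (g.map (IsLocalRing.residue ℂ⟦X⟧)).order = (reduceX g).order := by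
  have h : ∀ j, coeff j (g.map (IsLocalRing.residue ℂ⟦X⟧)) = 0 ↔ coeff j (reduceX g) = 0 := by
    intro j
    rw [coeff_map, coeff_map, IsLocalRing.residue_eq_zero_iff, mem_maximalIdeal_iff]
  apply le_antisymm
  · refine le_order _ _ fun i hi => (h i).1 (coeff_of_lt_order i hi)
  · refine le_order _ _ fun i hi => (h i).2 (coeff_of_lt_order i hi)

theorem order_rescale {c : ℂ} (hc : c ≠ 0) (f : ℂ⟦X⟧) : (rescale c f).order = f.order := by
  have h : ∀ j, coeff j (rescale c f) = 0 ↔ coeff j f = 0 := by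
    intro j
    rw [coeff_rescale, mul_eq_zero, or_iff_right (pow_ne_zero j hc)]
  apply le_antisymm
  · refine le_order _ _ fun i hi => (h i).1 (coeff_of_lt_order i hi)
  · refine le_order _ _ fun i hi => (h i).2 (coeff_of_lt_order i hi)

/-- A double power series whose reduction modulo `x` has order `d` is, after a ramification, a unit
times a product of `d` linear factors. -/
theorem exists_linear_factors {g : ℂ⟦X⟧⟦X⟧} {d : ℕ} (hg : (reduceX g).order = d) :
    ∃ (e : ℕ) (he : e ≠ 0) (u : ℂ⟦X⟧⟦X⟧) (s : Multiset ℂ⟦X⟧), IsUnit u ∧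
      s.card = d ∧ (∀ ψ ∈ s, constantCoeff ψ = 0) ∧
      expandX e he g = u * (s.map fun ψ => (X - C ψ : ℂ⟦X⟧⟦X⟧)).prod := by
  have hne : g.map (IsLocalRing.residue ℂ⟦X⟧) ≠ 0 := by
    intro h
    have h1 := order_map_residue g
    rw [h, hg, order_zero] at h1
    exact ENat.top_ne_natCast d h1
  obtain ⟨P, u, hW⟩ := exists_isWeierstrassFactorization hne
  have hPm : P.Monic := hW.isDistinguishedAt.monic
  have hPd : P.natDegree = d := by
    rw [hW.natDegree_eq_toNat_order_map, order_map_residue, hg, ENat.toNat_natCast]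
  have hPc : P.map (constantCoeff : ℂ⟦X⟧ →+* ℂ) = Polynomial.X ^ d := by
    ext1 i
    rw [Polynomial.coeff_map, Polynomial.coeff_X_pow]
    split_ifs with h
    · rw [h, ← hPd, hPm.coeff_natDegree, map_one]
    · rcases lt_or_gt_of_ne h with h | h
      · rw [← mem_maximalIdeal_iff]
        exact hW.isDistinguishedAt.mem (by omega)
      · rw [Polynomial.coeff_eq_zero_of_natDegree_lt (by omega), map_zero]
  obtain ⟨e, he, hs⟩ := splitsAfterRamification P hPm
  set Q := P.map (ramify e he) with hQ
  have hQm : Q.Monic := hPm.map _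
  have hQs : Q.Splits := hs
  refine ⟨e, he, expandX e he u, Q.roots, hW.isUnit.map _, ?_, ?_, ?_⟩
  · rw [← hQs.natDegree_eq_card_roots, hPm.natDegree_map, hPd]
  · intro ψ hψ
    have h1 : Q.eval ψ = 0 := (Polynomial.mem_roots hQm.ne_zero).1 hψ
    have h2 : (Q.map (constantCoeff : ℂ⟦X⟧ →+* ℂ)).eval (constantCoeff ψ) = 0 := by
      rw [Polynomial.eval_map_apply, h1, map_zero]
    have h3 : Q.map (constantCoeff : ℂ⟦X⟧ →+* ℂ) = P.map (constantCoeff : ℂ⟦X⟧ →+* ℂ) := by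
      ext1 i
      rw [Polynomial.coeff_map, hQ, Polynomial.coeff_map, Polynomial.coeff_map]
      exact constantCoeff_expand e he _
    rw [h3, hPc, Polynomial.eval_pow, Polynomial.eval_X] at h2
    by_contra h
    exact pow_ne_zero d h h2
  · have h1 : expandX e he (P : ℂ⟦X⟧⟦X⟧) = ((Q : Polynomial ℂ⟦X⟧) : ℂ⟦X⟧⟦X⟧) := by
      rw [hQ, Polynomial.polynomial_map_coe]
      rfl
    rw [hW.eq_mul, map_mul, mul_comm, h1]
    congr 1
    conv_lhs => rw [hQs.eq_prod_roots_of_monic hQm]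
    rw [← Polynomial.coeToPowerSeries.ringHom_apply, map_multiset_prod, Multiset.map_map]
    congr 1
    refine Multiset.map_congr rfl fun ψ _ => ?_
    simp

/-- The orders of the differences of conjugates only depend on the quotient of the roots of
unity. -/
theorem sum_order_rescale_sub {m : ℕ} (hm : m ≠ 0) (φ : ℂ⟦X⟧) {ζ : ℂ}
    (hζ : ζ ∈ Polynomial.nthRootsFinset m (1 : ℂ)) :
    ∑ η ∈ (Polynomial.nthRootsFinset m (1 : ℂ)).erase ζ,
      (rescale ζ φ - rescale η φ).order.toNat =
    ∑ η ∈ (Polynomial.nthRootsFinset m (1 : ℂ)).erase 1, (rescale η φ - φ).order.toNat := by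
  rw [mem_rootsOfUnity_iff hm] at hζ
  have hζ0 : ζ ≠ 0 := by
    rintro rfl
    rw [zero_pow hm] at hζ
    exact zero_ne_one hζ
  refine Finset.sum_nbij' (fun η => η * ζ⁻¹) (fun η => η * ζ) ?_ ?_ ?_ ?_ ?_
  · intro η hη
    rw [Finset.mem_erase, mem_rootsOfUnity_iff hm] at hη ⊢
    refine ⟨fun h => hη.1 ((mul_inv_eq_one₀ hζ0).1 h), ?_⟩
    rw [mul_pow, inv_pow, hη.2, hζ, inv_one, one_mul]
  · intro η hη
    rw [Finset.mem_erase, mem_rootsOfUnity_iff hm] at hη ⊢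
    refine ⟨fun h => hη.1 (mul_right_cancel₀ hζ0 (by rw [h, one_mul])), ?_⟩
    rw [mul_pow, hη.2, hζ, one_mul]
  · intro η _
    simp [hζ0]
  · intro η _
    simp [hζ0]
  · intro η _
    have h1 : rescale ζ φ - rescale η φ = -rescale ζ (rescale (η * ζ⁻¹) φ - φ) := by
      rw [map_sub, rescale_rescale, inv_mul_cancel_right₀ hζ0]
      ring
    rw [h1, order_neg, order_rescale hζ0]

theorem rank_eq_natCast_of_mul_eq {M : Cardinal} {e n : ℕ} (he : e ≠ 0)
    (h : (e : Cardinal) * M = n) : ∃ k : ℕ, M = k ∧ e * k = n := by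
  have hlt : M < Cardinal.aleph0 := by
    by_contra hcon
    push Not at hcon
    have h1 : M ≤ (e : Cardinal) * M := by
      calc M = 1 * M := (one_mul M).symm
        _ ≤ (e : Cardinal) * M := by
          gcongr
          exact_mod_cast Nat.one_le_iff_ne_zero.2 he
    rw [h] at h1
    exact absurd (hcon.trans h1) (not_le.2 (Cardinal.natCast_lt_aleph0))
  obtain ⟨k, rfl⟩ := Cardinal.lt_aleph0.1 hlt
  exact ⟨k, rfl, by exact_mod_cast h⟩

/-- The Milnor number of `h = V F`, for a unit `V` and `F` the product of the conjugates of
`y - φ(x ^ (1 / m))`, is given by the orders of the differences of the conjugates of `φ`.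

The intersection multiplicity of `h` with its polar `∂h/∂y` is computed twice: on the conjugates of
`φ` it gives the discriminant, while on the branches of the polar, where `h` is differentiated
along the branch, it exceeds the intersection multiplicity of the two partial derivatives by
`m - 1`. -/
theorem exists_rank_quotient_eq {m : ℕ} (hm : m ≠ 0) {φ : ℂ⟦X⟧} (hφ : constantCoeff φ = 0)
    (hne : ∀ ζ : ℂ, ζ ^ m = 1 → ζ ≠ 1 → rescale ζ φ ≠ φ) {V F : ℂ⟦X⟧⟦X⟧} (hV : IsUnit V)
    (hF : expandX m hm F =
      ∏ ζ ∈ Polynomial.nthRootsFinset m (1 : ℂ), (X - C (rescale ζ φ))) :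
    ∃ μ : ℕ, Module.rank ℂ (ℂ⟦X⟧⟦X⟧ ⧸ Ideal.span {(V * F).derivX, d⁄dX (ℂ⟦X⟧) (V * F)}) = μ ∧
      μ + (m - 1) = ∑ ζ ∈ (Polynomial.nthRootsFinset m (1 : ℂ)).erase 1,
        (rescale ζ φ - φ).order.toNat := by
  classical
  set R := Polynomial.nthRootsFinset m (1 : ℂ) with hR
  have hcard : R.card = m := (Complex.isPrimitiveRoot_exp m hm).card_nthRootsFinset
  have hcc : ∀ ζ, constantCoeff (rescale ζ φ) = 0 := by
    intro ζ
    rw [← coeff_zero_eq_constantCoeff_apply, coeff_rescale, coeff_zero_eq_constantCoeff_apply, hφ,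
      mul_zero]
  have hpair : ∀ ζ ∈ R, ∀ η ∈ R, η ≠ ζ → rescale ζ φ - rescale η φ ≠ 0 := by
    intro ζ hζ η hη hn h
    rw [hR, mem_rootsOfUnity_iff hm] at hζ hη
    have hζ0 : ζ ≠ 0 := by
      rintro rfl
      rw [zero_pow hm] at hζ
      exact zero_ne_one hζ
    apply hne (η * ζ⁻¹)
    · rw [mul_pow, inv_pow, hη, hζ, inv_one, one_mul]
    · exact fun h => hn ((mul_inv_eq_one₀ hζ0).1 h)
    · have h1 := congrArg (rescale ζ⁻¹) (sub_eq_zero.1 h)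
      rw [rescale_rescale, rescale_rescale, mul_inv_cancel₀ hζ0, rescale_one] at h1
      exact h1.symm
  set h := V * F with hh
  -- The polar `∂h/∂y` is regular of order `m - 1` in `y`.
  have hredF : reduceX F = X ^ m := by
    rw [← reduceX_expandX m hm, hF, map_prod, ← hcard, ← Finset.prod_const]
    refine Finset.prod_congr rfl fun ζ _ => ?_
    rw [map_sub, map_X, map_C, hcc, map_zero, sub_zero]
  have hord : (reduceX (d⁄dX (ℂ⟦X⟧) h)).order = (m - 1 : ℕ) := by
    have h1 : reduceX h = X ^ m * reduceX V := by rw [hh, map_mul, hredF, mul_comm]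
    rw [reduceX_derivative, h1, order_eq_nat]
    constructor
    · rw [coeff_derivative, coeff_X_pow_mul', if_pos (by omega)]
      have h2 : m - 1 + 1 - m = 0 := by omega
      rw [h2, coeff_zero_eq_constantCoeff_apply]
      refine mul_ne_zero (isUnit_constantCoeff _ (hV.map _)).ne_zero ?_
      exact_mod_cast Nat.succ_ne_zero (m - 1)
    · intro i hi
      rw [coeff_derivative, coeff_X_pow_mul', if_neg (by omega), zero_mul]
  obtain ⟨e₀, he₀, u, s, hu, hsc, hs0, hfac⟩ := exists_linear_factors hord
  -- Pass to `x = t ^ e`, where both `h` and its polar are products of linear factors.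
  set e := e₀ * m with he
  have he0 : e ≠ 0 := mul_ne_zero he₀ hm
  set H := expandX e he0 h with hH
  set Hy := d⁄dX (ℂ⟦X⟧) H with hHy
  set Kx := expandX e he0 h.derivX with hKx
  have hHx : H.derivX = C ((e : ℂ⟦X⟧) * X ^ (e - 1)) * Kx := derivX_expandX e he0 h
  have hHyK : Hy = expandX e he0 (d⁄dX (ℂ⟦X⟧) h) := derivative_expandX e he0 h
  set ψ : ℂ → ℂ⟦X⟧ := fun ζ => expand e₀ he₀ (rescale ζ φ) with hψ
  have hψ0 : ∀ ζ, constantCoeff (ψ ζ) = 0 := fun ζ => by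
    rw [hψ]
    exact (constantCoeff_expand e₀ he₀ _).trans (hcc ζ)
  have hHprod : H = expandX e he0 V * ∏ ζ ∈ R, (X - C (ψ ζ)) := by
    rw [hH, hh, map_mul]
    congr 1
    rw [← expandX_expandX e₀ m he₀ hm, hF, map_prod]
    exact Finset.prod_congr rfl fun ζ _ => expandX_X_sub_C e₀ he₀ _
  have hVu : IsUnit (expandX e he0 V) := hV.map _
  set t : Multiset ℂ⟦X⟧ := s.map (expand m hm) with ht
  have ht0 : ∀ η ∈ t, constantCoeff η = 0 := by
    intro η hη
    obtain ⟨ξ, hξ, rfl⟩ := Multiset.mem_map.1 hη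
    exact (constantCoeff_expand m hm ξ).trans (hs0 ξ hξ)
  have hHyprod : Hy = expandX m hm u * (t.map fun η => (X - C η : ℂ⟦X⟧⟦X⟧)).prod := by
    rw [hHyK, ← expandX_expandX e₀ m he₀ hm, expandX_comm, hfac, map_mul, map_multiset_prod, ht,
      Multiset.map_map, Multiset.map_map]
    congr 2
    exact Multiset.map_congr rfl fun ξ _ => expandX_X_sub_C m hm ξ
  have huu : IsUnit (expandX m hm u) := hu.map _
  -- The polar restricted to a conjugate of `φ`.
  have hrestr : ∀ ζ ∈ R, restrict (ψ ζ) (hψ0 ζ) Hy =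
      restrict (ψ ζ) (hψ0 ζ) (expandX e he0 V) * ∏ η ∈ R.erase ζ, (ψ ζ - ψ η) := by
    intro ζ hζ
    have h0 : restrict (ψ ζ) (hψ0 ζ) (X - C (ψ ζ)) = 0 := (restrict_eq_zero_iff _).2 dvd_rfl
    have h1 : H = (X - C (ψ ζ)) * (expandX e he0 V * ∏ η ∈ R.erase ζ, (X - C (ψ η))) := by
      rw [hHprod, ← Finset.mul_prod_erase R _ hζ]
      ring
    rw [hHy, h1, derivative_mul_eq, derivative_X_sub_C, map_add, map_mul, h0, zero_mul, zero_add,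
      mul_one, map_mul, map_prod]
    congr 1
    refine Finset.prod_congr rfl fun η _ => ?_
    rw [map_sub, restrict_X, restrict_C]
  have hψsub : ∀ ζ η, ψ ζ - ψ η = expand e₀ he₀ (rescale ζ φ - rescale η φ) := by
    intro ζ η
    rw [map_sub]
  have hψne : ∀ ζ ∈ R, ∀ η ∈ R.erase ζ, ψ ζ - ψ η ≠ 0 := by
    intro ζ hζ η hη h0
    rw [Finset.mem_erase] at hη
    have h1 := congrArg order h0
    rw [hψsub, order_expand, order_zero, ← coe_toNat_order (hpair ζ hζ η hη.2 hη.1)] at h1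
    simp at h1
    exact ENat.natCast_ne_top _ (by exact_mod_cast h1)
  have hrestr_ne : ∀ ζ ∈ R, restrict (ψ ζ) (hψ0 ζ) Hy ≠ 0 := by
    intro ζ hζ
    rw [hrestr ζ hζ]
    exact mul_ne_zero (hVu.map _).ne_zero (Finset.prod_ne_zero_iff.2 (hψne ζ hζ))
  set B := ∑ ζ ∈ R.erase 1, (rescale ζ φ - φ).order.toNat with hB
  have hbo : ∀ ζ ∈ R, branchOrder Hy (ψ ζ) = e₀ * B := by
    intro ζ hζ
    have h1 : (restrict (ψ ζ) (hψ0 ζ) Hy).order = ((e₀ * B : ℕ) : ℕ∞) := by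
      rw [hrestr ζ hζ, order_mul, order_zero_of_unit (hVu.map _), zero_add, order_prod, hB,
        ← sum_order_rescale_sub hm φ hζ, Finset.mul_sum, Nat.cast_sum]
      refine Finset.sum_congr rfl fun η hη => ?_
      rw [Finset.mem_erase] at hη
      rw [hψsub, order_expand, Nat.cast_mul, coe_toNat_order (hpair ζ hζ η hη.2 hη.1), nsmul_eq_mul]
    rw [branchOrder_eq (hψ0 ζ), h1, ENat.toNat_natCast]
  have hrank1 : Module.rank ℂ (ℂ⟦X⟧⟦X⟧ ⧸ Ideal.span {H, Hy}) = ((m * (e₀ * B) : ℕ) : Cardinal) := by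
    have h1 : (∏ ζ ∈ R, (X - C (ψ ζ)) : ℂ⟦X⟧⟦X⟧) =
        ((R.val.map ψ).map fun η => (X - C η : ℂ⟦X⟧⟦X⟧)).prod := by
      rw [Multiset.map_map]
      rfl
    rw [hHprod, span_pair_eq_of_unit_mul hVu, h1, rank_quotient_span_prod]
    · congr 1
      rw [Multiset.map_map]
      change ∑ ζ ∈ R, branchOrder Hy (ψ ζ) = _
      rw [Finset.sum_congr rfl hbo, Finset.sum_const, hcard, smul_eq_mul]
    · intro η hη
      obtain ⟨ζ, _, rfl⟩ := Multiset.mem_map.1 hη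
      exact hψ0 ζ
    · intro η hη hη0
      obtain ⟨ζ, hζ, rfl⟩ := Multiset.mem_map.1 hη
      exact hrestr_ne ζ hζ
  -- On the branches of the polar, the derivative of `h` along the branch is `∂h/∂x`.
  have hpolar : ∀ η ∈ t, ∀ hη : constantCoeff η = 0, restrict η hη H ≠ 0 ∧ restrict η hη Kx ≠ 0 ∧
      branchOrder H η = branchOrder Kx η + e := by
    intro η hηt hη
    have hy0 : restrict η hη Hy = 0 := by
      rw [hHyprod, map_mul, map_multiset_prod, Multiset.map_map, Multiset.prod_eq_zero, mul_zero]
      refine Multiset.mem_map.2 ⟨η, hηt, ?_⟩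
      exact (restrict_eq_zero_iff hη).2 dvd_rfl
    have hr0 : restrict η hη H ≠ 0 := by
      intro h0
      rw [hHprod, map_mul, map_prod] at h0
      have h1 := (mul_eq_zero.1 h0).resolve_left (hVu.map (restrict η hη)).ne_zero
      obtain ⟨ζ, hζ, h2⟩ := Finset.prod_eq_zero_iff.1 h1
      rw [map_sub, restrict_X, restrict_C, sub_eq_zero] at h2
      subst h2
      exact hrestr_ne ζ hζ hy0
    have hd := derivative_restrict hη H
    rw [← hHy, hy0, mul_zero, add_zero, hHx, map_mul, restrict_C] at hd
    have hc0 : constantCoeff (restrict η hη H) = 0 := by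
      rw [constantCoeff_restrict, hHprod, map_mul, map_mul, map_prod, map_prod]
      have h1 : (1 : ℂ) ∈ R := (mem_rootsOfUnity_iff hm).2 (one_pow m)
      rw [Finset.prod_eq_zero h1, mul_zero]
      simp [hψ0]
    set r := restrict η hη H with hr
    obtain ⟨n, hn⟩ : ∃ n : ℕ, r.order = ((n + 1 : ℕ) : ℕ∞) := by
      have h1 := coe_toNat_order hr0
      have h2 : r.order ≠ 0 := order_ne_zero_iff_constCoeff_eq_zero.2 hc0
      refine ⟨r.order.toNat - 1, ?_⟩
      rw [← h1] at h2 ⊢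
      have h3 : r.order.toNat ≠ 0 := by exact_mod_cast h2
      rw [ENat.toNat_natCast, Nat.sub_add_cancel (Nat.one_le_iff_ne_zero.2 h3)]
    have hrd : (d⁄dX ℂ r).order = (n : ℕ∞) := by
      rw [order_eq_nat] at hn ⊢
      refine ⟨?_, fun i hi => ?_⟩
      · rw [coeff_derivative]
        exact mul_ne_zero hn.1 (by exact_mod_cast Nat.succ_ne_zero n)
      · rw [coeff_derivative, hn.2 (i + 1) (by omega), zero_mul]
    have heu : ((e : ℂ⟦X⟧)).order = 0 := by
      apply order_zero_of_unit
      rw [isUnit_iff_constantCoeff, map_natCast, isUnit_iff_ne_zero]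
      exact_mod_cast he0
    rw [hd, order_mul, order_mul, heu, order_X_pow, zero_add] at hrd
    have hk0 : restrict η hη Kx ≠ 0 := by
      intro h0
      rw [h0, order_zero, add_top] at hrd
      exact ENat.top_ne_natCast n hrd
    refine ⟨hr0, hk0, ?_⟩
    rw [branchOrder_eq hη, branchOrder_eq hη, ← hr, hn, ENat.toNat_natCast]
    rw [← coe_toNat_order hk0] at hrd
    have h1 : e - 1 + (restrict η hη Kx).order.toNat = n := by exact_mod_cast hrd
    omega
  have hrank2 : Module.rank ℂ (ℂ⟦X⟧⟦X⟧ ⧸ Ideal.span {Hy, H}) =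
      (((t.map (branchOrder Kx)).sum + (m - 1) * e : ℕ) : Cardinal) := by
    rw [hHyprod, span_pair_eq_of_unit_mul huu, rank_quotient_span_prod t ht0
      fun η hη h0 => (hpolar η hη h0).1]
    congr 1
    rw [Multiset.map_congr rfl fun η hη => (hpolar η hη (ht0 η hη)).2.2, Multiset.sum_map_add,
      Multiset.map_const', Multiset.sum_replicate, smul_eq_mul, ht, Multiset.card_map, hsc]
  have hrank3 : Module.rank ℂ (ℂ⟦X⟧⟦X⟧ ⧸ Ideal.span {Hy, Kx}) =
      (((t.map (branchOrder Kx)).sum : ℕ) : Cardinal) := by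
    rw [hHyprod, span_pair_eq_of_unit_mul huu, rank_quotient_span_prod t ht0
      fun η hη h0 => (hpolar η hη h0).2.1]
  rw [hHyK, hKx, rank_quotient_span_expandX he0] at hrank3
  obtain ⟨μ, hμ, hμe⟩ := rank_eq_natCast_of_mul_eq he0 hrank3
  refine ⟨μ, by rw [Ideal.span_pair_comm]; exact hμ, ?_⟩
  rw [Ideal.span_pair_comm, hrank1, ← hμe] at hrank2
  have h1 : m * (e₀ * B) = e * μ + (m - 1) * e := by exact_mod_cast hrank2
  have h2 : e * (μ + (m - 1)) = e * B := by
    rw [mul_add, mul_comm e (m - 1), ← h1, he]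
    ring
  exact Nat.eq_of_mul_eq_mul_left (Nat.pos_of_ne_zero he0) h2

end

/-! ### Comparison of convergent and formal intersection multiplicities -/

noncomputable section

open PowerSeries

/-- An element of the maximal ideal of `ℂ⟦x⟧⟦y⟧` is nilpotent modulo every ideal of finite
codimension. -/
theorem exists_pow_mem_of_finite {J : Ideal ℂ⟦X⟧⟦X⟧} (hJ : Module.Finite ℂ (ℂ⟦X⟧⟦X⟧ ⧸ J))
    {z : ℂ⟦X⟧⟦X⟧} (hz : constantCoeff (constantCoeff z) = 0) : ∃ n, z ^ n ∈ J := by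
  obtain ⟨P, hP, hPz⟩ := Algebra.IsIntegral.isIntegral (R := ℂ) (Ideal.Quotient.mk J z)
  obtain ⟨Q, hQ, hdvd⟩ := Polynomial.exists_eq_pow_rootMultiplicity_mul_and_not_dvd P hP.ne_zero 0
  set n := P.rootMultiplicity 0
  refine ⟨n, ?_⟩
  let ε : ℂ⟦X⟧⟦X⟧ →+* ℂ := constantCoeff.comp constantCoeff
  have hε : ε.comp (algebraMap ℂ ℂ⟦X⟧⟦X⟧) = RingHom.id ℂ := by
    ext c
    simp [ε, PowerSeries.algebraMap_apply]
  have hu : IsUnit (Polynomial.eval₂ (algebraMap ℂ ℂ⟦X⟧⟦X⟧) z Q) := by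
    rw [isUnit_iff_constantCoeff, isUnit_iff_constantCoeff, isUnit_iff_ne_zero]
    change ε _ ≠ 0
    rw [Polynomial.hom_eval₂, hε]
    change Polynomial.eval₂ (RingHom.id ℂ) (constantCoeff (constantCoeff z)) Q ≠ 0
    rw [hz]
    intro h
    exact hdvd (Polynomial.dvd_iff_isRoot.2 h)
  have h1 : Polynomial.eval₂ (algebraMap ℂ ℂ⟦X⟧⟦X⟧) z P ∈ J := by
    rw [← Ideal.Quotient.eq_zero_iff_mem, Polynomial.hom_eval₂]
    exact hPz
  rw [hQ, Polynomial.eval₂_mul, map_zero, sub_zero, Polynomial.eval₂_pow, Polynomial.eval₂_X,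
    mul_comm] at h1
  obtain ⟨w, hw⟩ := hu.exists_left_inv
  have h2 := J.mul_mem_left w h1
  rwa [← mul_assoc, hw, one_mul] at h2

namespace analyticGerms

/-- Taylor expansion, as a homomorphism of algebras. -/
def taylorAlgHom : analyticGerms →ₐ[ℂ] ℂ⟦X⟧⟦X⟧ :=
  { taylor with
    commutes' := fun c => by
      change taylor _ = _
      rw [Algebra.algebraMap_eq_smul_one, taylor_smul, map_one, Algebra.algebraMap_eq_smul_one] }

/-- Modulo `(xᴾ, yᴾ)`, every double power series is the expansion of an analytic germ. -/
theorem exists_sub_taylor_mem (P : ℕ) (s : ℂ⟦X⟧⟦X⟧) :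
    ∃ g : analyticGerms, s - taylor g ∈ Ideal.span {(C X : ℂ⟦X⟧⟦X⟧) ^ P, X ^ P} := by
  set K := Ideal.span {(C X : ℂ⟦X⟧⟦X⟧) ^ P, X ^ P} with hK
  let f : analyticGerms →+* ℂ⟦X⟧⟦X⟧ ⧸ K := (Ideal.Quotient.mk K).comp taylor
  have hx : (C X : ℂ⟦X⟧⟦X⟧) ^ P ∈ K := Ideal.subset_span (by simp)
  have hy : (X : ℂ⟦X⟧⟦X⟧) ^ P ∈ K := Ideal.subset_span (by simp)
  have h1 : ∀ p : Polynomial ℂ, Ideal.Quotient.mk K (C (p : ℂ⟦X⟧)) ∈ f.range := by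
    intro p
    induction p using Polynomial.induction_on' with
    | add p q hp hq => rw [Polynomial.coe_add, map_add, map_add]; exact add_mem hp hq
    | monomial n a =>
      refine ⟨a • of (fun p => p.1) analyticAt_fst ^ n, ?_⟩
      rw [RingHom.comp_apply, taylor_smul, map_pow, taylor_fst, Polynomial.coe_monomial,
        ← map_pow]
      congr 1
      have h : (monomial n a : ℂ⟦X⟧) = a • X ^ n := by
        rw [X_pow_eq, ← LinearMap.map_smul, smul_eq_mul, mul_one]
      rw [h, smul_eq_C_mul, map_mul]
      ext i j
      simp
  have h2 : ∀ a : ℂ⟦X⟧, Ideal.Quotient.mk K (C a) ∈ f.range := by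
    intro a
    rw [eq_X_pow_mul_shift_add_trunc P a, map_add, map_add]
    refine add_mem ?_ (h1 _)
    rw [map_mul, map_pow, Ideal.Quotient.eq_zero_iff_mem.2 (K.mul_mem_right _ hx)]
    exact zero_mem _
  have h3 : ∀ p : Polynomial ℂ⟦X⟧, Ideal.Quotient.mk K (p : ℂ⟦X⟧⟦X⟧) ∈ f.range := by
    intro p
    induction p using Polynomial.induction_on with
    | C a => rw [Polynomial.coe_C]; exact h2 a
    | add p q hp hq => rw [Polynomial.coe_add, map_add]; exact add_mem hp hq
    | monomial n a h =>
      rw [pow_succ, ← mul_assoc, Polynomial.coe_mul, map_mul, Polynomial.coe_X]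
      exact mul_mem h ⟨of (fun p => p.2) analyticAt_snd, by rw [RingHom.comp_apply, taylor_snd]⟩
  have h4 : Ideal.Quotient.mk K s ∈ f.range := by
    rw [eq_X_pow_mul_shift_add_trunc P s, map_add]
    refine add_mem ?_ (h3 _)
    rw [Ideal.Quotient.eq_zero_iff_mem.2 (K.mul_mem_right _ hy)]
    exact zero_mem _
  obtain ⟨g, hg⟩ := h4
  exact ⟨g, Ideal.Quotient.eq.1 hg.symm⟩

theorem mem_span_of_taylor_mem (P : ℕ) (g : analyticGerms)
    (h : taylor g ∈ Ideal.span {(C X : ℂ⟦X⟧⟦X⟧) ^ P, X ^ P}) :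
    g ∈ Ideal.span {of (fun p => p.1) analyticAt_fst ^ P, of (fun p => p.2) analyticAt_snd ^ P} := by
  obtain ⟨a, b, hab⟩ := Ideal.mem_span_pair.1 h
  obtain ⟨u, v, huv⟩ := exists_eq_mul_add_mul g P P (by
    intro i hi j hj
    rw [← hab, map_add, map_add, mul_comm a, ← map_pow, coeff_C_mul, coeff_X_pow_mul',
      if_neg (by omega), coeff_mul_X_pow', if_neg (by omega), map_zero, add_zero])
  rw [huv]
  exact add_mem (Ideal.mul_mem_right _ _ (Ideal.subset_span (by simp)))
    (Ideal.mul_mem_right _ _ (Ideal.subset_span (by simp)))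

theorem ker_eval_le_jacobson :
    RingHom.ker (eval : analyticGerms →+* ℂ) ≤ Ideal.jacobson ⊥ := by
  intro x hx
  rw [Ideal.mem_jacobson_bot]
  intro y
  apply isUnit_of_eval_ne_zero
  have hx' : eval x = 0 := hx
  rw [map_add, map_mul, hx', zero_mul, zero_add, map_one]
  exact one_ne_zero

/-- An ideal of finite codimension in `ℂ⟦x⟧⟦y⟧` that is generated by the expansions of two
analytic germs has the same codimension as the ideal of `ℂ{x, y}` generated by these germs. -/
theorem rank_quotient_span_eq (a b : analyticGerms) {n : ℕ}
    (h : Module.rank ℂ (ℂ⟦X⟧⟦X⟧ ⧸ Ideal.span {taylor a, taylor b}) = n) :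
    Module.rank ℂ (analyticGerms ⧸ Ideal.span {a, b}) = n := by
  set I := Ideal.span {a, b} with hI
  set J := Ideal.span {taylor a, taylor b} with hJ
  set x := of (fun p => p.1) analyticAt_fst with hx
  set y := of (fun p => p.2) analyticAt_snd with hy
  have hfin : Module.Finite ℂ (ℂ⟦X⟧⟦X⟧ ⧸ J) := by
    rw [← Module.rank_lt_aleph0_iff, h]
    exact Cardinal.natCast_lt_aleph0
  have hIJ : ∀ g ∈ I, taylor g ∈ J := by
    intro g hg
    obtain ⟨u, v, rfl⟩ := Ideal.mem_span_pair.1 hg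
    rw [map_add, map_mul, map_mul]
    exact Ideal.mem_span_pair.2 ⟨_, _, rfl⟩
  obtain ⟨p, hp⟩ := exists_pow_mem_of_finite hfin (z := C X) (by simp)
  obtain ⟨q, hq⟩ := exists_pow_mem_of_finite hfin (z := X) (by simp)
  set P := max p q with hP
  have hpx : (C X : ℂ⟦X⟧⟦X⟧) ^ P ∈ J := Ideal.pow_mem_of_pow_mem _ hp (le_max_left _ _)
  have hpy : (X : ℂ⟦X⟧⟦X⟧) ^ P ∈ J := Ideal.pow_mem_of_pow_mem _ hq (le_max_right _ _)
  -- Truncating the coefficients, membership in `J` gives membership in `I + (xᴺ, yᴺ)`.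
  have happrox : ∀ N g, taylor g ∈ J → g ∈ I ⊔ Ideal.span {x ^ N, y ^ N} := by
    intro N g hg
    obtain ⟨u, v, huv⟩ := Ideal.mem_span_pair.1 hg
    obtain ⟨u', hu⟩ := exists_sub_taylor_mem N u
    obtain ⟨v', hv⟩ := exists_sub_taylor_mem N v
    have h1 : g - (u' * a + v' * b) ∈ Ideal.span {x ^ N, y ^ N} := by
      apply mem_span_of_taylor_mem
      rw [map_sub, map_add, map_mul, map_mul, ← huv]
      have h2 := add_mem (Ideal.mul_mem_right (taylor a) _ hu) (Ideal.mul_mem_right (taylor b) _ hv)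
      convert h2 using 1
      ring
    have h3 : g = (u' * a + v' * b) + (g - (u' * a + v' * b)) := by ring
    rw [h3]
    exact Submodule.add_mem_sup (Ideal.mem_span_pair.2 ⟨_, _, rfl⟩) h1
  -- By Nakayama's lemma, `I` contains `(xᴾ, yᴾ)`, since it does modulo `(xᴾ⁺¹, yᴾ⁺¹)`.
  have hxy : Ideal.span {x ^ P, y ^ P} ≤ I := by
    apply Submodule.le_of_le_smul_of_le_jacobson_bot (Submodule.fg_span (by simp))
      ker_eval_le_jacobson
    have hxm : x ∈ RingHom.ker (eval : analyticGerms →+* ℂ) := rfl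
    have hym : y ∈ RingHom.ker (eval : analyticGerms →+* ℂ) := rfl
    have hle : I ⊔ Ideal.span {x ^ (P + 1), y ^ (P + 1)} ≤
        I ⊔ RingHom.ker (eval : analyticGerms →+* ℂ) • Ideal.span {x ^ P, y ^ P} := by
      refine sup_le_sup_left (Ideal.span_le.2 ?_) _
      rintro z (rfl | rfl)
      · rw [pow_succ']
        exact Submodule.smul_mem_smul hxm (Ideal.subset_span (by simp))
      · rw [pow_succ']
        exact Submodule.smul_mem_smul hym (Ideal.subset_span (by simp))
    refine Ideal.span_le.2 ?_
    rintro z (rfl | rfl)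
    · exact hle (happrox _ _ (by rw [map_pow, taylor_fst]; exact hpx))
    · exact hle (happrox _ _ (by rw [map_pow, taylor_snd]; exact hpy))
  have hker : ∀ g, g ∈ I ↔ taylor g ∈ J :=
    fun g => ⟨hIJ g, fun hg => (sup_le le_rfl hxy) (happrox P g hg)⟩
  rw [← h]
  refine rank_quotient_eq_of_surjective I
    ((Ideal.Quotient.mkₐ ℂ J).comp taylorAlgHom).toLinearMap ?_ ?_
  · intro s
    obtain ⟨s, rfl⟩ := Ideal.Quotient.mk_surjective s
    obtain ⟨g, hg⟩ := exists_sub_taylor_mem P s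
    refine ⟨g, (Ideal.Quotient.eq.2 ?_).symm⟩
    refine Ideal.span_le.2 ?_ hg
    rintro z (rfl | rfl)
    exacts [hpx, hpy]
  · intro g
    rw [hker]
    exact Ideal.Quotient.eq_zero_iff_mem

end analyticGerms

end

/-! ### Linear changes of coordinates, multiplicity and Milnor number of a branch -/

noncomputable section

open PowerSeries

namespace analyticGerms

/-- The automorphism of `ℂ{x, y}` given by a linear change of coordinates. -/
def pullback (L : (ℂ × ℂ) ≃L[ℂ] (ℂ × ℂ)) : analyticGerms →+* analyticGerms where
  toFun g := ⟨(g : Germ (𝓝 (0 : ℂ × ℂ)) ℂ).compTendsto L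
    (L.continuous.continuousAt.tendsto_of_map_zero (map_zero L)), by
      obtain ⟨f, hf, rfl⟩ := exists_of g
      exact ⟨fun p => f (L p), hf.comp_of_map_zero (L.analyticAt 0) (map_zero L), rfl⟩⟩
  map_one' := rfl
  map_zero' := rfl
  map_add' a b := by
    obtain ⟨f, hf, rfl⟩ := exists_of a
    obtain ⟨g, hg, rfl⟩ := exists_of b
    rfl
  map_mul' a b := by
    obtain ⟨f, hf, rfl⟩ := exists_of a
    obtain ⟨g, hg, rfl⟩ := exists_of b
    rfl

theorem analyticAt_comp_linear {f : ℂ × ℂ → ℂ} (hf : AnalyticAt ℂ f 0)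
    (L : (ℂ × ℂ) ≃L[ℂ] (ℂ × ℂ)) : AnalyticAt ℂ (fun p => f (L p)) 0 :=
  hf.comp_of_map_zero (L.analyticAt 0) (map_zero L)

theorem pullback_of (L : (ℂ × ℂ) ≃L[ℂ] (ℂ × ℂ)) {f : ℂ × ℂ → ℂ} (hf : AnalyticAt ℂ f 0) :
    pullback L (of f hf) = of _ (analyticAt_comp_linear hf L) := rfl

theorem pullback_pullback_symm (L : (ℂ × ℂ) ≃L[ℂ] (ℂ × ℂ)) (g : analyticGerms) :
    pullback L (pullback L.symm g) = g := by
  obtain ⟨f, hf, rfl⟩ := exists_of g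
  rw [pullback_of, pullback_of, of_eq_of]
  exact Eventually.of_forall fun p => by simp

/-- The pullback by a linear automorphism, as an isomorphism of algebras. -/
def pullbackEquiv (L : (ℂ × ℂ) ≃L[ℂ] (ℂ × ℂ)) : analyticGerms ≃ₐ[ℂ] analyticGerms :=
  AlgEquiv.ofRingEquiv (f := RingEquiv.ofRingHom (pullback L) (pullback L.symm)
    (by ext1 g; exact pullback_pullback_symm L g)
    (by ext1 g; exact pullback_pullback_symm L.symm g)) fun _ => rfl

theorem deriv_pullback (L : (ℂ × ℂ) ≃L[ℂ] (ℂ × ℂ)) (v : ℂ × ℂ) (g : analyticGerms) :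
    deriv v (pullback L g) = pullback L (deriv (L v) g) := by
  obtain ⟨f, hf, rfl⟩ := exists_of g
  rw [pullback_of, deriv_of, deriv_of, pullback_of, of_eq_of]
  have h := (L.continuous.continuousAt.tendsto_of_map_zero (map_zero L)).eventually
    (eventually_differentiableAt hf)
  filter_upwards [h] with p hp
  rw [partialDeriv, partialDeriv]
  have h1 : HasFDerivAt (fun p => f (L p)) ((fderiv ℂ f (L p)).comp (L : ℂ × ℂ →L[ℂ] ℂ × ℂ)) p :=
    hp.hasFDerivAt.comp p L.hasFDerivAt
  rw [h1.fderiv]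
  rfl

/-- A derivative of order `n` at the origin vanishes if and only if all the Taylor
coefficients of total degree `n` do. -/
theorem iteratedFDeriv_eq_zero_iff {f : ℂ × ℂ → ℂ} (hf : AnalyticAt ℂ f 0) (n : ℕ) :
    iteratedFDeriv ℂ n f 0 = 0 ↔ ∀ i j, i + j = n → coeff i (coeff j (taylor (of f hf))) = 0 := by
  have hfac : ∀ i j : ℕ, ((i.factorial : ℂ)⁻¹ * (j.factorial : ℂ)⁻¹) ≠ 0 := fun i j =>
    mul_ne_zero (inv_ne_zero (by exact_mod_cast i.factorial_ne_zero))
      (inv_ne_zero (by exact_mod_cast j.factorial_ne_zero))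
  simp only [coeff_taylor, mul_eq_zero, hfac, false_or]
  constructor
  · rintro h i j rfl
    rw [← iteratedFDeriv_mixed, h]
    rfl
  · induction n generalizing f with
    | zero =>
      intro h
      ext v
      have := h 0 0 rfl
      simpa [eval_of] using this
    | succ n ih =>
      intro h
      ext v
      rw [iteratedFDeriv_succ_apply hf]
      rw [ih (analyticAt_partialDeriv _ hf)]
      · rfl
      intro i j hij
      have hcomm : (deriv (0, 1))^[j] (deriv (1, 0) (of f hf)) =
          deriv (1, 0) ((deriv (0, 1))^[j] (of f hf)) :=
        (Function.Commute.iterate_left (f := deriv (0, 1)) (g := deriv (1, 0))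
          (fun g => deriv_comm _ _ g) j) _
      rw [← deriv_of _ hf, deriv_eq, iterate_map_add, iterate_map_add, iterate_deriv_smul,
        iterate_deriv_smul, iterate_deriv_smul, iterate_deriv_smul, hcomm,
        ← Function.iterate_succ_apply, ← Function.iterate_succ_apply, map_add, map_smul, map_smul,
        h _ _ (by omega), h _ _ (by omega), smul_zero, smul_zero, add_zero]

end analyticGerms

namespace PlaneBranch

open analyticGerms

/-- The branch `L⁻¹ (B, 0)`: the equation of `(B, 0)` in the linear coordinates `L`. -/
def comp (B : PlaneBranch) (L : (ℂ × ℂ) ≃L[ℂ] (ℂ × ℂ)) : PlaneBranch where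
  eqn p := B.eqn (L p)
  analytic := analyticAt_comp_linear B.analytic L
  irreducible := (MulEquiv.irreducible_iff (pullbackEquiv L)).2 B.irreducible

/-- The Jacobian ideal is generated by all the directional derivatives. -/
theorem jacobianIdeal_eq (B : PlaneBranch) :
    B.jacobianIdeal = Ideal.span (Set.range fun v => deriv v (of B.eqn B.analytic)) := by
  have hx := deriv_of (1, 0) B.analytic
  have hy := deriv_of (0, 1) B.analytic
  rw [jacobianIdeal, ← hx, ← hy]
  apply le_antisymm
  · rw [Ideal.span_le]
    rintro z (rfl | rfl)
    exacts [Ideal.subset_span ⟨(1, 0), rfl⟩, Ideal.subset_span ⟨(0, 1), rfl⟩]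
  · rw [Ideal.span_le]
    rintro z ⟨v, rfl⟩
    change deriv v (of B.eqn B.analytic) ∈ _
    rw [deriv_eq v, Algebra.smul_def, Algebra.smul_def]
    exact Ideal.mem_span_pair.2 ⟨_, _, rfl⟩

theorem milnor_comp (B : PlaneBranch) (L : (ℂ × ℂ) ≃L[ℂ] (ℂ × ℂ)) :
    (B.comp L).milnor = B.milnor := by
  have h : (B.comp L).jacobianIdeal =
      B.jacobianIdeal.map (pullbackEquiv L : analyticGerms →+* analyticGerms) := by
    rw [jacobianIdeal_eq, jacobianIdeal_eq, Ideal.map_span]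
    congr 1
    ext g
    constructor
    · rintro ⟨v, rfl⟩
      exact ⟨_, ⟨L v, rfl⟩, (deriv_pullback L v _).symm⟩
    · rintro ⟨_, ⟨v, rfl⟩, rfl⟩
      refine ⟨L.symm v, (deriv_pullback L (L.symm v) (of B.eqn B.analytic)).trans ?_⟩
      rw [L.apply_symm_apply]
      rfl
  rw [milnor, milnor,
    (Ideal.quotientEquivAlg _ _ (pullbackEquiv L) h).toLinearEquiv.rank_eq]

theorem hasMultiplicity_comp (B : PlaneBranch) (L : (ℂ × ℂ) ≃L[ℂ] (ℂ × ℂ)) (m : ℕ) :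
    (B.comp L).HasMultiplicity m ↔ B.HasMultiplicity m := by
  have key : ∀ n (f : ℂ × ℂ → ℂ) (L : (ℂ × ℂ) ≃L[ℂ] (ℂ × ℂ)), iteratedFDeriv ℂ n f 0 = 0 →
      iteratedFDeriv ℂ n (fun p => f (L p)) 0 = 0 := by
    intro n f L h
    change iteratedFDeriv ℂ n (f ∘ L) 0 = 0
    have h1 := L.iteratedFDerivWithin_comp_right (f := f) uniqueDiffOn_univ (x := 0)
      (Set.mem_univ _) n
    rw [Set.preimage_univ, iteratedFDerivWithin_univ, iteratedFDerivWithin_univ, map_zero, h] at h1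
    rw [h1]
    rfl
  have key' : ∀ n, iteratedFDeriv ℂ n (B.comp L).eqn 0 = 0 ↔ iteratedFDeriv ℂ n B.eqn 0 = 0 := by
    intro n
    refine ⟨fun h => ?_, key n _ L⟩
    have h1 := key n _ L.symm h
    have h2 : (fun p => (B.comp L).eqn (L.symm p)) = B.eqn := by
      ext p
      simp [comp]
    rwa [h2] at h1
  simp only [HasMultiplicity, ne_eq, key']

theorem IsPuiseuxParametrization.map_zero {B : PlaneBranch} {L : (ℂ × ℂ) ≃L[ℂ] (ℂ × ℂ)} {m : ℕ}
    {φ : ℂ → ℂ} (h : B.IsPuiseuxParametrization L m φ) : φ 0 = 0 := by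
  by_contra h0
  have := h.lt_of_mem 0 (by simpa [powerSupport] using h0)
  omega

theorem IsPuiseuxParametrization.hasDistinctConjugates {B : PlaneBranch}
    {L : (ℂ × ℂ) ≃L[ℂ] (ℂ × ℂ)} {m : ℕ} {φ : ℂ → ℂ} (h : B.IsPuiseuxParametrization L m φ) :
    HasDistinctConjugates m φ := by
  intro ζ hζ hne he
  obtain ⟨U, hU, hinj⟩ := h.parametrizes.injective
  have hζ0 : Tendsto (fun u : ℂ => ζ * u) (𝓝 0) (𝓝 0) := tendsto_const_mul_zero ζ
  have h1 : ∀ᶠ u in 𝓝[≠] (0 : ℂ), u ∈ U ∧ ζ * u ∈ U ∧ φ (ζ * u) = φ u :=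
    ((Filter.eventually_mem_set.2 hU).and ((hζ0.eventually hU).and he)).filter_mono
      nhdsWithin_le_nhds
  obtain ⟨u, ⟨hu, hu', hφ⟩, hu0⟩ := (h1.and self_mem_nhdsWithin).exists
  have h2 := hinj hu' hu (by simp only [mul_pow, hζ, one_mul, hφ])
  have h3 : (ζ - 1) * u = 0 := by rw [sub_mul, h2, one_mul, sub_self]
  rcases mul_eq_zero.1 h3 with h3 | h3
  · exact hne (sub_eq_zero.1 h3)
  · exact hu0 h3

theorem coeff_taylorSeries_eq_zero_iff (φ : ℂ → ℂ) (n : ℕ) :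
    coeff n (taylorSeries φ) = 0 ↔ n ∉ powerSupport φ := by
  rw [taylorSeries, coeff_mk, powerSupport, Set.mem_ofPred_eq, not_not, mul_eq_zero,
    _root_.inv_eq_zero]
  exact or_iff_right (by exact_mod_cast n.factorial_ne_zero)

theorem taylorSeries_injective {φ ψ : ℂ → ℂ} (hφ : AnalyticAt ℂ φ 0) (hψ : AnalyticAt ℂ ψ 0)
    (h : taylorSeries φ = taylorSeries ψ) : φ =ᶠ[𝓝 0] ψ := by
  have h1 : of _ (analyticAt_comp_fst hφ) = of _ (analyticAt_comp_fst hψ) := by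
    apply taylor_injective
    rw [coeff_taylor_comp_fst hφ, coeff_taylor_comp_fst hψ, h]
  rw [of_eq_of] at h1
  have h2 : Tendsto (fun x : ℂ => ((x, 0) : ℂ × ℂ)) (𝓝 0) (𝓝 0) := by
    have : Continuous (fun x : ℂ => ((x, 0) : ℂ × ℂ)) := by fun_prop
    exact this.continuousAt.tendsto_of_map_zero rfl
  exact h2.eventually h1

/-- In the coordinates of a Puiseux parametrization, the equation of the branch is the product of
the conjugates of `y - φ (x ^ (1 / m))`, up to a unit. -/
theorem IsPuiseuxParametrization.exists_eq_unit_mul {B : PlaneBranch}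
    {L : (ℂ × ℂ) ≃L[ℂ] (ℂ × ℂ)} {m : ℕ} {φ : ℂ → ℂ} (h : B.IsPuiseuxParametrization L m φ) :
    ∃ (F : ℂ × ℂ → ℂ) (hF : IsBranchEquation m φ F) (V : analyticGerms), IsUnit V ∧
      of (B.comp L).eqn (B.comp L).analytic = V * of F hF.analytic := by
  have hm := h.pos.ne'
  obtain ⟨F, hF⟩ := exists_isBranchEquation hm h.analytic
  refine ⟨F, hF, ?_⟩
  have hirr := hF.irreducible hm h.analytic h.map_zero h.hasDistinctConjugates
  obtain ⟨V, hV⟩ := hF.dvd hm h.analytic h.map_zero h.hasDistinctConjugates (B.comp L).analytic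
    h.parametrizes.vanishes
  refine ⟨V, ?_, by rw [hV, mul_comm]⟩
  exact ((B.comp L).irreducible.isUnit_or_isUnit hV).resolve_left hirr.not_isUnit

/-- The order in `u` of `φ (ζ u) - φ u`. -/
def contactOrder (φ : ℂ → ℂ) (ζ : ℂ) : ℕ :=
  (rescale ζ (taylorSeries φ) - taylorSeries φ).order.toNat

/-- The Milnor number of a branch in terms of the contact orders of a Puiseux parametrization with
its conjugates. -/
theorem IsPuiseuxParametrization.exists_milnor_eq {B : PlaneBranch}
    {L : (ℂ × ℂ) ≃L[ℂ] (ℂ × ℂ)} {m : ℕ} {φ : ℂ → ℂ} (h : B.IsPuiseuxParametrization L m φ) :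
    ∃ μ : ℕ, B.milnor = μ ∧
      μ + (m - 1) = ∑ ζ ∈ (Polynomial.nthRootsFinset m (1 : ℂ)).erase 1, contactOrder φ ζ := by
  have hm := h.pos.ne'
  obtain ⟨F, hF, V, hV, hFV⟩ := h.exists_eq_unit_mul
  obtain ⟨μ, h1, h2⟩ := exists_rank_quotient_eq hm (φ := taylorSeries φ)
    (by
      rw [← coeff_zero_eq_constantCoeff_apply, coeff_taylorSeries_eq_zero_iff]
      intro h0
      have := h.lt_of_mem 0 h0
      omega)
    (by
      intro ζ hζ hne he
      rw [← taylorSeries_comp_const_mul h.analytic] at he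
      exact h.hasDistinctConjugates ζ hζ hne
        (taylorSeries_injective (h.analytic.comp_const_mul ζ) h.analytic he))
    (hV.map taylor) (hF.expandX_taylor hm h.analytic)
  refine ⟨μ, ?_, h2⟩
  rw [← map_mul, ← hFV, ← taylor_deriv_fst, ← taylor_deriv_snd, deriv_of, deriv_of] at h1
  rw [← milnor_comp B L, milnor]
  have h3 := rank_quotient_span_eq _ _ h1
  rw [jacobianIdeal, h3]
  simp

/-- The integer `m` of a Puiseux parametrization is the multiplicity of the branch, because the
exponents of `φ` are larger than `m`. -/
theorem IsPuiseuxParametrization.hasMultiplicity {B : PlaneBranch}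
    {L : (ℂ × ℂ) ≃L[ℂ] (ℂ × ℂ)} {m : ℕ} {φ : ℂ → ℂ} (h : B.IsPuiseuxParametrization L m φ) :
    B.HasMultiplicity m := by
  have hm := h.pos.ne'
  obtain ⟨F, hF, V, hV, hFV⟩ := h.exists_eq_unit_mul
  set R := Polynomial.nthRootsFinset m (1 : ℂ) with hR
  have hcard : R.card = m := (Complex.isPrimitiveRoot_exp m hm).card_nthRootsFinset
  have hexp := hF.expandX_taylor hm h.analytic
  have hφ : (X ^ (m + 1) : ℂ⟦X⟧) ∣ taylorSeries φ := by
    rw [X_pow_dvd_iff]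
    intro n hn
    rw [coeff_taylorSeries_eq_zero_iff]
    intro hmem
    have := h.lt_of_mem n hmem
    omega
  have hφζ : ∀ ζ, (X ^ (m + 1) : ℂ⟦X⟧) ∣ rescale ζ (taylorSeries φ) := by
    intro ζ
    rw [X_pow_dvd_iff] at hφ ⊢
    intro n hn
    rw [coeff_rescale, hφ n hn, mul_zero]
  set G := taylor (of (B.comp L).eqn (B.comp L).analytic) with hG
  have hGF : G = taylor V * taylor (of F hF.analytic) := by rw [hG, hFV, map_mul]
  -- Substituting `y = t ^ m z` after `x = t ^ m` turns the total degree into the degree in `t`.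
  have hdvd : (C ((X : ℂ⟦X⟧) ^ (m * m)) : ℂ⟦X⟧⟦X⟧) ∣
      rescale ((X : ℂ⟦X⟧) ^ m) (expandX m hm G) := by
    rw [hGF, map_mul, map_mul, hexp, map_prod]
    refine Dvd.dvd.mul_left ?_ _
    have h1 : (C ((X : ℂ⟦X⟧) ^ (m * m)) : ℂ⟦X⟧⟦X⟧) = ∏ ζ ∈ R, C ((X : ℂ⟦X⟧) ^ m) := by
      rw [Finset.prod_const, hcard, ← map_pow, pow_mul]
    rw [h1]
    refine Finset.prod_dvd_prod_of_dvd _ _ fun ζ _ => ?_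
    obtain ⟨c, hc⟩ := hφζ ζ
    refine ⟨X - C (X * c), ?_⟩
    rw [map_sub, rescale_X, hc]
    have h2 : rescale ((X : ℂ⟦X⟧) ^ m) (C (X ^ (m + 1) * c)) = C (X ^ (m + 1) * c) := by
      ext1 j
      rw [coeff_rescale, coeff_C]
      split_ifs with hj
      · rw [hj, pow_zero, one_mul]
      · rw [mul_zero]
    rw [h2, mul_sub, ← map_mul, ← mul_assoc, pow_succ]
  rw [← hasMultiplicity_comp B L]
  constructor
  · intro n hn
    rw [iteratedFDeriv_eq_zero_iff (B.comp L).analytic]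
    intro i j hij
    obtain ⟨q, hq⟩ := hdvd
    have h1 := congrArg (fun s => coeff (m * n) (coeff j s)) hq
    simp only [coeff_rescale, coeff_expandX, coeff_C_mul] at h1
    rw [← pow_mul, coeff_X_pow_mul', coeff_X_pow_mul', if_pos (by rw [← hij]; nlinarith),
      if_neg (by rw [not_le]; exact Nat.mul_lt_mul_of_pos_left hn h.pos)] at h1
    have h2 : m * n - m * j = m * i := by rw [← hij, mul_add, Nat.add_sub_cancel]
    rw [h2, coeff_expand_mul] at h1
    exact h1
  · intro h0
    rw [iteratedFDeriv_eq_zero_iff (B.comp L).analytic] at h0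
    have h1 := h0 0 m (zero_add m)
    have h2 : reduceX G = X ^ m * reduceX (taylor V) := by
      have h3 : reduceX (taylor (of F hF.analytic)) = X ^ m := by
        have h5 : (X ^ m : ℂ⟦X⟧) = ∏ ζ ∈ R, X := by rw [Finset.prod_const, hcard]
        rw [← reduceX_expandX m hm, hexp, map_prod, h5]
        refine Finset.prod_congr rfl fun ζ _ => ?_
        obtain ⟨c, hc⟩ := hφζ ζ
        rw [map_sub, hc, map_X, map_C, map_mul, map_pow]
        simp
      rw [hGF, map_mul, h3, mul_comm]
    have h4 := congrArg (coeff m) h2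
    rw [coeff_map, coeff_X_pow_mul', if_pos le_rfl, Nat.sub_self,
      coeff_zero_eq_constantCoeff_apply, ← coeff_zero_eq_constantCoeff_apply, h1] at h4
    exact (isUnit_constantCoeff _ ((hV.map taylor).map reduceX) : IsUnit _).ne_zero h4.symm

theorem HasMultiplicity.unique {B : PlaneBranch} {m n : ℕ} (hm : B.HasMultiplicity m)
    (hn : B.HasMultiplicity n) : m = n := by
  rcases lt_trichotomy m n with h | h | h
  · exact absurd (hn.1 m h) hm.2
  · exact h
  · exact absurd (hm.1 n h) hn.2

end PlaneBranch

end

/-! ### The Milnor number in terms of the characteristic exponents -/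

noncomputable section

open PowerSeries

section gcdBelow

variable {m : ℕ} {φ : ℂ → ℂ}

theorem dvd_gcdBelow_iff {a n : ℕ} :
    a ∣ gcdBelow m φ n ↔ a ∣ m ∧ ∀ i < n, i ∈ powerSupport φ → a ∣ i := by
  classical
  rw [gcdBelow, Nat.dvd_gcd_iff, Finset.dvd_gcd_iff]
  simp only [Finset.mem_filter, Finset.mem_range, id, and_imp]

theorem gcdBelow_dvd (m : ℕ) (φ : ℂ → ℂ) (n : ℕ) : gcdBelow m φ n ∣ m :=
  (dvd_gcdBelow_iff.1 dvd_rfl).1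

theorem gcdBelow_dvd_of_mem {i n : ℕ} (hi : i < n) (h : i ∈ powerSupport φ) :
    gcdBelow m φ n ∣ i :=
  (dvd_gcdBelow_iff.1 dvd_rfl).2 i hi h

theorem gcdBelow_dvd_gcdBelow {n n' : ℕ} (h : n ≤ n') : gcdBelow m φ n' ∣ gcdBelow m φ n :=
  dvd_gcdBelow_iff.2 ⟨gcdBelow_dvd _ _ _, fun _ hi => gcdBelow_dvd_of_mem (hi.trans_le h)⟩

theorem gcdBelow_pos (hm : m ≠ 0) (n : ℕ) : 0 < gcdBelow m φ n :=
  Nat.pos_of_dvd_of_pos (gcdBelow_dvd _ _ _) (Nat.pos_of_ne_zero hm)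

theorem gcdBelow_zero (m : ℕ) (φ : ℂ → ℂ) : gcdBelow m φ 0 = m :=
  Nat.dvd_antisymm (gcdBelow_dvd _ _ _) (dvd_gcdBelow_iff.2 ⟨dvd_rfl, by simp⟩)

theorem gcdBelow_succ_of_notMem {n : ℕ} (h : n ∉ powerSupport φ) :
    gcdBelow m φ (n + 1) = gcdBelow m φ n := by
  refine Nat.dvd_antisymm (gcdBelow_dvd_gcdBelow n.le_succ)
    (dvd_gcdBelow_iff.2 ⟨gcdBelow_dvd _ _ _, fun i hi hmem => ?_⟩)
  rcases Nat.lt_succ_iff_lt_or_eq.1 hi with h1 | rfl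
  · exact gcdBelow_dvd_of_mem h1 hmem
  · exact absurd hmem h

theorem mem_powerSupport_of_gcdBelow_lt {n : ℕ} (h : gcdBelow m φ (n + 1) < gcdBelow m φ n) :
    n ∈ powerSupport φ := by
  by_contra h1
  exact h.ne (gcdBelow_succ_of_notMem h1)

/-- The exponents at which the greatest common divisor drops. -/
def gcdDrops (m : ℕ) (φ : ℂ → ℂ) : Set ℕ := {n | gcdBelow m φ (n + 1) < gcdBelow m φ n}

theorem puiseuxExponents_eq (m : ℕ) (φ : ℂ → ℂ) :
    puiseuxExponents m φ = insert m (gcdDrops m φ) := by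
  rw [puiseuxExponents]
  congr 1
  ext n
  exact ⟨fun h => h.2, fun h => ⟨mem_powerSupport_of_gcdBelow_lt h, h⟩⟩

end gcdBelow

section contactOrder

variable {m : ℕ} {φ : ℂ → ℂ}

theorem coeff_rescale_sub_eq_zero_iff (φ : ℂ → ℂ) (ζ : ℂ) (i : ℕ) :
    coeff i (rescale ζ (taylorSeries φ) - taylorSeries φ) = 0 ↔
      (i ∈ powerSupport φ → ζ ^ i = 1) := by
  rw [map_sub, coeff_rescale, ← sub_one_mul, mul_eq_zero, sub_eq_zero,
    PlaneBranch.coeff_taylorSeries_eq_zero_iff]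
  tauto

/-- The conjugates of contact at least `n` are the powers of a primitive root of unity of order
`gcdBelow m φ n`. -/
theorem le_contactOrder_iff (hφ : AnalyticAt ℂ φ 0) (hd : HasDistinctConjugates m φ) {ζ : ℂ}
    (hζ : ζ ^ m = 1) (h1 : ζ ≠ 1) (n : ℕ) :
    n ≤ PlaneBranch.contactOrder φ ζ ↔ ζ ^ gcdBelow m φ n = 1 := by
  have hne : (rescale ζ (taylorSeries φ) - taylorSeries φ).order ≠ ⊤ := by
    rw [ne_eq, order_eq_top, sub_eq_zero, ← taylorSeries_comp_const_mul hφ]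
    exact fun h => hd ζ hζ h1
      (PlaneBranch.taylorSeries_injective (hφ.comp_const_mul ζ) hφ h)
  rw [PlaneBranch.contactOrder, ← Nat.cast_le (α := ℕ∞), ENat.natCast_toNat hne,
    ← orderOf_dvd_iff_pow_eq_one, dvd_gcdBelow_iff, orderOf_dvd_iff_pow_eq_one]
  simp only [orderOf_dvd_iff_pow_eq_one, ← coeff_rescale_sub_eq_zero_iff]
  exact ⟨fun h => ⟨hζ, fun i hi => coeff_of_lt_order i (lt_of_lt_of_le (by exact_mod_cast hi) h)⟩,
    fun h => nat_le_order _ _ h.2⟩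

/-- Counting, for every `n`, the roots of unity of contact order at least `n` turns the sum of the
contact orders into a sum over the greatest common divisors. The terms vanish for large `n`. -/
theorem exists_sum_contactOrder_eq (hm : m ≠ 0) (hφ : AnalyticAt ℂ φ 0)
    (hd : HasDistinctConjugates m φ) :
    ∃ N₀, ∀ N ≥ N₀, ∑ ζ ∈ (Polynomial.nthRootsFinset m (1 : ℂ)).erase 1,
      PlaneBranch.contactOrder φ ζ = ∑ n ∈ Finset.Icc 1 N, (gcdBelow m φ n - 1) := by
  classical
  set R := Polynomial.nthRootsFinset m (1 : ℂ) with hR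
  refine ⟨(R.erase 1).sup (PlaneBranch.contactOrder φ), fun N hN => ?_⟩
  have h1 : ∀ ζ ∈ R.erase 1, PlaneBranch.contactOrder φ ζ =
      ∑ n ∈ Finset.Icc 1 N, if n ≤ PlaneBranch.contactOrder φ ζ then 1 else 0 := by
    intro ζ hζ
    have h2 : PlaneBranch.contactOrder φ ζ ≤ N := (Finset.le_sup hζ).trans hN
    rw [← Finset.card_filter]
    have h3 : (Finset.Icc 1 N).filter (fun n => n ≤ PlaneBranch.contactOrder φ ζ) =
        Finset.Icc 1 (PlaneBranch.contactOrder φ ζ) := by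
      ext n
      simp only [Finset.mem_filter, Finset.mem_Icc]
      omega
    rw [h3, Nat.card_Icc, Nat.add_sub_cancel]
  rw [Finset.sum_congr rfl h1, Finset.sum_comm]
  refine Finset.sum_congr rfl fun n _ => ?_
  rw [← Finset.card_filter]
  have hG := gcdBelow_pos (φ := φ) hm n
  have h2 : (R.erase 1).filter (fun ζ => n ≤ PlaneBranch.contactOrder φ ζ) =
      (Polynomial.nthRootsFinset (gcdBelow m φ n) (1 : ℂ)).erase 1 := by
    ext ζ
    rw [Finset.mem_filter, Finset.mem_erase, Finset.mem_erase, hR, mem_rootsOfUnity_iff hm,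
      mem_rootsOfUnity_iff hG.ne']
    constructor
    · rintro ⟨⟨h1, hζ⟩, h⟩
      exact ⟨h1, (le_contactOrder_iff hφ hd hζ h1 n).1 h⟩
    · rintro ⟨h1, h⟩
      have hζ : ζ ^ m = 1 := by
        obtain ⟨c, hc⟩ := gcdBelow_dvd m φ n
        rw [hc, pow_mul, h, one_pow]
      exact ⟨⟨h1, hζ⟩, (le_contactOrder_iff hφ hd hζ h1 n).2 h⟩
  rw [h2, Finset.card_erase_of_mem ((mem_rootsOfUnity_iff hG.ne').2 (one_pow _)),
    (Complex.isPrimitiveRoot_exp _ hG.ne').card_nthRootsFinset]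

end contactOrder

/-- A divisor of `p₁ ⋯ pᵣ` with at least `s` prime factors is at least `p₁ ⋯ pₛ`. -/
theorem prod_le_of_dvd_of_le_cardFactors {p : ℕ → ℕ} {r : ℕ}
    (hp : ∀ i ∈ Finset.Icc 1 r, (p i).Prime)
    (hmono : ∀ i ∈ Finset.Icc 1 r, ∀ j ∈ Finset.Icc 1 r, i ≤ j → p i ≤ p j) {x s : ℕ}
    (hx : x ∣ ∏ i ∈ Finset.Icc 1 r, p i) (hs : s ≤ x.primeFactorsList.length) :
    s ≤ r ∧ ∏ i ∈ Finset.Icc 1 s, p i ≤ x := by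
  induction r generalizing x s with
  | zero =>
    rw [Finset.Icc_eq_empty (by omega), Finset.prod_empty, Nat.dvd_one] at hx
    subst hx
    rw [Nat.primeFactorsList_one, List.length_nil, Nat.le_zero] at hs
    subst hs
    simp
  | succ r ih =>
    have hsub : ∀ i ∈ Finset.Icc 1 r, i ∈ Finset.Icc 1 (r + 1) := fun i hi => by
      rw [Finset.mem_Icc] at hi ⊢
      omega
    have ih' := @ih (fun i hi => hp i (hsub i hi))
      (fun i hi j hj => hmono i (hsub i hi) j (hsub j hj))
    have hpr := hp (r + 1) (by simp)
    rw [Finset.prod_Icc_succ_top (by omega)] at hx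
    by_cases hdvd : p (r + 1) ∣ x
    · obtain ⟨y, rfl⟩ := hdvd
      have hpos : 0 < ∏ i ∈ Finset.Icc 1 r, p i :=
        Finset.prod_pos fun i hi => (hp i (hsub i hi)).pos
      rw [mul_comm] at hx
      have hy : y ∣ ∏ i ∈ Finset.Icc 1 r, p i := Nat.dvd_of_mul_dvd_mul_right hpr.pos hx
      have hy0 : y ≠ 0 := (Nat.pos_of_dvd_of_pos hy hpos).ne'
      rw [(Nat.perm_primeFactorsList_mul hpr.ne_zero hy0).length_eq,
        List.length_append, Nat.primeFactorsList_prime hpr, List.length_singleton] at hs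
      rcases s with _ | s
      · refine ⟨Nat.zero_le _, ?_⟩
        rw [Finset.Icc_eq_empty (by omega), Finset.prod_empty]
        exact Nat.mul_pos hpr.pos (Nat.pos_of_ne_zero hy0)
      · obtain ⟨h1, h2⟩ := ih' hy (s := s) (by omega)
        refine ⟨by omega, ?_⟩
        rw [Finset.prod_Icc_succ_top (by omega), mul_comm]
        exact Nat.mul_le_mul (hmono _ (by simp; omega) _ (by simp) (by omega)) h2
    · have hc : Nat.Coprime x (p (r + 1)) := ((Nat.Prime.coprime_iff_not_dvd hpr).2 hdvd).symm
      obtain ⟨h1, h2⟩ := ih' (hc.dvd_of_dvd_mul_right hx) hs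
      exact ⟨by omega, h2⟩

section nested

variable {m r k : ℕ} {p : ℕ → ℕ}

theorem nestedDivisor_of_pos {i : ℕ} (hi : i ≠ 0) :
    nestedDivisor m k p i = ∏ l ∈ Finset.Icc 1 (k - 1 - i), p l := by
  rw [nestedDivisor, if_neg hi]

theorem nestedDivisor_zero : nestedDivisor m k p 0 = m := by
  rw [nestedDivisor, if_pos rfl]

theorem normalExponent_zero : normalExponent m k p 0 = m := by
  simp [normalExponent]

theorem normalExponent_succ (i : ℕ) :
    normalExponent m k p (i + 1) = normalExponent m k p i + nestedDivisor m k p (i + 1) := by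
  rw [normalExponent, normalExponent, Finset.sum_Icc_succ_top (by omega), add_assoc]

theorem nestedDivisor_last (hk : 3 ≤ k) : nestedDivisor m k p (k - 1) = 1 := by
  rw [nestedDivisor_of_pos (by omega), Nat.sub_self, Finset.Icc_eq_empty (by omega),
    Finset.prod_empty]

theorem normalExponent_last (hk : 3 ≤ k) :
    normalExponent m k p (k - 1) = normalExponent m k p (k - 2) + 1 := by
  have h : k - 1 = k - 2 + 1 := by omega
  rw [h, normalExponent_succ, ← h, nestedDivisor_last hk]

theorem nestedDivisor_succ (hp : ∀ i ∈ Finset.Icc 1 r, (p i).Prime)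
    (hfac : m = ∏ i ∈ Finset.Icc 1 r, p i) (hk : 3 ≤ k) (hkr : k ≤ r + 1) {i : ℕ}
    (hi : i < k - 1) : nestedDivisor m k p (i + 1) ∣ nestedDivisor m k p i ∧
      nestedDivisor m k p (i + 1) < nestedDivisor m k p i := by
  have key : ∀ a b, a < b → b ≤ r → ∏ l ∈ Finset.Icc 1 a, p l ∣ ∏ l ∈ Finset.Icc 1 b, p l ∧
      ∏ l ∈ Finset.Icc 1 a, p l < ∏ l ∈ Finset.Icc 1 b, p l := by
    intro a b hab hb
    induction b, hab using Nat.le_induction with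
    | base =>
      have hpr := hp (a + 1) (by rw [Finset.mem_Icc]; omega)
      have hpos : 0 < ∏ l ∈ Finset.Icc 1 a, p l :=
        Finset.prod_pos fun i hi => (hp i (by rw [Finset.mem_Icc] at hi ⊢; omega)).pos
      rw [Finset.prod_Icc_succ_top (by omega)]
      exact ⟨dvd_mul_right _ _, lt_mul_of_one_lt_right hpos hpr.one_lt⟩
    | succ b hab ih =>
      have hpr := hp (b + 1) (by rw [Finset.mem_Icc]; omega)
      obtain ⟨h1, h2⟩ := ih (by omega)
      rw [Finset.prod_Icc_succ_top (by omega)]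
      exact ⟨h1.mul_right _, h2.trans_le (Nat.le_mul_of_pos_right _ hpr.pos)⟩
  rw [nestedDivisor_of_pos (Nat.succ_ne_zero i)]
  rcases Nat.eq_zero_or_pos i with rfl | h0
  · rw [nestedDivisor_zero, hfac]
    exact key _ _ (by omega) le_rfl
  · rw [nestedDivisor_of_pos h0.ne']
    exact key _ _ (by omega) (by omega)

theorem nestedDivisor_dvd (hp : ∀ i ∈ Finset.Icc 1 r, (p i).Prime)
    (hfac : m = ∏ i ∈ Finset.Icc 1 r, p i) (hk : 3 ≤ k) (hkr : k ≤ r + 1) {i j : ℕ}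
    (hij : i ≤ j) (hj : j ≤ k - 1) : nestedDivisor m k p j ∣ nestedDivisor m k p i := by
  induction j, hij using Nat.le_induction with
  | base => exact dvd_rfl
  | succ j hij ih =>
    exact (nestedDivisor_succ hp hfac hk hkr (by omega)).1.trans (ih (by omega))

theorem nestedDivisor_pos (hm : m ≠ 0) (hp : ∀ i ∈ Finset.Icc 1 r, (p i).Prime)
    (hfac : m = ∏ i ∈ Finset.Icc 1 r, p i) (hk : 3 ≤ k) (hkr : k ≤ r + 1) {i : ℕ}
    (hi : i ≤ k - 1) : 0 < nestedDivisor m k p i := by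
  have h := nestedDivisor_dvd hp hfac hk hkr (Nat.zero_le i) hi
  rw [nestedDivisor_zero] at h
  exact Nat.pos_of_dvd_of_pos h (Nat.pos_of_ne_zero hm)

theorem normalExponent_strictMonoOn (hm : m ≠ 0) (hp : ∀ i ∈ Finset.Icc 1 r, (p i).Prime)
    (hfac : m = ∏ i ∈ Finset.Icc 1 r, p i) (hk : 3 ≤ k) (hkr : k ≤ r + 1) {i j : ℕ}
    (hij : i < j) (hj : j ≤ k - 1) : normalExponent m k p i < normalExponent m k p j := by
  induction j, hij using Nat.le_induction with
  | base =>
    rw [normalExponent_succ]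
    exact Nat.lt_add_of_pos_right (nestedDivisor_pos hm hp hfac hk hkr hj)
  | succ j hij ih =>
    rw [normalExponent_succ]
    exact (ih (by omega)).trans (Nat.lt_add_of_pos_right (nestedDivisor_pos hm hp hfac hk hkr hj))

theorem dvd_normalExponent (hp : ∀ i ∈ Finset.Icc 1 r, (p i).Prime)
    (hfac : m = ∏ i ∈ Finset.Icc 1 r, p i) (hk : 3 ≤ k) (hkr : k ≤ r + 1) {i j : ℕ}
    (hij : i ≤ j) (hj : j ≤ k - 1) : nestedDivisor m k p j ∣ normalExponent m k p i := by
  induction i with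
  | zero =>
    rw [normalExponent_zero]
    simpa [nestedDivisor_zero] using nestedDivisor_dvd hp hfac hk hkr (Nat.zero_le j) hj
  | succ i ih =>
    rw [normalExponent_succ]
    exact dvd_add (ih (by omega)) (nestedDivisor_dvd hp hfac hk hkr hij hj)

/-- The lower bound behind the classification: when the greatest common divisor drops exactly
`k - 1` times, it is at least `dⱼ` after `j` drops, and consecutive drops are at least that far
apart. Hence it bounds from above every function `G` that, from `m + d₁ + ⋯ + dⱼ` on, is at most
`dⱼ`. -/
theorem le_gcdBelow_of_encard (hm : m ≠ 0) (hp : ∀ i ∈ Finset.Icc 1 r, (p i).Prime)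
    (hmono : ∀ i ∈ Finset.Icc 1 r, ∀ j ∈ Finset.Icc 1 r, i ≤ j → p i ≤ p j)
    (hfac : m = ∏ i ∈ Finset.Icc 1 r, p i) (hk : 3 ≤ k)
    {φ : ℂ → ℂ} (hlt : ∀ n ∈ powerSupport φ, m < n) (hE : (puiseuxExponents m φ).encard = k)
    {G : ℕ → ℕ} (hG : ∀ j ≤ k - 1, ∀ n, normalExponent m k p j < n → G n ≤ nestedDivisor m k p j)
    {n : ℕ} (hn : m < n) : G n ≤ gcdBelow m φ n := by
  classical
  set D := gcdDrops m φ with hD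
  have hDm : ∀ n ∈ D, m < n := fun n hn => hlt n (mem_powerSupport_of_gcdBelow_lt hn)
  have hDcard : D.encard = (k - 1 : ℕ) := by
    rw [puiseuxExponents_eq, Set.encard_insert_of_notMem fun h => (hDm m h).false] at hE
    have h1 : (k : ℕ∞) = (k - 1 : ℕ) + 1 := by
      rw [← Nat.cast_add_one, Nat.sub_add_cancel (by omega)]
    rw [h1] at hE
    exact (ENat.add_left_injective_of_ne_top ENat.one_ne_top) hE
  -- The number of drops before `n`.
  let c : ℕ → ℕ := fun n => ((Finset.range n).filter (fun i => i ∈ D)).card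
  have hc_succ : ∀ n, c (n + 1) = c n + if n ∈ D then 1 else 0 := by
    intro n
    simp only [c, Finset.range_add_one, Finset.filter_insert]
    split_ifs with h
    · rw [Finset.card_insert_of_notMem (by simp)]
    · rfl
  have hc_le : ∀ n, c n ≤ k - 1 := by
    intro n
    have h1 : (((Finset.range n).filter (fun i => i ∈ D) : Finset ℕ) : Set ℕ) ⊆ D := by
      intro i hi
      simp only [Finset.coe_filter, Set.mem_ofPred_eq] at hi
      exact hi.2
    have h2 := Set.encard_le_encard h1
    rw [Set.encard_coe_eq_coe_finsetCard, hDcard] at h2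
    exact_mod_cast h2
  have hfin : D.Finite := Set.finite_of_encard_eq_coe hDcard
  obtain ⟨N, hN⟩ : ∃ N, ∀ n ≥ N, c n = k - 1 := by
    refine ⟨hfin.toFinset.sup id + 1, fun n hn => ?_⟩
    have h1 : (Finset.range n).filter (fun i => i ∈ D) = hfin.toFinset := by
      ext i
      rw [Finset.mem_filter, Finset.mem_range, Set.Finite.mem_toFinset]
      refine ⟨fun h => h.2, fun h => ⟨?_, h⟩⟩
      have := Finset.le_sup (f := id) (hfin.mem_toFinset.2 h)
      simp only [id] at this
      omega
    have h2 : hfin.toFinset.card = k - 1 := by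
      rw [hfin.encard_eq_coe_toFinset_card] at hDcard
      exact_mod_cast hDcard
    simp only [c, h1, h2]
  -- Each drop costs at least one prime factor.
  have hΩ : ∀ n n', n ≤ n' → (gcdBelow m φ n').primeFactorsList.length + c n' ≤
      (gcdBelow m φ n).primeFactorsList.length + c n := by
    intro n n' h
    induction n', h using Nat.le_induction with
    | base => exact le_rfl
    | succ n' _ ih =>
      refine le_trans ?_ ih
      rw [hc_succ]
      have hsub := Nat.primeFactorsList_sublist_of_dvd
        (gcdBelow_dvd_gcdBelow (m := m) (φ := φ) (Nat.le_add_right n' 1)) (gcdBelow_pos hm n').ne'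
      split_ifs with hmem
      · have h1 : (gcdBelow m φ (n' + 1)).primeFactorsList.length <
            (gcdBelow m φ n').primeFactorsList.length := by
          refine lt_of_le_of_ne hsub.length_le fun he => ?_
          have h2 := congrArg List.prod (hsub.eq_of_length he)
          rw [Nat.prod_primeFactorsList (gcdBelow_pos hm _).ne',
            Nat.prod_primeFactorsList (gcdBelow_pos hm _).ne'] at h2
          exact absurd h2 (ne_of_lt hmem)
        omega
      · have := hsub.length_le
        omega
  -- The `k - 1 - c n` drops still to come require that many prime factors.
  have hd : ∀ n, nestedDivisor m k p (c n) ≤ gcdBelow m φ n := by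
    intro n
    rcases Nat.eq_zero_or_pos (c n) with h0 | h0
    · have h1 : ∀ i ≤ n, gcdBelow m φ i = m := by
        intro i
        induction i with
        | zero => exact fun _ => gcdBelow_zero m φ
        | succ i ih =>
          intro hi
          have hi' : i ∉ D := by
            intro hmem
            rw [Finset.card_eq_zero] at h0
            exact Finset.notMem_empty i
              (h0 ▸ Finset.mem_filter.2 ⟨Finset.mem_range.2 (by omega), hmem⟩)
          exact (le_antisymm (Nat.le_of_dvd (gcdBelow_pos hm _)
            (gcdBelow_dvd_gcdBelow i.le_succ)) (not_lt.1 hi')).trans (ih (by omega))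
      rw [h0, nestedDivisor_zero, h1 n le_rfl]
    · rw [nestedDivisor_of_pos h0.ne']
      have h1 := hΩ n (max n N) (le_max_left _ _)
      rw [hN _ (le_max_right _ _)] at h1
      exact (prod_le_of_dvd_of_le_cardFactors hp hmono (hfac ▸ gcdBelow_dvd m φ n)
        (by omega)).2
  -- The witness `a` is the last drop before `n`, or `m` if there is none.
  have hβ : ∀ n, m < n → ∃ a, normalExponent m k p (c n) ≤ a ∧ a < n ∧ gcdBelow m φ n ∣ a := by
    intro n hn
    induction n, hn using Nat.le_induction with
    | base =>
      have h0 : c (m + 1) = 0 := by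
        rw [Finset.card_eq_zero, Finset.filter_eq_empty_iff]
        intro i hi hmem
        have := hDm i hmem
        rw [Finset.mem_range] at hi
        omega
      rw [h0, normalExponent_zero]
      exact ⟨m, le_rfl, m.lt_succ_self, gcdBelow_dvd _ _ _⟩
    | succ n hn ih =>
      obtain ⟨a, ha1, ha2, ha3⟩ := ih
      have ha4 : gcdBelow m φ (n + 1) ∣ a := (gcdBelow_dvd_gcdBelow n.le_succ).trans ha3
      by_cases hmem : n ∈ D
      · have hc1 : c (n + 1) = c n + 1 := by rw [hc_succ, if_pos hmem]
        have hna : gcdBelow m φ (n + 1) ∣ n :=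
          gcdBelow_dvd_of_mem n.lt_succ_self (mem_powerSupport_of_gcdBelow_lt hmem)
        refine ⟨n, ?_, n.lt_succ_self, hna⟩
        have h1 := Nat.le_of_dvd (by omega) (Nat.dvd_sub hna ha4)
        have h2 := hd (n + 1)
        rw [hc1] at h2 ⊢
        rw [normalExponent_succ]
        omega
      · refine ⟨a, ?_, by omega, ha4⟩
        rw [hc_succ, if_neg hmem]
        exact ha1
  obtain ⟨a, ha1, ha2, -⟩ := hβ n hn
  exact (hG (c n) (hc_le n) n (by omega)).trans (hd n)

/-- If the exponents are those of the normal form, then the greatest common divisor after the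
exponent `m + d₁ + ⋯ + dⱼ` is at most `dⱼ`: it divides the difference of two consecutive exponents.
-/
theorem gcdBelow_le_of_powerSupport_eq (hm : m ≠ 0) (hp : ∀ i ∈ Finset.Icc 1 r, (p i).Prime)
    (hfac : m = ∏ i ∈ Finset.Icc 1 r, p i) (hk : 3 ≤ k) (hkr : k ≤ r + 1) {φ : ℂ → ℂ}
    (hφ : powerSupport φ = {n | ∃ i ∈ Finset.Icc 1 (k - 1), n = normalExponent m k p i})
    {j : ℕ} (hj : j ≤ k - 1) {n : ℕ} (hn : normalExponent m k p j < n) :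
    gcdBelow m φ n ≤ nestedDivisor m k p j := by
  refine Nat.le_of_dvd (nestedDivisor_pos hm hp hfac hk hkr hj) ?_
  have h1 : ∀ i ≤ j, gcdBelow m φ n ∣ normalExponent m k p i := by
    intro i hi
    rcases Nat.eq_zero_or_pos i with rfl | h0
    · rw [normalExponent_zero]
      exact gcdBelow_dvd _ _ _
    · refine gcdBelow_dvd_of_mem ?_ (hφ ▸ ⟨i, Finset.mem_Icc.2 ⟨h0, by omega⟩, rfl⟩)
      rcases hi.lt_or_eq with h | rfl
      · exact (normalExponent_strictMonoOn hm hp hfac hk hkr h hj).trans hn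
      · exact hn
  rcases j with _ | j
  · rw [nestedDivisor_zero]
    exact gcdBelow_dvd _ _ _
  · have h2 := h1 (j + 1) le_rfl
    rw [normalExponent_succ] at h2
    exact (Nat.dvd_add_right (h1 j (by omega))).1 h2

theorem gcdDrops_of_powerSupport_eq (hm : m ≠ 0) (hp : ∀ i ∈ Finset.Icc 1 r, (p i).Prime)
    (hfac : m = ∏ i ∈ Finset.Icc 1 r, p i) (hk : 3 ≤ k) (hkr : k ≤ r + 1) {φ : ℂ → ℂ}
    (hφ : powerSupport φ = {n | ∃ i ∈ Finset.Icc 1 (k - 1), n = normalExponent m k p i}) :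
    gcdDrops m φ = powerSupport φ := by
  refine Set.Subset.antisymm (fun n hn => mem_powerSupport_of_gcdBelow_lt hn) fun n hn => ?_
  rw [hφ] at hn
  obtain ⟨j, hj, rfl⟩ := hn
  rw [Finset.mem_Icc] at hj
  obtain ⟨i, rfl⟩ : ∃ i, j = i + 1 := ⟨j - 1, by omega⟩
  have h1 := gcdBelow_le_of_powerSupport_eq hm hp hfac hk hkr hφ hj.2
    (Nat.lt_succ_self (normalExponent m k p (i + 1)))
  refine lt_of_le_of_lt h1 (lt_of_lt_of_le
    (nestedDivisor_succ hp hfac hk hkr (by omega : i < k - 1)).2 ?_)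
  refine Nat.le_of_dvd (gcdBelow_pos hm _) (dvd_gcdBelow_iff.2 ⟨?_, fun n hlt hn => ?_⟩)
  · simpa [nestedDivisor_zero] using nestedDivisor_dvd hp hfac hk hkr (Nat.zero_le i)
      (by omega : i ≤ k - 1)
  · rw [hφ] at hn
    obtain ⟨l, hl, rfl⟩ := hn
    rw [Finset.mem_Icc] at hl
    refine dvd_normalExponent hp hfac hk hkr ?_ (by omega)
    by_contra hil
    rcases (show i + 1 ≤ l by omega).lt_or_eq with h | rfl
    · exact absurd hlt (normalExponent_strictMonoOn hm hp hfac hk hkr h hl.2).le.not_gt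
    · exact lt_irrefl _ hlt

theorem puiseuxExponents_of_powerSupport_eq (hm : m ≠ 0)
    (hp : ∀ i ∈ Finset.Icc 1 r, (p i).Prime)
    (hfac : m = ∏ i ∈ Finset.Icc 1 r, p i) (hk : 3 ≤ k) (hkr : k ≤ r + 1) {φ : ℂ → ℂ}
    (hφ : powerSupport φ = {n | ∃ i ∈ Finset.Icc 1 (k - 1), n = normalExponent m k p i}) :
    puiseuxExponents m φ = insert (normalExponent m k p (k - 2) + 1)
      {e | ∃ i ≤ k - 2, e = normalExponent m k p i} ∧ (puiseuxExponents m φ).encard = k := by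
  have h1 : puiseuxExponents m φ = normalExponent m k p '' Finset.range k := by
    rw [puiseuxExponents_eq, gcdDrops_of_powerSupport_eq hm hp hfac hk hkr hφ, hφ]
    ext n
    simp only [Set.mem_insert_iff, Set.mem_ofPred_eq, Finset.mem_Icc, Set.mem_image,
      Finset.coe_range, Set.mem_Iio]
    constructor
    · rintro (rfl | ⟨i, hi, rfl⟩)
      · exact ⟨0, by omega, normalExponent_zero⟩
      · exact ⟨i, by omega, rfl⟩
    · rintro ⟨i, hi, rfl⟩
      rcases Nat.eq_zero_or_pos i with rfl | h0
      · exact Or.inl normalExponent_zero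
      · exact Or.inr ⟨i, by omega, rfl⟩
  constructor
  · rw [h1, ← normalExponent_last hk]
    ext n
    simp only [Set.mem_insert_iff, Set.mem_ofPred_eq, Set.mem_image, Finset.coe_range, Set.mem_Iio]
    constructor
    · rintro ⟨i, hi, rfl⟩
      rcases (show i = k - 1 ∨ i ≤ k - 2 by omega) with rfl | h
      · exact Or.inl rfl
      · exact Or.inr ⟨i, h, rfl⟩
    · rintro (rfl | ⟨i, hi, rfl⟩)
      · exact ⟨k - 1, by omega, rfl⟩
      · exact ⟨i, by omega, rfl⟩
  · rw [h1, Set.InjOn.encard_image, Set.encard_coe_eq_coe_finsetCard, Finset.card_range]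
    intro i hi j hj hij
    simp only [Finset.coe_range, Set.mem_Iio] at hi hj
    rcases lt_trichotomy i j with h | h | h
    · exact absurd hij (normalExponent_strictMonoOn hm hp hfac hk hkr h (by omega)).ne
    · exact h
    · exact absurd hij (normalExponent_strictMonoOn hm hp hfac hk hkr h (by omega)).ne'

end nested

end

/-! ### Uniqueness of the characteristic exponents -/

noncomputable section

open PowerSeries Asymptotics

theorem taylorSeries_sub {f g : ℂ → ℂ} (hf : AnalyticAt ℂ f 0) (hg : AnalyticAt ℂ g 0) :
    taylorSeries (fun u => f u - g u) = taylorSeries f - taylorSeries g := by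
  apply C_injective
  rw [map_sub, ← analyticGerms.coeff_taylor_comp_fst hf, ← analyticGerms.coeff_taylor_comp_fst hg,
    ← analyticGerms.coeff_taylor_comp_fst (hf.fun_sub hg), ← map_sub, analyticGerms.of_sub]
  rfl

theorem natCast_le_analyticOrderAt_iff_coeff {f : ℂ → ℂ} (hf : AnalyticAt ℂ f 0) (n : ℕ) :
    n ≤ analyticOrderAt f 0 ↔ ∀ i < n, coeff i (taylorSeries f) = 0 := by
  rw [natCast_le_analyticOrderAt_iff_iteratedDeriv_eq_zero hf]
  refine forall₂_congr fun i _ => ?_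
  rw [PlaneBranch.coeff_taylorSeries_eq_zero_iff, powerSupport, Set.mem_ofPred_eq, not_not]

theorem isBigO_pow_iff {f : ℂ → ℂ} (hf : AnalyticAt ℂ f 0) (n : ℕ) :
    f =O[𝓝 0] (fun u => u ^ n) ↔ n ≤ analyticOrderAt f 0 := by
  constructor
  · intro h
    by_contra hlt
    rw [not_le] at hlt
    obtain ⟨k, hk⟩ := ENat.ne_top_iff_exists.1 (ne_top_of_lt hlt)
    rw [← hk, ENat.natCast_lt_natCast] at hlt
    obtain ⟨g, hg, hg0, hfg⟩ := (hf.analyticOrderAt_eq_natCast).1 hk.symm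
    have h1 : (fun u : ℂ => u ^ k) =O[𝓝 0] f := by
      have h2 : (fun u : ℂ => f u * (g u)⁻¹) =O[𝓝 0] (fun u => f u * 1) :=
        (isBigO_refl f _).mul ((hg.inv hg0).continuousAt.tendsto.isBigO_one ℂ)
      simp only [mul_one] at h2
      refine h2.congr' ?_ EventuallyEq.rfl
      filter_upwards [hfg, hg.continuousAt.eventually_ne hg0] with u h3 h4
      rw [h3, sub_zero, smul_eq_mul, mul_assoc, mul_inv_cancel₀ h4, mul_one]
    have h3 : (fun u : ℂ => u ^ k) =o[𝓝 0] (fun u : ℂ => u ^ k) :=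
      (h1.trans h).trans_isLittleO (isLittleO_pow_pow hlt)
    refine isLittleO_irrefl ?_ h3
    refine Frequently.filter_mono (Eventually.frequently ?_) (nhdsWithin_le_nhds (s := {0}ᶜ))
    filter_upwards [self_mem_nhdsWithin] with u hu using pow_ne_zero k hu
  · intro h
    obtain ⟨g, hg, hfg⟩ := (natCast_le_analyticOrderAt hf).1 h
    have h1 : (fun u : ℂ => u ^ n * g u) =O[𝓝 0] (fun u => u ^ n * 1) :=
      (isBigO_refl _ _).mul (hg.continuousAt.tendsto.isBigO_one ℂ)
    simp only [mul_one] at h1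
    refine h1.congr' ?_ EventuallyEq.rfl
    filter_upwards [hfg] with u hu
    rw [hu, sub_zero, smul_eq_mul]

/-- Conjugation by `ζ` preserves `φ` up to order `n` if and only if `ζ` is a root of unity of
order dividing `gcdBelow m φ n`. -/
theorem isBigO_conj_sub_iff {m : ℕ} {φ : ℂ → ℂ} (hφ : AnalyticAt ℂ φ 0) {ζ : ℂ} (hζ : ζ ^ m = 1)
    (n : ℕ) : (fun u => φ (ζ * u) - φ u) =O[𝓝 0] (fun u => u ^ n) ↔ ζ ^ gcdBelow m φ n = 1 := by
  rw [isBigO_pow_iff ((hφ.comp_const_mul ζ).fun_sub hφ), natCast_le_analyticOrderAt_iff_coeff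
    ((hφ.comp_const_mul ζ).fun_sub hφ), taylorSeries_sub (hφ.comp_const_mul ζ) hφ,
    taylorSeries_comp_const_mul hφ]
  simp only [coeff_rescale_sub_eq_zero_iff]
  rw [← orderOf_dvd_iff_pow_eq_one, dvd_gcdBelow_iff, orderOf_dvd_iff_pow_eq_one]
  simp only [orderOf_dvd_iff_pow_eq_one]
  exact ⟨fun h => ⟨hζ, h⟩, fun h => h.2⟩

theorem eventually_forall_pow_eq (m : ℕ) {P : ℂ → Prop}
    (h : ∀ᶠ u in 𝓝 (0 : ℂ), P u) :
    ∀ᶠ x in 𝓝 (0 : ℂ), ∀ u, u ^ m = x → P u := by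
  obtain ⟨r, hr, hP⟩ := Metric.eventually_nhds_iff_ball.1 h
  filter_upwards [Metric.ball_mem_nhds (0 : ℂ) (pow_pos hr m)] with x hx u hu
  apply hP
  rw [mem_ball_zero_iff] at hx ⊢
  rw [← hu, norm_pow] at hx
  exact lt_of_pow_lt_pow_left₀ m hr.le hx

theorem exists_eq_pow_mul {m : ℕ} {φ : ℂ → ℂ} (hφ : AnalyticAt ℂ φ 0)
    (hlt : ∀ n ∈ powerSupport φ, m < n) :
    ∃ χ : ℂ → ℂ, AnalyticAt ℂ χ 0 ∧ ∀ᶠ u in 𝓝 (0 : ℂ), φ u = u ^ (m + 1) * χ u := by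
  have h : ((m + 1 : ℕ) : ℕ∞) ≤ analyticOrderAt φ 0 := by
    rw [natCast_le_analyticOrderAt_iff_coeff hφ]
    intro i hi
    rw [PlaneBranch.coeff_taylorSeries_eq_zero_iff]
    intro hmem
    have := hlt i hmem
    omega
  obtain ⟨χ, hχ, he⟩ := (natCast_le_analyticOrderAt hφ).1 h
  exact ⟨χ, hχ, he.mono fun u hu => by rw [hu, sub_zero, smul_eq_mul]⟩

theorem exists_root_of_pow_eq {m : ℕ} (hm : m ≠ 0) {v w : ℂ} (h : v ^ m = w ^ m) :
    ∃ ζ ∈ Polynomial.nthRootsFinset m (1 : ℂ), v = ζ * w := by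
  by_cases hw : w = 0
  · subst hw
    rw [zero_pow hm] at h
    exact ⟨1, (mem_rootsOfUnity_iff hm).2 (one_pow m), by rw [mul_zero, eq_zero_of_pow_eq_zero h]⟩
  · refine ⟨v / w, (mem_rootsOfUnity_iff hm).2 ?_, (div_mul_cancel₀ v hw).symm⟩
    rw [div_pow, h, div_self (pow_ne_zero m hw)]

namespace PlaneBranch

variable {B : PlaneBranch} {L L' : (ℂ × ℂ) ≃L[ℂ] (ℂ × ℂ)} {m : ℕ} {φ φ' : ℂ → ℂ}

/-- In the coordinates of a Puiseux parametrization, the branch is the image of the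
parametrization. Since all the parameters of a point near the origin are small, they need not be
restricted to a neighbourhood. -/
theorem IsPuiseuxParametrization.eventually_iff (h : B.IsPuiseuxParametrization L m φ) :
    ∀ᶠ q in 𝓝 (0 : ℂ × ℂ), B.eqn (L q) = 0 ↔ ∃ u, u ^ m = q.1 ∧ φ u = q.2 := by
  have h1 := (L.continuous.continuousAt.tendsto_of_map_zero (_root_.map_zero L)).eventually
    (h.parametrizes.surjective Set.univ univ_mem)
  have h2 := (continuous_fst.continuousAt.tendsto_of_map_zero
    (rfl : (0 : ℂ × ℂ).1 = 0)).eventually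
    (eventually_forall_pow_eq m h.parametrizes.vanishes)
  filter_upwards [h1, h2] with q hq1 hq2
  constructor
  · intro hq
    obtain ⟨u, -, hu⟩ := hq1 hq
    have h3 := L.injective hu
    exact ⟨u, congrArg Prod.fst h3, congrArg Prod.snd h3⟩
  · rintro ⟨u, hu1, hu2⟩
    have h3 := hq2 u hu1
    rwa [hu1, hu2] at h3

/-- Two Puiseux parametrizations of a branch, in the coordinates `L` and `L'`, differ by a change
of parameter `u ↦ u κ(u)`; the change of coordinates preserves the tangent line `y = 0`. -/
theorem IsPuiseuxParametrization.exists_reparametrization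
    (h : B.IsPuiseuxParametrization L m φ) (h' : B.IsPuiseuxParametrization L' m φ') :
    ∃ (κ : ℂ → ℂ) (a b d : ℂ), AnalyticAt ℂ κ 0 ∧ κ 0 ≠ 0 ∧
      (∀ᶠ u in 𝓝 (0 : ℂ), u ^ m * κ u ^ m = a * u ^ m + b * φ u) ∧
      ∀ᶠ u in 𝓝 (0 : ℂ), φ' (u * κ u) = d * φ u := by
  have hm := h.pos.ne'
  set M := L.trans L'.symm with hM
  set a := (M (1, 0)).1 with ha
  set b := (M (0, 1)).1 with hb
  set c := (M (1, 0)).2 with hc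
  set d := (M (0, 1)).2 with hd
  have hMxy : ∀ x y : ℂ, M (x, y) = (a * x + b * y, c * x + d * y) := by
    intro x y
    have h1 : ((x, y) : ℂ × ℂ) = x • ((1, 0) : ℂ × ℂ) + y • ((0, 1) : ℂ × ℂ) := by ext <;> simp
    rw [h1, map_add, map_smul, map_smul]
    ext <;> simp [a, b, c, d, mul_comm]
  obtain ⟨χ, hχ, hφχ⟩ := exists_eq_pow_mul h.analytic h.lt_of_mem
  obtain ⟨χ', hχ', hφχ'⟩ := exists_eq_pow_mul h'.analytic h'.lt_of_mem
  have hpar : ∀ᶠ u in 𝓝 (0 : ℂ), ∃ v, v ^ m = a * u ^ m + b * φ u ∧ φ' v = c * u ^ m + d * φ u := by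
    have h1 : Tendsto (fun u : ℂ => M (u ^ m, φ u)) (𝓝 0) (𝓝 0) :=
      (M.continuous.continuousAt.tendsto_of_map_zero (_root_.map_zero M)).comp
        (tendsto_param hm h.analytic h.map_zero)
    filter_upwards [h1.eventually h'.eventually_iff, h.parametrizes.vanishes] with u h2 h3
    have h4 : L' (M (u ^ m, φ u)) = L (u ^ m, φ u) := by simp [hM]
    rw [h4, hMxy] at h2
    exact h2.1 h3
  have hcont : ContinuousAt (fun u : ℂ => a + b * (u * χ u)) 0 :=
    continuousAt_const.add (continuousAt_const.mul (continuousAt_id.mul hχ.continuousAt))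
  -- The tangent line is preserved: compare the two coordinates, divided by `u ^ m`.
  have hc0 : c = 0 := by
    have h1 : ∀ ε > 0, ‖c‖ ≤ ‖a‖ * ε := by
      intro ε hε
      have hω : ContinuousAt (fun v : ℂ => v * χ' v) 0 := continuousAt_id.mul hχ'.continuousAt
      have h2 : ∀ᶠ v in 𝓝 (0 : ℂ), ‖v * χ' v‖ < ε := by
        have := hω.norm
        refine this.eventually_lt continuousAt_const ?_
        simpa using hε
      have h3 : Tendsto (fun u : ℂ => a * u ^ m + b * φ u) (𝓝 0) (𝓝 0) := by
        have : ContinuousAt (fun u : ℂ => a * u ^ m + b * φ u) 0 :=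
          (continuousAt_const.mul (continuousAt_id.pow m)).add
            (continuousAt_const.mul h.analytic.continuousAt)
        exact this.tendsto_of_map_zero (by simp [hm, h.map_zero])
      have h4 := h3.eventually (eventually_forall_pow_eq m (h2.and hφχ'))
      have h5 : ∀ᶠ u in 𝓝[≠] (0 : ℂ), ‖c + d * (u * χ u)‖ ≤ ‖a + b * (u * χ u)‖ * ε := by
        have h6 := (h4.and (hpar.and hφχ)).filter_mono (nhdsWithin_le_nhds (s := {0}ᶜ))
        filter_upwards [h6, self_mem_nhdsWithin] with u hu hu0
        obtain ⟨hv, ⟨v, hv1, hv2⟩, hφu⟩ := hu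
        obtain ⟨h7, h8⟩ := hv v hv1
        have h9 : u ^ m ≠ 0 := pow_ne_zero m hu0
        have h10 : c + d * (u * χ u) = (a + b * (u * χ u)) * (v * χ' v) := by
          apply mul_left_cancel₀ h9
          calc u ^ m * (c + d * (u * χ u)) = c * u ^ m + d * φ u := by rw [hφu]; ring
            _ = v ^ m * (v * χ' v) := by rw [← hv2, h8]; ring
            _ = u ^ m * ((a + b * (u * χ u)) * (v * χ' v)) := by rw [hv1, hφu]; ring
        rw [h10, norm_mul]
        exact mul_le_mul_of_nonneg_left h7.le (norm_nonneg _)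
      have hcont' : ContinuousAt (fun u : ℂ => c + d * (u * χ u)) 0 :=
        continuousAt_const.add (continuousAt_const.mul (continuousAt_id.mul hχ.continuousAt))
      have h11 := le_of_tendsto_of_tendsto
        (hcont'.norm.tendsto.mono_left (nhdsWithin_le_nhds (s := {0}ᶜ)))
        ((hcont.norm.mul continuousAt_const).tendsto.mono_left (nhdsWithin_le_nhds (s := {0}ᶜ))) h5
      simpa using h11
    by_contra hne
    have h2 : 0 < ‖c‖ := norm_pos_iff.2 hne
    have h3 := h1 (‖c‖ / (2 * (‖a‖ + 1))) (by positivity)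
    have h4 : ‖a‖ * (‖c‖ / (2 * (‖a‖ + 1))) ≤ ‖c‖ / 2 := by
      rw [mul_div_assoc', div_le_div_iff₀ (by positivity) two_pos]
      nlinarith [norm_nonneg a]
    linarith
  have ha0 : a ≠ 0 := by
    intro ha0
    have h1 := hMxy 1 0
    rw [ha0, hc0] at h1
    have h2 : M (1, 0) = M 0 := by rw [h1, _root_.map_zero]; simp
    have h3 := congrArg Prod.fst (M.injective h2)
    simp at h3
  -- An analytic `m`-th root of `a + b φ / u ^ m`.
  let κ : ℂ → ℂ := fun u => a ^ ((m : ℂ)⁻¹) * (1 + b / a * (u * χ u)) ^ ((m : ℂ)⁻¹)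
  have hκ : AnalyticAt ℂ κ 0 := by
    refine analyticAt_const.mul (AnalyticAt.cpow (analyticAt_const.add
      (analyticAt_const.mul (analyticAt_id.mul hχ))) analyticAt_const ?_)
    simp
  have hκm : ∀ u, κ u ^ m = a + b * (u * χ u) := by
    intro u
    simp only [κ]
    rw [mul_pow, Complex.cpow_nat_inv_pow _ hm, Complex.cpow_nat_inv_pow _ hm]
    field_simp
  have hpow : ∀ᶠ u in 𝓝 (0 : ℂ), (u * κ u) ^ m = a * u ^ m + b * φ u := by
    filter_upwards [hφχ] with u hu
    rw [mul_pow, hκm, hu]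
    ring
  -- The root of unity `ζ` depends on `u`, but one of them occurs for arbitrarily small `u`, and the
  -- identity theorem extends its equation to all `u`.
  have hex : ∀ᶠ u in 𝓝 (0 : ℂ), ∃ ζ ∈ Polynomial.nthRootsFinset m (1 : ℂ),
      φ' (ζ * (u * κ u)) = d * φ u := by
    filter_upwards [hpow, hpar] with u h1 ⟨v, h2, h3⟩
    obtain ⟨ζ, hζ, hv⟩ := exists_root_of_pow_eq hm (h2.trans h1.symm)
    exact ⟨ζ, hζ, by rw [← hv, h3, hc0, zero_mul, zero_add]⟩
  have hfreq : ∃ᶠ u in 𝓝[≠] (0 : ℂ), ∃ ζ ∈ Polynomial.nthRootsFinset m (1 : ℂ),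
      φ' (ζ * (u * κ u)) = d * φ u := (hex.filter_mono nhdsWithin_le_nhds).frequently
  rw [frequently_exists_finset] at hfreq
  obtain ⟨ζ, hζ, hfreq⟩ := hfreq
  rw [mem_rootsOfUnity_iff hm] at hζ
  have hζ0 : ζ ≠ 0 := by
    rintro rfl
    rw [zero_pow hm] at hζ
    exact zero_ne_one hζ
  have han : AnalyticAt ℂ (fun u => φ' (ζ * (u * κ u))) 0 :=
    h'.analytic.comp_of_map_zero (analyticAt_const.mul (analyticAt_id.mul hκ)) (by simp)
  have heq := (han.frequently_eq_iff_eventually_eq (analyticAt_const.mul h.analytic)).1 hfreq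
  refine ⟨fun u => ζ * κ u, a, b, d, analyticAt_const.mul hκ, mul_ne_zero hζ0 ?_, ?_, ?_⟩
  · intro h0
    have h1 := hκm 0
    rw [h0, zero_pow hm] at h1
    simp only [zero_mul, mul_zero, add_zero] at h1
    exact ha0 h1.symm
  · filter_upwards [hpow] with u hu
    rw [mul_pow, hζ, one_mul, ← mul_pow, hu]
  · filter_upwards [heq] with u hu
    rw [mul_left_comm]
    exact hu

/-- If the conjugation by `ζ` preserves `φ` up to order `n`, then the change of parameter commutes
with `ζ` up to an order that makes the conjugation preserve `φ'` up to order `n`, too. -/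
theorem IsPuiseuxParametrization.gcdBelow_dvd_gcdBelow
    (h : B.IsPuiseuxParametrization L m φ) (h' : B.IsPuiseuxParametrization L' m φ') (n : ℕ) :
    gcdBelow m φ n ∣ gcdBelow m φ' n := by
  have hm := h.pos.ne'
  obtain ⟨κ, a, b, d, hκ, hκ0, hκm, hφκ⟩ := h.exists_reparametrization h'
  obtain ⟨χ', hχ', hφχ'⟩ := exists_eq_pow_mul h'.analytic h'.lt_of_mem
  have hprim := Complex.isPrimitiveRoot_exp _ (gcdBelow_pos (φ := φ) hm n).ne'
  set ζ := Complex.exp (2 * Real.pi * Complex.I / (gcdBelow m φ n : ℕ)) with hζdef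
  have hζ : ζ ^ m = 1 := (hprim.pow_eq_one_iff_dvd m).2 (gcdBelow_dvd m φ n)
  rw [← hprim.pow_eq_one_iff_dvd, ← isBigO_conj_sub_iff h'.analytic hζ]
  have hδ := (isBigO_conj_sub_iff h.analytic hζ n).2 hprim.pow_eq_one
  have hζt := tendsto_const_mul_zero ζ
  have hκ1 : AnalyticAt ℂ (fun u => κ (ζ * u)) 0 := hκ.comp_const_mul ζ
  have hζn : ‖ζ‖ = 1 := Complex.norm_eq_one_of_pow_eq_one hζ hm
  -- `κ` is invariant under `ζ` up to order `n - m`.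
  have hS : ∃ c > 0, ∀ᶠ u in 𝓝 (0 : ℂ), c * ‖κ (ζ * u) - κ u‖ ≤ ‖κ (ζ * u) ^ m - κ u ^ m‖ := by
    have hcont : ContinuousAt (fun u => ∑ i ∈ Finset.range m,
        κ (ζ * u) ^ i * κ u ^ (m - 1 - i)) 0 :=
      tendsto_finsetSum _ fun i _ => (hκ1.continuousAt.pow i).mul (hκ.continuousAt.pow _)
    have hne : ∑ i ∈ Finset.range m, κ (ζ * 0) ^ i * κ 0 ^ (m - 1 - i) ≠ 0 := by
      have h1 : ∀ i ∈ Finset.range m, κ (ζ * 0) ^ i * κ 0 ^ (m - 1 - i) = κ 0 ^ (m - 1) := by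
        intro i hi
        rw [Finset.mem_range] at hi
        rw [mul_zero, ← pow_add]
        congr 1
        omega
      rw [Finset.sum_congr rfl h1, Finset.sum_const, Finset.card_range, nsmul_eq_mul]
      exact mul_ne_zero (Nat.cast_ne_zero.2 hm) (pow_ne_zero _ hκ0)
    set s := ‖∑ i ∈ Finset.range m, κ (ζ * 0) ^ i * κ 0 ^ (m - 1 - i)‖ with hs
    have hs0 : 0 < s := norm_pos_iff.2 hne
    refine ⟨s / 2, by positivity, ?_⟩
    filter_upwards [continuousAt_const.eventually_lt hcont.norm (half_lt_self hs0)] with u hu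
    rw [← geom_sum₂_mul, norm_mul]
    exact mul_le_mul_of_nonneg_right hu.le (norm_nonneg _)
  obtain ⟨c, hc, hS⟩ := hS
  have hdiff : ∀ᶠ u in 𝓝 (0 : ℂ), u ^ m * (κ (ζ * u) ^ m - κ u ^ m) = b * (φ (ζ * u) - φ u) := by
    filter_upwards [hκm, hζt.eventually hκm] with u h1 h2
    rw [mul_pow, hζ, one_mul] at h2
    rw [mul_sub, h1, h2]
    ring
  -- The function `φ' (ζ u x)`, divided by `(ζ u) ^ (m + 1)`, is Lipschitz in `x`.
  let H : ℂ × ℂ → ℂ := fun q => q.1 ^ (m + 1) * χ' (ζ * q.2 * q.1)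
  have hH : AnalyticAt ℂ H (κ 0, 0) := by
    refine (analyticAt_fst.pow _).mul ?_
    have h1 : AnalyticAt ℂ χ' ((fun q : ℂ × ℂ => ζ * q.2 * q.1) (κ 0, 0)) := by simpa using hχ'
    exact AnalyticAt.fun_comp (f := fun q : ℂ × ℂ => ζ * q.2 * q.1) h1
      ((analyticAt_const.mul analyticAt_snd).mul analyticAt_fst)
  obtain ⟨K, s, hs, hK⟩ := hH.hasStrictFDerivAt.exists_lipschitzOnWith
  have hs1 : ∀ᶠ u in 𝓝 (0 : ℂ), (κ (ζ * u), u) ∈ s := by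
    have : ContinuousAt (fun u : ℂ => (κ (ζ * u), u)) 0 := hκ1.continuousAt.prodMk continuousAt_id
    exact this.eventually (by simpa using hs)
  have hs2 : ∀ᶠ u in 𝓝 (0 : ℂ), (κ u, u) ∈ s := by
    have : ContinuousAt (fun u : ℂ => (κ u, u)) 0 := hκ.continuousAt.prodMk continuousAt_id
    exact this.eventually hs
  have hτ : AnalyticAt ℂ (fun u => u * κ u) 0 := analyticAt_id.mul hκ
  have hτt : Tendsto (fun u => u * κ u) (𝓝 0) (𝓝 0) :=
    hτ.continuousAt.tendsto_of_map_zero (zero_mul _)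
  have hmain : (fun u => φ' (ζ * (u * κ u)) - φ' (u * κ u)) =O[𝓝 0] (fun u : ℂ => u ^ n) := by
    have h1 : (fun u => φ' (ζ * u * κ (ζ * u)) - φ' (ζ * (u * κ u))) =O[𝓝 0]
        (fun u : ℂ => φ (ζ * u) - φ u) := by
      refine IsBigO.of_bound (K * ‖b‖ / c) ?_
      have hτ1 : Tendsto (fun u => ζ * u * κ (ζ * u)) (𝓝 0) (𝓝 0) := hτt.comp hζt
      have hτ2 : Tendsto (fun u => ζ * (u * κ u)) (𝓝 0) (𝓝 0) := hζt.comp hτt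
      filter_upwards [hS, hdiff, hs1, hs2, hτ1.eventually hφχ', hτ2.eventually hφχ',
        Metric.ball_mem_nhds (0 : ℂ) one_pos] with u e1 e2 e3 e4 e5 e6 e7
      have e8 : φ' (ζ * u * κ (ζ * u)) - φ' (ζ * (u * κ u)) =
          (ζ * u) ^ (m + 1) * (H (κ (ζ * u), u) - H (κ u, u)) := by
        rw [e5, e6]
        simp only [H, mul_assoc, mul_pow]
        ring
      have e9 := hK.dist_le_mul _ e3 _ e4
      rw [dist_eq_norm, dist_eq_norm, Prod.mk_sub_mk, sub_self, Prod.norm_mk, norm_zero,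
        max_eq_left (norm_nonneg _)] at e9
      have e10 : ‖u‖ ≤ 1 := (mem_ball_zero_iff.1 e7).le
      have e11 := congrArg norm e2
      rw [norm_mul, norm_mul, norm_pow] at e11
      rw [e8, norm_mul, norm_pow, norm_mul, hζn, one_mul, div_mul_eq_mul_div, le_div_iff₀ hc]
      calc ‖u‖ ^ (m + 1) * ‖H (κ (ζ * u), u) - H (κ u, u)‖ * c
          ≤ ‖u‖ ^ (m + 1) * (K * ‖κ (ζ * u) - κ u‖) * c := by gcongr
        _ = K * (‖u‖ ^ m * (c * ‖κ (ζ * u) - κ u‖)) * ‖u‖ := by ring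
        _ ≤ K * (‖u‖ ^ m * ‖κ (ζ * u) ^ m - κ u ^ m‖) * 1 := by gcongr
        _ = K * ‖b‖ * ‖φ (ζ * u) - φ u‖ := by rw [e11]; ring
    have h2 := (hδ.const_mul_left d).sub (h1.trans hδ)
    refine h2.congr' ?_ EventuallyEq.rfl
    filter_upwards [hφκ, hζt.eventually hφκ] with u e1 e2
    rw [e1, e2]
    ring
  have hcomp : AnalyticAt ℂ (fun v => φ' (ζ * v) - φ' v) 0 :=
    (h'.analytic.comp_const_mul ζ).fun_sub h'.analytic
  rw [isBigO_pow_iff hcomp]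
  rw [isBigO_pow_iff (hcomp.comp_of_map_zero hτ (zero_mul _))] at hmain
  have hderiv : deriv (fun u => u * κ u) 0 ≠ 0 := by
    have h1 : HasDerivAt (fun u => u * κ u) (1 * κ 0 + 0 * deriv κ 0) 0 :=
      (hasDerivAt_id (0 : ℂ)).mul hκ.differentiableAt.hasDerivAt
    rw [h1.deriv, one_mul, zero_mul, add_zero]
    exact hκ0
  have h3 := analyticOrderAt_comp_of_deriv_ne_zero (f := fun v => φ' (ζ * v) - φ' v) hτ hderiv
  rw [zero_mul] at h3
  rw [← h3]
  exact hmain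

/-- The characteristic exponents do not depend on the Puiseux parametrization. -/
theorem IsPuiseuxParametrization.gcdBelow_eq
    (h : B.IsPuiseuxParametrization L m φ) (h' : B.IsPuiseuxParametrization L' m φ') :
    gcdBelow m φ = gcdBelow m φ' :=
  funext fun n => Nat.dvd_antisymm (h.gcdBelow_dvd_gcdBelow h' n) (h'.gcdBelow_dvd_gcdBelow h n)

end PlaneBranch

end

/-! ### Deforming the coefficients of a Puiseux parametrization -/

noncomputable section

open PowerSeries Asymptotics

/-- The plane curves `u ↦ (u ^ m, φ u)` and `u ↦ (u ^ m, ψ u)` correspond to each other, near the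
origin, under a homeomorphism of `ℂ²`. -/
def CurveEquivalent (m : ℕ) (φ ψ : ℂ → ℂ) : Prop :=
  ∃ Φ : (ℂ × ℂ) ≃ₜ (ℂ × ℂ), Φ 0 = 0 ∧ ∀ᶠ q in 𝓝 (0 : ℂ × ℂ),
    (∃ u, u ^ m = q.1 ∧ φ u = q.2) ↔ ∃ u, u ^ m = (Φ q).1 ∧ ψ u = (Φ q).2

theorem CurveEquivalent.symm {m : ℕ} {φ ψ : ℂ → ℂ} (h : CurveEquivalent m φ ψ) :
    CurveEquivalent m ψ φ := by
  obtain ⟨Φ, h0, h⟩ := h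
  have h0' : Φ.symm 0 = 0 := by rw [Homeomorph.symm_apply_eq, h0]
  refine ⟨Φ.symm, h0', ?_⟩
  filter_upwards [(Φ.symm.continuous.continuousAt.tendsto_of_map_zero h0').eventually h] with q hq
  rw [Φ.apply_symm_apply] at hq
  exact hq.symm

theorem CurveEquivalent.trans {m : ℕ} {φ ψ χ : ℂ → ℂ} (h : CurveEquivalent m φ ψ)
    (h' : CurveEquivalent m ψ χ) : CurveEquivalent m φ χ := by
  obtain ⟨Φ, h0, h⟩ := h
  obtain ⟨Ψ, h0', h'⟩ := h'
  refine ⟨Φ.trans Ψ, by rw [Homeomorph.trans_apply, h0, h0'], ?_⟩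
  filter_upwards [h, (Φ.continuous.continuousAt.tendsto_of_map_zero h0).eventually h'] with q h1 h2
  exact h1.trans h2

/-- A translation of the vertical lines, by a function that is contracting in the vertical
direction, is a homeomorphism. -/
theorem exists_homeomorph_add {g : ℂ × ℂ → ℂ} (hg : Continuous g)
    (hl : ∀ x y y', ‖g (x, y) - g (x, y')‖ ≤ 1 / 2 * ‖y - y'‖) :
    ∃ Φ : (ℂ × ℂ) ≃ₜ (ℂ × ℂ), ∀ q, Φ q = (q.1, q.2 + g q) := by
  have hinj : ∀ x y y', ‖y - y'‖ ≤ 2 * ‖(y + g (x, y)) - (y' + g (x, y'))‖ := by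
    intro x y y'
    have h1 := hl x y y'
    have h2 : y - y' = ((y + g (x, y)) - (y' + g (x, y'))) - (g (x, y) - g (x, y')) := by ring
    have h3 := norm_sub_le ((y + g (x, y)) - (y' + g (x, y'))) (g (x, y) - g (x, y'))
    rw [← h2] at h3
    linarith
  have hsurj : ∀ q : ℂ × ℂ, ∃ y, y + g (q.1, y) = q.2 := by
    intro q
    have hc : ContractingWith (1 / 2) (fun y => q.2 - g (q.1, y)) := by
      refine ⟨by norm_num, LipschitzWith.of_dist_le_mul fun y y' => ?_⟩
      rw [dist_eq_norm, dist_eq_norm, sub_sub_sub_cancel_left, norm_sub_rev]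
      simpa using hl q.1 y y'
    refine ⟨hc.fixedPoint, ?_⟩
    have h1 : q.2 - g (q.1, hc.fixedPoint) = hc.fixedPoint := hc.fixedPoint_isFixedPt
    nth_rewrite 1 [← h1]
    ring
  choose ψ hψ using hsurj
  have hcont : Continuous ψ := by
    rw [continuous_iff_continuousAt]
    intro q₀
    have h1 : Tendsto (fun q : ℂ × ℂ => 2 * ‖q.2 - (ψ q₀ + g (q.1, ψ q₀))‖) (𝓝 q₀) (𝓝 0) := by
      have h2 : Continuous (fun q : ℂ × ℂ => 2 * ‖q.2 - (ψ q₀ + g (q.1, ψ q₀))‖) := by fun_prop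
      have h3 := h2.tendsto q₀
      rwa [hψ q₀, sub_self, norm_zero, mul_zero] at h3
    rw [ContinuousAt, tendsto_iff_norm_sub_tendsto_zero]
    refine squeeze_zero (fun _ => norm_nonneg _) (fun q => ?_) h1
    have h2 := hinj q.1 (ψ q) (ψ q₀)
    rwa [hψ q] at h2
  refine ⟨{ toFun := fun q => (q.1, q.2 + g q)
            invFun := fun q => (q.1, ψ q)
            left_inv := fun q => ?_
            right_inv := fun q => ?_
            continuous_toFun := by fun_prop
            continuous_invFun := by fun_prop }, fun q => rfl⟩
  · have h1 := hinj q.1 (ψ (q.1, q.2 + g q)) q.2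
    rw [hψ (q.1, q.2 + g q), sub_self, norm_zero, mul_zero, norm_le_zero_iff, sub_eq_zero] at h1
    exact Prod.ext rfl h1
  · exact Prod.ext rfl (hψ q)

section lipschitzExtension

variable {ι : Type*} {s : Finset ι} (hs : s.Nonempty)

/-- The largest `1 / 4`-Lipschitz function on `ℂ` with values at most `aᵢ` at the points `cᵢ`. -/
def lipschitzExtension (a : ι → ℝ) (c : ι → ℂ) (y : ℂ) : ℝ :=
  s.inf' hs fun i => a i + 1 / 4 * ‖y - c i‖

theorem lipschitzExtension_apply {a : ι → ℝ} {c : ι → ℂ}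
    (h : ∀ i ∈ s, ∀ j ∈ s, |a i - a j| ≤ 1 / 4 * ‖c i - c j‖) {j : ι} (hj : j ∈ s) :
    lipschitzExtension hs a c (c j) = a j := by
  apply le_antisymm
  · refine (Finset.inf'_le _ hj).trans (le_of_eq ?_)
    rw [sub_self, norm_zero, mul_zero, add_zero]
  · refine Finset.le_inf' _ _ fun i hi => ?_
    have h1 := (abs_le.1 (h j hj i hi)).2
    linarith

theorem abs_lipschitzExtension_sub_le (a : ι → ℝ) (c : ι → ℂ) (y y' : ℂ) :
    |lipschitzExtension hs a c y - lipschitzExtension hs a c y'| ≤ 1 / 4 * ‖y - y'‖ := by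
  have key : ∀ y y', lipschitzExtension hs a c y ≤
      lipschitzExtension hs a c y' + 1 / 4 * ‖y - y'‖ := by
    intro y y'
    obtain ⟨i, hi, he⟩ := Finset.exists_mem_eq_inf' hs fun i => a i + 1 / 4 * ‖y' - c i‖
    rw [lipschitzExtension, lipschitzExtension, he]
    refine (Finset.inf'_le _ hi).trans ?_
    have h1 := norm_add_le (y - y') (y' - c i)
    rw [sub_add_sub_cancel] at h1
    linarith
  have h1 := key y y'
  have h2 := key y' y
  rw [norm_sub_rev] at h2
  rw [abs_le]
  constructor <;> linarith

end lipschitzExtension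

/-- The radial retraction of `ℂ` onto the disc of radius `r`. -/
def radialRetraction (r : ℝ) (u : ℂ) : ℂ := ((r / max r ‖u‖ : ℝ) : ℂ) * u

theorem continuous_radialRetraction {r : ℝ} (hr : 0 < r) : Continuous (radialRetraction r) := by
  have h : ∀ u : ℂ, max r ‖u‖ ≠ 0 := fun u => (lt_max_of_lt_left hr).ne'
  unfold radialRetraction
  fun_prop (disch := exact h _)

theorem radialRetraction_mem {r : ℝ} (hr : 0 < r) (u : ℂ) :
    radialRetraction r u ∈ Metric.closedBall (0 : ℂ) r := by
  rw [mem_closedBall_zero_iff, radialRetraction, norm_mul, Complex.norm_real, Real.norm_eq_abs,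
    abs_of_nonneg (by positivity), div_mul_eq_mul_div, div_le_iff₀ (lt_max_of_lt_left hr)]
  exact mul_le_mul_of_nonneg_left (le_max_right _ _) hr.le

theorem radialRetraction_of_mem {r : ℝ} (hr : 0 < r) {u : ℂ} (hu : u ∈ Metric.closedBall (0 : ℂ) r) :
    radialRetraction r u = u := by
  rw [mem_closedBall_zero_iff] at hu
  rw [radialRetraction, max_eq_left hu, div_self hr.ne', Complex.ofReal_one, one_mul]

theorem radialRetraction_mul (r : ℝ) {ζ : ℂ} (hζ : ‖ζ‖ = 1) (u : ℂ) :
    radialRetraction r (ζ * u) = ζ * radialRetraction r u := by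
  rw [radialRetraction, radialRetraction, norm_mul, hζ, one_mul, mul_left_comm]

/-- A continuous function of `(u, y)` that is invariant under the roots of unity is a continuous
function of `(u ^ m, y)`. -/
theorem exists_continuous_comp_pow {m : ℕ} (hm : m ≠ 0) {G : ℂ × ℂ → ℂ} (hG : Continuous G)
    (h : ∀ ζ : ℂ, ζ ^ m = 1 → ∀ u y, G (ζ * u, y) = G (u, y)) :
    ∃ g : ℂ × ℂ → ℂ, Continuous g ∧ ∀ u y, g (u ^ m, y) = G (u, y) := by
  have : NeZero m := ⟨hm⟩
  let g : ℂ × ℂ → ℂ := fun q => G (q.1 ^ ((m : ℂ)⁻¹), q.2)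
  have hg : ∀ u y, g (u ^ m, y) = G (u, y) := by
    intro u y
    have h1 : ((u ^ m) ^ ((m : ℂ)⁻¹)) ^ m = u ^ m := Complex.cpow_nat_inv_pow _ hm
    obtain ⟨ζ, hζ, hu⟩ := exists_root_of_pow_eq hm h1
    simp only [g]
    rw [hu, h ζ ((mem_rootsOfUnity_iff hm).1 hζ)]
  refine ⟨g, ?_, hg⟩
  have hq : IsOpenQuotientMap (Prod.map (fun u : ℂ => u ^ m) (id : ℂ → ℂ)) :=
    (Complex.isOpenQuotientMap_pow m).prodMap IsOpenQuotientMap.id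
  rw [hq.isQuotientMap.continuous_iff]
  have h2 : g ∘ Prod.map (fun u : ℂ => u ^ m) (id : ℂ → ℂ) = G := by
    ext ⟨u, y⟩
    exact hg u y
  rwa [h2]

theorem norm_eq_one_of_mem_nthRootsFinset {m : ℕ} (hm : m ≠ 0) {ζ : ℂ}
    (hζ : ζ ∈ Polynomial.nthRootsFinset m (1 : ℂ)) : ‖ζ‖ = 1 :=
  Complex.norm_eq_one_of_pow_eq_one ((mem_rootsOfUnity_iff hm).1 hζ) hm

/-- If the difference `ψ - φ` separates conjugate parameters at most a quarter as much as `φ`, then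
it extends, on each line `x = u ^ m`, from the points `φ (ζ u)` to a contraction, and adding this
contraction to `y` moves one curve to the other. -/
theorem curveEquivalent_of_norm_sub_le {m : ℕ} (hm : m ≠ 0) {φ ψ : ℂ → ℂ} (hφ : AnalyticAt ℂ φ 0)
    (hψ : AnalyticAt ℂ ψ 0) (hφ0 : φ 0 = 0) (hψ0 : ψ 0 = 0)
    (h : ∀ᶠ u in 𝓝 (0 : ℂ), ∀ ζ ∈ Polynomial.nthRootsFinset m (1 : ℂ),
      ‖(ψ (ζ * u) - φ (ζ * u)) - (ψ u - φ u)‖ ≤ 1 / 4 * ‖φ (ζ * u) - φ u‖) :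
    CurveEquivalent m φ ψ := by
  set R := Polynomial.nthRootsFinset m (1 : ℂ) with hR
  have hR1 : (1 : ℂ) ∈ R := (mem_rootsOfUnity_iff hm).2 (one_pow m)
  have hRne : R.Nonempty := ⟨1, hR1⟩
  have hRmul : ∀ ζ ∈ R, ∀ η ∈ R, ζ * η ∈ R := fun ζ hζ η hη => by
    rw [hR, mem_rootsOfUnity_iff hm] at hζ hη ⊢
    rw [mul_pow, hζ, hη, one_mul]
  have hRinv : ∀ ζ ∈ R, ζ⁻¹ ∈ R := fun ζ hζ => by
    rw [hR, mem_rootsOfUnity_iff hm] at hζ ⊢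
    rw [inv_pow, hζ, inv_one]
  have hRne0 : ∀ ζ ∈ R, ζ ≠ 0 := fun ζ hζ h0 => by
    have := norm_eq_one_of_mem_nthRootsFinset hm hζ
    rw [h0, norm_zero] at this
    exact zero_ne_one this
  have hcont : ∀ {f : ℂ → ℂ}, AnalyticAt ℂ f 0 → ∀ᶠ u in 𝓝 (0 : ℂ), ContinuousAt f u :=
    fun hf => hf.eventually_analyticAt.mono fun _ h => h.continuousAt
  obtain ⟨r, hr, hball⟩ := Metric.nhds_basis_closedBall.eventually_iff.1
    (h.and ((hcont hφ).and (hcont hψ)))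
  -- Extend both functions to the plane.
  set ρ := radialRetraction r with hρ
  have hρmem := radialRetraction_mem hr
  have hext : ∀ {f : ℂ → ℂ}, (∀ u ∈ Metric.closedBall (0 : ℂ) r, ContinuousAt f u) →
      Continuous fun u => f (ρ u) := fun hf =>
    continuous_iff_continuousAt.2 fun u =>
      (hf _ (hρmem u)).comp (continuous_radialRetraction hr).continuousAt
  have hφc := hext fun u hu => (hball hu).2.1
  have hψc := hext fun u hu => (hball hu).2.2
  set φ' := fun u => φ (ρ u) with hφ'
  set D := fun u => ψ (ρ u) - φ (ρ u) with hD
  have hDc : Continuous D := hψc.sub hφc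
  have hDφ : ∀ u, ∀ ζ ∈ R, ∀ η ∈ R, ‖D (ζ * u) - D (η * u)‖ ≤ 1 / 4 * ‖φ' (ζ * u) - φ' (η * u)‖ := by
    intro u ζ hζ η hη
    have h1 := (hball (hρmem (η * u))).1 (ζ * η⁻¹) (hRmul _ hζ _ (hRinv _ hη))
    have h2 : ζ * η⁻¹ * ρ (η * u) = ρ (ζ * u) := by
      rw [hρ, radialRetraction_mul r (norm_eq_one_of_mem_nthRootsFinset hm hη),
        radialRetraction_mul r (norm_eq_one_of_mem_nthRootsFinset hm hζ), mul_assoc,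
        inv_mul_cancel_left₀ (hRne0 η hη)]
    rw [← hρ, h2] at h1
    exact h1
  -- The extension of `p ∘ D`, where `p` is the real or the imaginary part, from the points
  -- `φ' (ζ u)` to the line; two `1 / 4`-Lipschitz real functions form a `1 / 2`-Lipschitz map.
  let e : (ℂ → ℝ) → ℂ × ℂ → ℝ := fun p q =>
    lipschitzExtension hRne (fun ζ => p (D (ζ * q.1))) (fun ζ => φ' (ζ * q.1)) q.2
  have hec : ∀ p, Continuous p → Continuous (e p) := by
    intro p hp
    simp only [e, lipschitzExtension]
    refine Continuous.finset_inf'_apply hRne fun ζ _ => ?_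
    fun_prop
  have he_le : ∀ p, ∀ ω ∈ R, ∀ u y, e p (u, y) ≤ e p (ω * u, y) := by
    intro p ω hω u y
    refine Finset.le_inf' _ _ fun ζ hζ => ?_
    refine (Finset.inf'_le _ (hRmul ζ hζ ω hω)).trans (le_of_eq ?_)
    simp only [mul_assoc]
  have he_inv : ∀ p, ∀ ω ∈ R, ∀ u y, e p (ω * u, y) = e p (u, y) := by
    intro p ω hω u y
    refine le_antisymm ?_ (he_le p ω hω u y)
    have h1 := he_le p ω⁻¹ (hRinv ω hω) (ω * u) y
    rwa [inv_mul_cancel_left₀ (hRne0 ω hω)] at h1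
  have he_apply : ∀ p : ℂ → ℝ, (∀ z w, |p z - p w| ≤ ‖z - w‖) → ∀ u, e p (u, φ' u) = p (D u) := by
    intro p hp u
    have h1 := lipschitzExtension_apply hRne (a := fun ζ => p (D (ζ * u)))
      (c := fun ζ => φ' (ζ * u)) (fun ζ hζ η hη => (hp _ _).trans (hDφ u ζ hζ η hη)) hR1
    simp only [one_mul] at h1
    exact h1
  obtain ⟨g, hgc, hg⟩ := exists_continuous_comp_pow hm
    (G := fun q => (e Complex.re q : ℂ) + (e Complex.im q : ℂ) * Complex.I)
    (by
      have h1 := hec _ Complex.continuous_re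
      have h2 := hec _ Complex.continuous_im
      fun_prop)
    (fun ζ hζ u y => by
      have hζR := (mem_rootsOfUnity_iff hm).2 hζ
      simp only [he_inv _ ζ hζR])
  have hgl : ∀ x y y', ‖g (x, y) - g (x, y')‖ ≤ 1 / 2 * ‖y - y'‖ := by
    intro x y y'
    obtain ⟨u, rfl⟩ : ∃ u : ℂ, u ^ m = x := ⟨_, Complex.cpow_nat_inv_pow x hm⟩
    rw [hg, hg]
    have h1 := abs_lipschitzExtension_sub_le hRne (fun ζ => (D (ζ * u)).re)
      (fun ζ => φ' (ζ * u)) y y'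
    have h2 := abs_lipschitzExtension_sub_le hRne (fun ζ => (D (ζ * u)).im)
      (fun ζ => φ' (ζ * u)) y y'
    refine (Complex.norm_le_abs_re_add_abs_im _).trans ?_
    simp only [Complex.sub_re, Complex.sub_im, Complex.add_re, Complex.add_im, Complex.ofReal_re,
      Complex.ofReal_im, Complex.mul_re, Complex.mul_im, Complex.I_re, Complex.I_im, mul_zero,
      mul_one, sub_zero, zero_add, add_zero]
    simp only [e]
    linarith
  have hgD : ∀ u, g (u ^ m, φ' u) = D u := by
    intro u
    rw [hg, he_apply _ fun z w => by rw [← Complex.sub_re]; exact Complex.abs_re_le_norm _,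
      he_apply _ fun z w => by rw [← Complex.sub_im]; exact Complex.abs_im_le_norm _,
      Complex.re_add_im]
  obtain ⟨Φ, hΦ⟩ := exists_homeomorph_add hgc hgl
  have hsmall : ∀ u ∈ Metric.closedBall (0 : ℂ) r, g (u ^ m, φ u) = ψ u - φ u := by
    intro u hu
    have h1 := hgD u
    have h2 : ρ u = u := radialRetraction_of_mem hr hu
    simp only [hD, hφ', h2] at h1
    exact h1
  refine ⟨Φ, ?_, ?_⟩
  · have h1 := hsmall 0 (Metric.mem_closedBall_self hr.le)
    rw [zero_pow hm, hφ0, hψ0, sub_self] at h1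
    rw [hΦ]
    change ((0 : ℂ), (0 : ℂ) + g (0, 0)) = 0
    rw [h1, add_zero]
    rfl
  · have h1 := eventually_forall_pow_eq m (Metric.closedBall_mem_nhds (0 : ℂ) hr)
    filter_upwards [(continuous_fst.continuousAt.tendsto_of_map_zero
      (rfl : (0 : ℂ × ℂ).1 = 0)).eventually h1] with q hq
    rw [hΦ]
    constructor
    · rintro ⟨u, hu1, hu2⟩
      refine ⟨u, hu1, ?_⟩
      have h2 := hsmall u (hq u hu1)
      rw [hu1, hu2] at h2
      change ψ u = q.2 + g (q.1, q.2)
      rw [h2, add_sub_cancel]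
    · rintro ⟨u, hu1, hu2⟩
      refine ⟨u, hu1, ?_⟩
      have hu1' : u ^ m = q.1 := hu1
      have hu2' : ψ u = q.2 + g (q.1, q.2) := hu2
      have h2 := hsmall u (hq u hu1)
      rw [hu1'] at h2
      have h3 := hgl q.1 (φ u) q.2
      have h4 : g (q.1, φ u) - g (q.1, q.2) = -(φ u - q.2) := by rw [h2, hu2']; ring
      rw [h4, norm_neg] at h3
      have h5 : ‖φ u - q.2‖ = 0 := by linarith [norm_nonneg (φ u - q.2)]
      exact sub_eq_zero.1 (norm_eq_zero.1 h5)

end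

/-! ### The topological type is determined by the characteristic exponents -/

noncomputable section

open PowerSeries Asymptotics

section taylorSeries

theorem taylorSeries_congr {f g : ℂ → ℂ} (h : f =ᶠ[𝓝 0] g) : taylorSeries f = taylorSeries g := by
  ext n
  rw [taylorSeries, taylorSeries, coeff_mk, coeff_mk, (h.iteratedDeriv_eq n)]

theorem taylorSeries_pow_mul {g : ℂ → ℂ} (hg : AnalyticAt ℂ g 0) (n : ℕ) :
    taylorSeries (fun u => u ^ n * g u) = X ^ n * taylorSeries g := by
  apply C_injective
  have h : AnalyticAt ℂ (fun u : ℂ => u ^ n * g u) 0 := (analyticAt_id.pow n).mul hg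
  rw [map_mul, map_pow, ← analyticGerms.taylor_fst, ← analyticGerms.coeff_taylor_comp_fst hg,
    ← analyticGerms.coeff_taylor_comp_fst h, ← map_pow, ← map_mul]
  rfl

theorem taylorSeries_add {f g : ℂ → ℂ} (hf : AnalyticAt ℂ f 0) (hg : AnalyticAt ℂ g 0) :
    taylorSeries (fun u => f u + g u) = taylorSeries f + taylorSeries g := by
  apply C_injective
  rw [map_add, ← analyticGerms.coeff_taylor_comp_fst hf, ← analyticGerms.coeff_taylor_comp_fst hg,
    ← analyticGerms.coeff_taylor_comp_fst (hf.fun_add hg), ← map_add, analyticGerms.of_add]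
  rfl

theorem taylorSeries_const (c : ℂ) : taylorSeries (fun _ => c) = C c := by
  ext n
  rw [taylorSeries, coeff_mk, coeff_C, iteratedDeriv_const]
  split_ifs with h
  · simp [h]
  · simp

theorem analyticAt_sum_pow {ι : Type*} (s : Finset ι) (c : ι → ℂ) (e : ι → ℕ) :
    AnalyticAt ℂ (fun u : ℂ => ∑ i ∈ s, u ^ e i * c i) 0 :=
  Finset.analyticAt_fun_sum _ fun i _ => (analyticAt_id.pow (e i)).mul analyticAt_const

theorem coeff_taylorSeries_sum_pow {ι : Type*} (s : Finset ι) (c : ι → ℂ) (e : ι → ℕ) (n : ℕ) :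
    coeff n (taylorSeries fun u => ∑ i ∈ s, u ^ e i * c i) =
      ∑ i ∈ s, if n = e i then c i else 0 := by
  classical
  have h : taylorSeries (fun u => ∑ i ∈ s, u ^ e i * c i) = ∑ i ∈ s, X ^ e i * C (c i) := by
    induction s using Finset.induction_on with
    | empty =>
      simp only [Finset.sum_empty]
      rw [taylorSeries_const, map_zero]
    | insert a s ha ih =>
      simp only [Finset.sum_insert ha]
      have h1 : AnalyticAt ℂ (fun u : ℂ => u ^ e a * c a) 0 :=
        (analyticAt_id.pow (e a)).mul analyticAt_const
      rw [taylorSeries_add h1 (analyticAt_sum_pow s c e), ih, taylorSeries_pow_mul analyticAt_const,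
        taylorSeries_const]
  rw [h, map_sum]
  refine Finset.sum_congr rfl fun i _ => ?_
  rw [mul_comm, coeff_C_mul, coeff_X_pow, mul_ite, mul_one, mul_zero]

theorem coeff_taylorSeries_sum_pow_of_injective {ι : Type*} {s : Finset ι} (c : ι → ℂ) {e : ι → ℕ}
    (he : Set.InjOn e s) {i : ι} (hi : i ∈ s) :
    coeff (e i) (taylorSeries fun u => ∑ i ∈ s, u ^ e i * c i) = c i := by
  rw [coeff_taylorSeries_sum_pow, Finset.sum_eq_single i, if_pos rfl]
  · intro j hj hji
    rw [if_neg fun h => hji (he hj hi h.symm)]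
  · exact fun h => absurd hi h

theorem powerSupport_sum_pow {ι : Type*} {s : Finset ι} {c : ι → ℂ} {e : ι → ℕ}
    (he : Set.InjOn e s) (hc : ∀ i ∈ s, c i ≠ 0) :
    powerSupport (fun u => ∑ i ∈ s, u ^ e i * c i) = e '' s := by
  ext n
  rw [← not_iff_not, ← PlaneBranch.coeff_taylorSeries_eq_zero_iff]
  constructor
  · rintro h ⟨i, hi, rfl⟩
    rw [coeff_taylorSeries_sum_pow_of_injective c he hi] at h
    exact hc i hi h
  · intro h
    rw [coeff_taylorSeries_sum_pow]
    exact Finset.sum_eq_zero fun i hi => if_neg fun h1 => h ⟨i, hi, h1.symm⟩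

end taylorSeries

section conjugates

variable {m : ℕ} {φ ψ : ℂ → ℂ}

/-- If the exponents and `m` had a common divisor `e > 1`, then the conjugation by an `e`-th root
of unity would preserve `φ`. -/
theorem HasDistinctConjugates.exists_gcdBelow_eq_one (hm : m ≠ 0) (hφ : AnalyticAt ℂ φ 0)
    (h : HasDistinctConjugates m φ) : ∃ n, gcdBelow m φ n = 1 := by
  obtain ⟨N, hN⟩ := WellFounded.has_min (measure (gcdBelow m φ)).wf Set.univ Set.univ_nonempty
  have hN' : ∀ n, gcdBelow m φ N ∣ gcdBelow m φ n := by
    intro n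
    rcases le_total n N with hn | hn
    · exact gcdBelow_dvd_gcdBelow hn
    · have h1 : gcdBelow m φ N ≤ gcdBelow m φ n := not_lt.1 (hN.2 n (Set.mem_univ n))
      rw [le_antisymm h1 (Nat.le_of_dvd (gcdBelow_pos hm N) (gcdBelow_dvd_gcdBelow hn))]
  refine ⟨N, ?_⟩
  by_contra hne
  have hprim := Complex.isPrimitiveRoot_exp _ (gcdBelow_pos (φ := φ) hm N).ne'
  set ζ := Complex.exp (2 * Real.pi * Complex.I / (gcdBelow m φ N : ℕ))
  have hζ := (hprim.pow_eq_one_iff_dvd m).2 (gcdBelow_dvd m φ N)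
  refine h ζ hζ (hprim.ne_one (lt_of_le_of_ne (gcdBelow_pos hm N) (Ne.symm hne))) ?_
  have htop : analyticOrderAt (fun u => φ (ζ * u) - φ u) 0 = ⊤ := by
    refine ENat.eq_top_iff_forall_ge.2 fun n => ?_
    rw [← isBigO_pow_iff ((hφ.comp_const_mul _).fun_sub hφ), isBigO_conj_sub_iff hφ hζ,
      hprim.pow_eq_one_iff_dvd]
    exact hN' n
  rw [analyticOrderAt_eq_top] at htop
  exact htop.mono fun u hu => sub_eq_zero.1 hu

theorem hasDistinctConjugates_of_gcdBelow_eq_one (hφ : AnalyticAt ℂ φ 0) {n : ℕ}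
    (h : gcdBelow m φ n = 1) : HasDistinctConjugates m φ := by
  intro ζ hζ hne he
  apply hne
  rw [← pow_one ζ, ← h, ← isBigO_conj_sub_iff hφ hζ]
  have h0 : (fun _ : ℂ => (0 : ℂ)) =O[𝓝 (0 : ℂ)] fun u => u ^ n := isBigO_zero _ _
  refine h0.congr' ?_ EventuallyEq.rfl
  exact he.mono fun u hu => (sub_eq_zero.2 hu).symm

theorem finite_gcdDrops (hm : m ≠ 0) {n : ℕ} (h : gcdBelow m φ n = 1) :
    (gcdDrops m φ).Finite := by
  refine (Set.finite_Iio n).subset fun i hi => ?_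
  by_contra hni
  rw [Set.mem_Iio, not_lt] at hni
  have h1 : gcdBelow m φ i ∣ 1 := h ▸ gcdBelow_dvd_gcdBelow hni
  have h2 := gcdBelow_pos (φ := φ) hm (i + 1)
  have h3 : gcdBelow m φ (i + 1) < gcdBelow m φ i := hi
  rw [Nat.dvd_one.1 h1] at h3
  omega

/-- Two parametrizations with the same greatest common divisors are equivalent as soon as their
coefficients at the characteristic exponents are close. -/
theorem curveEquivalent_of_norm_coeff_sub_lt (hm : m ≠ 0) (hφ : AnalyticAt ℂ φ 0)
    (hψ : AnalyticAt ℂ ψ 0) (hφ0 : φ 0 = 0) (hψ0 : ψ 0 = 0)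
    (hG : gcdBelow m φ = gcdBelow m ψ) {N : ℕ} (hN : gcdBelow m φ N = 1)
    (h : ∀ n ∈ gcdDrops m φ, ‖coeff n (taylorSeries ψ) - coeff n (taylorSeries φ)‖ <
      1 / 4 * ‖coeff n (taylorSeries φ)‖) : CurveEquivalent m φ ψ := by
  classical
  refine curveEquivalent_of_norm_sub_le hm hφ hψ hφ0 hψ0 ?_
  rw [eventually_all_finset]
  intro ζ hζ
  rw [mem_rootsOfUnity_iff hm] at hζ
  by_cases h1 : ζ = 1
  · subst h1
    simp
  have hex : ∃ n, ζ ^ gcdBelow m φ (n + 1) ≠ 1 := by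
    refine ⟨N, fun h2 => h1 ?_⟩
    have h3 := gcdBelow_dvd_gcdBelow (m := m) (φ := φ) (Nat.le_add_right N 1)
    rw [hN, Nat.dvd_one] at h3
    rwa [h3, pow_one] at h2
  -- The contact order of `φ` with its conjugate is a characteristic exponent `β`.
  set β := Nat.find hex with hβ
  have hβ1 : ζ ^ gcdBelow m φ (β + 1) ≠ 1 := Nat.find_spec hex
  have hβ0 : ζ ^ gcdBelow m φ β = 1 := by
    rcases Nat.eq_zero_or_pos β with h0 | h0
    · rw [h0, gcdBelow_zero, hζ]
    · have h2 := not_not.1 (Nat.find_min hex (m := β - 1) (by omega))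
      rwa [Nat.sub_add_cancel h0] at h2
  have hmem : β ∈ gcdDrops m φ := by
    refine lt_of_le_of_ne (Nat.le_of_dvd (gcdBelow_pos hm _) (gcdBelow_dvd_gcdBelow β.le_succ)) ?_
    intro h2
    rw [h2] at hβ1
    exact hβ1 hβ0
  have hζβ : ζ ^ β ≠ 1 := by
    intro h2
    apply hβ1
    rw [← orderOf_dvd_iff_pow_eq_one] at h2 hβ0 ⊢
    rw [dvd_gcdBelow_iff] at hβ0 ⊢
    refine ⟨hβ0.1, fun i hi hi' => ?_⟩
    rcases Nat.lt_succ_iff_lt_or_eq.1 hi with h3 | rfl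
    exacts [hβ0.2 i h3 hi', h2]
  have key : ∀ {f : ℂ → ℂ}, AnalyticAt ℂ f 0 → gcdBelow m f = gcdBelow m φ →
      ∃ g, AnalyticAt ℂ g 0 ∧ (∀ᶠ u in 𝓝 (0 : ℂ), f (ζ * u) - f u = u ^ β * g u) ∧
        g 0 = (ζ ^ β - 1) * coeff β (taylorSeries f) := by
    intro f hf hfG
    have ha := (hf.comp_const_mul ζ).fun_sub hf
    have h2 := (isBigO_conj_sub_iff hf hζ β).2 (by rw [hfG]; exact hβ0)
    rw [isBigO_pow_iff ha] at h2
    obtain ⟨g, hg, hfg⟩ := (natCast_le_analyticOrderAt ha).1 h2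
    have hfg' : ∀ᶠ u in 𝓝 (0 : ℂ), f (ζ * u) - f u = u ^ β * g u :=
      hfg.mono fun u hu => by rw [hu, sub_zero, smul_eq_mul]
    refine ⟨g, hg, hfg', ?_⟩
    have h3 : taylorSeries (fun u => f (ζ * u) - f u) = X ^ β * taylorSeries g :=
      (taylorSeries_congr hfg').trans (taylorSeries_pow_mul hg β)
    rw [taylorSeries_sub (hf.comp_const_mul ζ) hf, taylorSeries_comp_const_mul hf] at h3
    have h4 := congrArg (coeff β) h3
    rw [map_sub, coeff_rescale, coeff_X_pow_mul', if_pos le_rfl, Nat.sub_self, taylorSeries,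
      taylorSeries, coeff_mk, coeff_mk, iteratedDeriv_zero, Nat.factorial_zero, Nat.cast_one,
      inv_one, one_mul] at h4
    rw [← h4, taylorSeries, coeff_mk]
    ring
  obtain ⟨g, hg, hφg, hg0⟩ := key hφ rfl
  obtain ⟨g', hg', hψg, hg0'⟩ := key hψ hG.symm
  have hlt : ‖g' 0 - g 0‖ < 1 / 4 * ‖g 0‖ := by
    rw [hg0, hg0', ← mul_sub, norm_mul, norm_mul, mul_left_comm]
    exact mul_lt_mul_of_pos_left (h β hmem) (norm_pos_iff.2 (sub_ne_zero.2 hζβ))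
  have hev : ∀ᶠ u in 𝓝 (0 : ℂ), ‖g' u - g u‖ < 1 / 4 * ‖g u‖ :=
    (hg'.continuousAt.sub hg.continuousAt).norm.eventually_lt
      (continuousAt_const.mul hg.continuousAt.norm) hlt
  filter_upwards [hev, hφg, hψg] with u e1 e2 e3
  have e4 : ψ (ζ * u) - φ (ζ * u) - (ψ u - φ u) = u ^ β * (g' u - g u) := by
    rw [mul_sub, ← e2, ← e3]
    ring
  rw [e4, e2, norm_mul, norm_mul, mul_left_comm]
  exact mul_le_mul_of_nonneg_left e1.le (norm_nonneg _)

/-- The polynomial with given coefficients at the exponents in `s`. -/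
def polynomialOf (s : Finset ℕ) (c : s → ℂ) (u : ℂ) : ℂ := ∑ i : s, u ^ (i : ℕ) * c i

theorem analyticAt_polynomialOf (s : Finset ℕ) (c : s → ℂ) : AnalyticAt ℂ (polynomialOf s c) 0 :=
  analyticAt_sum_pow Finset.univ c fun i : s => (i : ℕ)

theorem coeff_polynomialOf {s : Finset ℕ} (c : s → ℂ) (i : s) :
    coeff (i : ℕ) (taylorSeries (polynomialOf s c)) = c i :=
  coeff_taylorSeries_sum_pow_of_injective (s := Finset.univ) c (e := fun i : s => (i : ℕ))
    (fun _ _ _ _ h => Subtype.ext h) (Finset.mem_univ i)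

theorem powerSupport_polynomialOf {s : Finset ℕ} {c : s → ℂ} (hc : ∀ i, c i ≠ 0) :
    powerSupport (polynomialOf s c) = s := by
  refine (powerSupport_sum_pow (s := Finset.univ) (e := fun i : s => (i : ℕ))
    (fun _ _ _ _ h => Subtype.ext h) fun i _ => hc i).trans ?_
  simp

/-- Only the characteristic exponents matter for the greatest common divisors. -/
theorem gcdBelow_eq_of_powerSupport_eq_gcdDrops (hm : m ≠ 0) (h : powerSupport ψ = gcdDrops m φ) :
    gcdBelow m φ = gcdBelow m ψ := by
  ext n
  apply Nat.dvd_antisymm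
  · refine dvd_gcdBelow_iff.2 ⟨gcdBelow_dvd _ _ _, fun i hi hmem => gcdBelow_dvd_of_mem hi ?_⟩
    rw [h] at hmem
    exact mem_powerSupport_of_gcdBelow_lt hmem
  · have key : ∀ j ≤ n, gcdBelow m ψ n ∣ gcdBelow m φ j := by
      intro j
      induction j with
      | zero =>
        rw [gcdBelow_zero]
        exact fun _ => gcdBelow_dvd _ _ _
      | succ j ih =>
        intro hj
        have h1 := ih (by omega)
        by_cases hmem : j ∈ gcdDrops m φ
        · refine dvd_gcdBelow_iff.2 ⟨gcdBelow_dvd _ _ _, fun i hi hi' => ?_⟩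
          rcases Nat.lt_succ_iff_lt_or_eq.1 hi with h3 | rfl
          · exact h1.trans (gcdBelow_dvd_of_mem h3 hi')
          · exact gcdBelow_dvd_of_mem (by omega) (h ▸ hmem)
        · by_cases hj' : gcdBelow m φ (j + 1) = gcdBelow m φ j
          · rwa [hj']
          · exact absurd (lt_of_le_of_ne (Nat.le_of_dvd (gcdBelow_pos hm j)
              (gcdBelow_dvd_gcdBelow j.le_succ)) hj') hmem
    exact key n le_rfl

/-- Parametrizations with the same greatest common divisors are topologically equivalent: their
characteristic coefficients can be joined through nonzero values. -/
theorem curveEquivalent_of_gcdBelow_eq (hm : m ≠ 0) (hφ : AnalyticAt ℂ φ 0)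
    (hψ : AnalyticAt ℂ ψ 0) (hφlt : ∀ n ∈ powerSupport φ, m < n)
    (hψlt : ∀ n ∈ powerSupport ψ, m < n) (hG : gcdBelow m φ = gcdBelow m ψ)
    (hd : HasDistinctConjugates m φ) : CurveEquivalent m φ ψ := by
  obtain ⟨N, hN⟩ := hd.exists_gcdBelow_eq_one hm hφ
  have hfin := finite_gcdDrops hm hN
  set s := hfin.toFinset with hs
  have hs_mem : ∀ {n}, n ∈ s ↔ n ∈ gcdDrops m φ := fun {n} => hfin.mem_toFinset
  have hz : ∀ {f : ℂ → ℂ}, (∀ n ∈ powerSupport f, m < n) → f 0 = 0 := by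
    intro f hf
    by_contra h0
    have := hf 0 (by simpa [powerSupport] using h0)
    omega
  have hPlt : ∀ c : s → ℂ, (∀ i, c i ≠ 0) → ∀ n ∈ powerSupport (polynomialOf s c), m < n := by
    intro c hc n hn
    rw [powerSupport_polynomialOf hc] at hn
    exact hφlt n (mem_powerSupport_of_gcdBelow_lt (hs_mem.1 hn))
  have hPG : ∀ c : s → ℂ, (∀ i, c i ≠ 0) → gcdBelow m φ = gcdBelow m (polynomialOf s c) := by
    intro c hc
    apply gcdBelow_eq_of_powerSupport_eq_gcdDrops hm
    rw [powerSupport_polynomialOf hc, hs, hfin.coe_toFinset]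
  have hdrops : ∀ {f : ℂ → ℂ}, gcdBelow m φ = gcdBelow m f → gcdDrops m f = gcdDrops m φ := by
    intro f hf
    rw [gcdDrops, gcdDrops, hf]
  -- Dropping the terms that are not characteristic does not change the topology.
  have hred : ∀ {f : ℂ → ℂ}, AnalyticAt ℂ f 0 → (∀ n ∈ powerSupport f, m < n) →
      gcdBelow m φ = gcdBelow m f →
      ∃ c : s → ℂ, (∀ i, c i ≠ 0) ∧ CurveEquivalent m f (polynomialOf s c) := by
    intro f hf hlt hfG
    have hc : ∀ i : s, coeff (i : ℕ) (taylorSeries f) ≠ 0 := by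
      intro i
      rw [ne_eq, PlaneBranch.coeff_taylorSeries_eq_zero_iff, not_not]
      apply mem_powerSupport_of_gcdBelow_lt (m := m)
      rw [← hfG]
      exact hs_mem.1 i.2
    refine ⟨fun i => coeff (i : ℕ) (taylorSeries f), hc, ?_⟩
    refine curveEquivalent_of_norm_coeff_sub_lt hm hf (analyticAt_polynomialOf s _) (hz hlt)
      (hz (hPlt _ hc)) (hfG.symm.trans (hPG _ hc)) (hfG ▸ hN) fun n hn => ?_
    rw [hdrops hfG] at hn
    have h1 := coeff_polynomialOf (fun i : s => coeff (i : ℕ) (taylorSeries f)) ⟨n, hs_mem.2 hn⟩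
    simp only at h1
    rw [h1, sub_self, norm_zero]
    exact mul_pos (by norm_num) (norm_pos_iff.2 (hc ⟨n, hs_mem.2 hn⟩))
  obtain ⟨c, hc, h1⟩ := hred hφ hφlt rfl
  obtain ⟨c', hc', h2⟩ := hred hψ hψlt hG
  -- The characteristic coefficients vary in a connected space.
  let T : Set (s → ℂ) := Set.pi Set.univ fun _ => {0}ᶜ
  have hT : IsPreconnected T := isPreconnected_univ_pi fun _ =>
    (isConnected_compl_singleton_of_one_lt_rank (by simp) 0).isPreconnected
  have hTmem : ∀ c : s → ℂ, c ∈ T ↔ ∀ i, c i ≠ 0 := by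
    intro c
    simp [T, Set.mem_pi]
  refine (h1.trans (hT.induction₂' (fun c c' => CurveEquivalent m (polynomialOf s c)
    (polynomialOf s c')) ?_ (fun _ _ _ _ _ _ h h' => h.trans h') ((hTmem c).2 hc)
      ((hTmem c').2 hc'))).trans h2.symm
  intro c hc
  rw [hTmem] at hc
  have hnear : ∀ᶠ c' in 𝓝 c, ∀ i, ‖c' i - c i‖ < 1 / 4 * ‖c i‖ := by
    rw [eventually_all]
    intro i
    have h3 : Continuous fun c' : s → ℂ => ‖c' i - c i‖ := by fun_prop
    refine h3.continuousAt.eventually_lt continuousAt_const ?_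
    rw [sub_self, norm_zero]
    exact mul_pos (by norm_num) (norm_pos_iff.2 (hc i))
  filter_upwards [hnear.filter_mono nhdsWithin_le_nhds, self_mem_nhdsWithin] with c' h3 hc'
  rw [hTmem] at hc'
  have h4 : CurveEquivalent m (polynomialOf s c) (polynomialOf s c') := by
    refine curveEquivalent_of_norm_coeff_sub_lt hm (analyticAt_polynomialOf s c)
      (analyticAt_polynomialOf s c') (hz (hPlt c hc)) (hz (hPlt c' hc'))
      ((hPG c hc).symm.trans (hPG c' hc')) (hPG c hc ▸ hN) fun n hn => ?_
    rw [hdrops (hPG c hc)] at hn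
    have e1 := coeff_polynomialOf c ⟨n, hs_mem.2 hn⟩
    have e2 := coeff_polynomialOf c' ⟨n, hs_mem.2 hn⟩
    simp only at e1 e2
    rw [e1, e2]
    exact h3 ⟨n, hs_mem.2 hn⟩
  exact ⟨h4, h4.symm⟩

end conjugates

namespace PlaneBranch

theorem topEquivalent_of_curveEquivalent {B B' : PlaneBranch} {L L' : (ℂ × ℂ) ≃L[ℂ] (ℂ × ℂ)}
    {m : ℕ} {φ φ' : ℂ → ℂ} (h : B.IsPuiseuxParametrization L m φ)
    (h' : B'.IsPuiseuxParametrization L' m φ') (he : CurveEquivalent m φ φ') :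
    B.TopEquivalent B' := by
  obtain ⟨Φ, h0, hΦ⟩ := he
  let Ψ : (ℂ × ℂ) ≃ₜ (ℂ × ℂ) := (L.symm.toHomeomorph.trans Φ).trans L'.toHomeomorph
  have hΨ : ∀ q, Ψ q = L' (Φ (L.symm q)) := fun q => rfl
  have hL : Tendsto L.symm (𝓝 0) (𝓝 0) :=
    L.symm.continuous.continuousAt.tendsto_of_map_zero (_root_.map_zero L.symm)
  have hΦt : Tendsto Φ (𝓝 0) (𝓝 0) := Φ.continuous.continuousAt.tendsto_of_map_zero h0
  refine ⟨Ψ.toOpenPartialHomeomorph, Set.mem_univ _, ?_, ?_⟩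
  · change L' (Φ (L.symm 0)) = 0
    rw [_root_.map_zero, h0, _root_.map_zero]
  · filter_upwards [hL.eventually hΦ, hL.eventually h.eventually_iff,
      (hΦt.comp hL).eventually h'.eventually_iff] with q e1 e2 e3
    change B.eqn q = 0 ↔ B'.eqn (L' (Φ (L.symm q))) = 0
    rw [L.apply_symm_apply] at e2
    exact e2.trans (e1.trans e3.symm)

end PlaneBranch

end

/-! ### The normal form and its minimality -/

noncomputable section

namespace PlaneBranch

/-- The product of the conjugates of `y - φ(x ^ (1 / m))` is the equation of a branch parametrized
by `u ↦ (u ^ m, φ u)`. -/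
theorem exists_isPuiseuxParametrization {m : ℕ} (hm : m ≠ 0) {φ : ℂ → ℂ} (hφ : AnalyticAt ℂ φ 0)
    (hlt : ∀ n ∈ powerSupport φ, m < n) (hd : HasDistinctConjugates m φ) :
    ∃ B : PlaneBranch,
      B.IsPuiseuxParametrization (ContinuousLinearEquiv.refl ℂ (ℂ × ℂ)) m φ := by
  have h0 : φ 0 = 0 := by
    by_contra h0
    have := hlt 0 (by simpa [powerSupport] using h0)
    omega
  obtain ⟨F, hF⟩ := exists_isBranchEquation hm hφ
  refine ⟨⟨F, hF.analytic, hF.irreducible hm hφ h0 hd⟩, Nat.pos_of_ne_zero hm, hφ, hlt, ?_⟩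
  refine ⟨analyticAt_param hφ, param_zero hm h0, hF.eventually_param hm hφ h0, ?_, ?_⟩
  · have h1 : ∀ᶠ u in 𝓝[≠] (0 : ℂ), ∀ ζ ∈ Polynomial.nthRootsFinset m (1 : ℂ),
        ζ ≠ 1 → φ (ζ * u) ≠ φ u := by
      rw [eventually_all_finset]
      intro ζ hζ
      by_cases hζ1 : ζ = 1
      · exact Eventually.of_forall fun u h => absurd hζ1 h
      · rcases ((hφ.comp_const_mul ζ).fun_sub hφ).eventually_eq_zero_or_eventually_ne_zero with h | h
        · exact absurd (h.mono fun u hu => sub_eq_zero.1 hu)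
            (hd ζ ((mem_rootsOfUnity_iff hm).1 hζ) hζ1)
        · exact h.mono fun u hu _ => sub_ne_zero.1 hu
    rw [eventually_nhdsWithin_iff] at h1
    refine ⟨_, h1, fun u _ v hv huv => ?_⟩
    obtain ⟨huv1, huv2⟩ := Prod.ext_iff.1 huv
    have huv1' : u ^ m = v ^ m := huv1
    have huv2' : φ u = φ v := huv2
    obtain ⟨ζ, hζ, rfl⟩ := exists_root_of_pow_eq hm huv1'
    by_cases hv0 : v = 0
    · rw [hv0, mul_zero]
    · by_cases hζ1 : ζ = 1
      · rw [hζ1, one_mul]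
      · exact absurd huv2' (hv hv0 ζ hζ hζ1)
  · intro U hU
    refine analyticGerms.eventually_of_pow hm ?_
    have h1 : ∀ᶠ p in 𝓝 (0 : ℂ × ℂ), ∀ ζ ∈ Polynomial.nthRootsFinset m (1 : ℂ), ζ * p.1 ∈ U := by
      rw [eventually_all_finset]
      intro ζ _
      have h2 : Tendsto (fun p : ℂ × ℂ => ζ * p.1) (𝓝 0) (𝓝 0) :=
        (tendsto_const_mul_zero ζ).comp
          (continuous_fst.continuousAt.tendsto_of_map_zero (rfl : (0 : ℂ × ℂ).1 = 0))
      exact h2.eventually hU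
    filter_upwards [hF.eq_conjProd, h1] with p hp hpU h2
    have h3 : conjProd m φ p = 0 := hp.symm.trans h2
    obtain ⟨ζ, hζ, h4⟩ := Finset.prod_eq_zero_iff.1 h3
    refine ⟨ζ * p.1, hpU ζ hζ, ?_⟩
    change ((ζ * p.1) ^ m, φ (ζ * p.1)) = (p.1 ^ m, p.2)
    rw [mul_pow, (mem_rootsOfUnity_iff hm).1 hζ, one_mul, sub_eq_zero.1 h4]

theorem exists_isPuiseuxParametrization_of_mem_Lam {B : PlaneBranch} {m k : ℕ} (h : B ∈ Lam m k) :
    ∃ (L : (ℂ × ℂ) ≃L[ℂ] (ℂ × ℂ)) (φ : ℂ → ℂ), B.IsPuiseuxParametrization L m φ ∧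
      (puiseuxExponents m φ).encard = k := by
  obtain ⟨hmult, E, ⟨L, m', φ, hpar, rfl⟩, hE⟩ := h
  obtain rfl := hpar.hasMultiplicity.unique hmult
  exact ⟨L, φ, hpar, hE⟩

section comparison

variable {B B' : PlaneBranch} {L L' : (ℂ × ℂ) ≃L[ℂ] (ℂ × ℂ)} {m : ℕ} {φ φ' : ℂ → ℂ}

theorem IsPuiseuxParametrization.exists_milnor_eq_sum (h : B.IsPuiseuxParametrization L m φ) :
    ∃ μ : ℕ, B.milnor = μ ∧ ∃ N₀, ∀ N ≥ N₀,
      μ + (m - 1) = ∑ n ∈ Finset.Icc 1 N, (gcdBelow m φ n - 1) := by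
  obtain ⟨μ, h1, h2⟩ := h.exists_milnor_eq
  obtain ⟨N₀, h3⟩ := exists_sum_contactOrder_eq h.pos.ne' h.analytic h.hasDistinctConjugates
  exact ⟨μ, h1, N₀, fun N hN => h2.trans (h3 N hN)⟩

/-- The Milnor number is monotone in the greatest common divisors. -/
theorem IsPuiseuxParametrization.milnor_le (h : B.IsPuiseuxParametrization L m φ)
    (h' : B'.IsPuiseuxParametrization L' m φ') (hG : ∀ n, gcdBelow m φ n ≤ gcdBelow m φ' n) :
    B.milnor ≤ B'.milnor := by
  obtain ⟨μ, h1, N, h2⟩ := h.exists_milnor_eq_sum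
  obtain ⟨μ', h1', N', h2'⟩ := h'.exists_milnor_eq_sum
  rw [h1, h1', Nat.cast_le]
  have h3 := Finset.sum_le_sum fun n (_ : n ∈ Finset.Icc 1 (max N N')) =>
    Nat.sub_le_sub_right (hG n) 1
  rw [← h2 _ (le_max_left _ _), ← h2' _ (le_max_right _ _)] at h3
  omega

/-- The Milnor number is strictly monotone in the greatest common divisors. -/
theorem IsPuiseuxParametrization.gcdBelow_eq_of_milnor_le (h : B.IsPuiseuxParametrization L m φ)
    (h' : B'.IsPuiseuxParametrization L' m φ') (hG : ∀ n, gcdBelow m φ n ≤ gcdBelow m φ' n)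
    (hle : B'.milnor ≤ B.milnor) : gcdBelow m φ = gcdBelow m φ' := by
  obtain ⟨μ, h1, N, h2⟩ := h.exists_milnor_eq_sum
  obtain ⟨μ', h1', N', h2'⟩ := h'.exists_milnor_eq_sum
  rw [h1, h1', Nat.cast_le] at hle
  ext n
  rcases Nat.eq_zero_or_pos n with rfl | hn
  · rw [gcdBelow_zero, gcdBelow_zero]
  set M := max n (max N N')
  have h3 : ∀ i ∈ Finset.Icc 1 M, gcdBelow m φ i - 1 ≤ gcdBelow m φ' i - 1 := fun i _ =>
    Nat.sub_le_sub_right (hG i) 1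
  have h4 : ∑ i ∈ Finset.Icc 1 M, (gcdBelow m φ i - 1) =
      ∑ i ∈ Finset.Icc 1 M, (gcdBelow m φ' i - 1) := by
    refine le_antisymm (Finset.sum_le_sum h3) ?_
    rw [← h2 M (by simp [M]), ← h2' M (by simp [M])]
    omega
  have h5 := (Finset.sum_eq_sum_iff_of_le h3).1 h4 n (Finset.mem_Icc.2 ⟨hn, le_max_left _ _⟩)
  have h6 := gcdBelow_pos (φ := φ) h.pos.ne' n
  have h7 := gcdBelow_pos (φ := φ') h.pos.ne' n
  omega

end comparison

end PlaneBranch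

theorem gcdBelow_of_le {m : ℕ} {φ : ℂ → ℂ} (hlt : ∀ n ∈ powerSupport φ, m < n) {n : ℕ}
    (hn : n ≤ m) : gcdBelow m φ n = m := by
  refine Nat.dvd_antisymm (gcdBelow_dvd _ _ _) (dvd_gcdBelow_iff.2 ⟨dvd_rfl, fun i hi hmem => ?_⟩)
  have := hlt i hmem
  omega

section normalForm

variable {m r k : ℕ} {p : ℕ → ℕ}

theorem normalForm_snd_eq (hk : 3 ≤ k) : (fun u => (normalForm m k p u).2) =
    fun u => ∑ i ∈ Finset.Icc 1 (k - 1), u ^ normalExponent m k p i * 1 := by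
  funext u
  have h1 : k - 1 = k - 2 + 1 := by omega
  rw [h1, Finset.sum_Icc_succ_top (by omega), ← h1, normalExponent_last hk]
  simp only [mul_one]
  rfl

theorem analyticAt_normalForm_snd (hk : 3 ≤ k) :
    AnalyticAt ℂ (fun u => (normalForm m k p u).2) 0 := by
  rw [normalForm_snd_eq hk]
  exact analyticAt_sum_pow _ _ _

theorem powerSupport_normalForm_snd (hm : m ≠ 0) (hp : ∀ i ∈ Finset.Icc 1 r, (p i).Prime)
    (hfac : m = ∏ i ∈ Finset.Icc 1 r, p i) (hk : 3 ≤ k) (hkr : k ≤ r + 1) :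
    powerSupport (fun u => (normalForm m k p u).2) =
      {n | ∃ i ∈ Finset.Icc 1 (k - 1), n = normalExponent m k p i} := by
  rw [normalForm_snd_eq hk, powerSupport_sum_pow]
  · ext n
    simp only [Set.mem_image, Finset.mem_coe, Set.mem_ofPred_eq, eq_comm]
  · intro i hi j hj hij
    rw [Finset.mem_coe, Finset.mem_Icc] at hi hj
    rcases lt_trichotomy i j with h | h | h
    · exact absurd hij (normalExponent_strictMonoOn hm hp hfac hk hkr h hj.2).ne
    · exact h
    · exact absurd hij (normalExponent_strictMonoOn hm hp hfac hk hkr h hi.2).ne'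
  · exact fun _ _ => one_ne_zero

theorem lt_of_mem_powerSupport_normalForm (hm : m ≠ 0)
    (hp : ∀ i ∈ Finset.Icc 1 r, (p i).Prime)
    (hfac : m = ∏ i ∈ Finset.Icc 1 r, p i) (hk : 3 ≤ k) (hkr : k ≤ r + 1) :
    ∀ n ∈ powerSupport (fun u => (normalForm m k p u).2), m < n := by
  intro n hn
  rw [powerSupport_normalForm_snd hm hp hfac hk hkr] at hn
  obtain ⟨i, hi, rfl⟩ := hn
  rw [Finset.mem_Icc] at hi
  have h1 := normalExponent_strictMonoOn hm hp hfac hk hkr (show 0 < i by omega) hi.2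
  rwa [normalExponent_zero] at h1

theorem hasDistinctConjugates_normalForm (hm : m ≠ 0) (hp : ∀ i ∈ Finset.Icc 1 r, (p i).Prime)
    (hfac : m = ∏ i ∈ Finset.Icc 1 r, p i) (hk : 3 ≤ k) (hkr : k ≤ r + 1) :
    HasDistinctConjugates m (fun u => (normalForm m k p u).2) := by
  have h1 := gcdBelow_le_of_powerSupport_eq hm hp hfac hk hkr
    (powerSupport_normalForm_snd hm hp hfac hk hkr) (le_refl (k - 1))
    (Nat.lt_succ_self (normalExponent m k p (k - 1)))
  rw [nestedDivisor_last hk] at h1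
  exact hasDistinctConjugates_of_gcdBelow_eq_one (analyticAt_normalForm_snd hk)
    (le_antisymm h1 (gcdBelow_pos hm _))

end normalForm

end

theorem mainTheorem4 (m r k : ℕ) (p : ℕ → ℕ) (hm : 4 ≤ m) (hcomp : ¬ m.Prime)
    (hp : ∀ i ∈ Finset.Icc 1 r, (p i).Prime)
    (hmono : ∀ i ∈ Finset.Icc 1 r, ∀ j ∈ Finset.Icc 1 r, i ≤ j → p i ≤ p j)
    (hfac : m = ∏ i ∈ Finset.Icc 1 r, p i) (hk : 3 ≤ k) (hkr : k ≤ r + 1) :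
    (∀ i < k - 1, nestedDivisor m k p (i + 1) ∣ nestedDivisor m k p i ∧
      nestedDivisor m k p (i + 1) < nestedDivisor m k p i) ∧
    nestedDivisor m k p (k - 1) = 1 ∧
    ∃ N : PlaneBranch, N.IsParametrizedBy (normalForm m k p) ∧ N.IsMuMinimal m k ∧
      ∀ X : PlaneBranch, X.IsMuMinimal m k →
        X.TopEquivalent N ∧
        ∀ E : Set ℕ, X.HasCharExponents E ↔
          E = insert (normalExponent m k p (k - 2) + 1)
            {e | ∃ i ≤ k - 2, e = normalExponent m k p i} := by
  have hm0 : m ≠ 0 := by omega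
  refine ⟨fun i hi => nestedDivisor_succ hp hfac hk hkr hi, nestedDivisor_last hk, ?_⟩
  set φ : ℂ → ℂ := fun u => (normalForm m k p u).2 with hφ
  have hsupp := powerSupport_normalForm_snd hm0 hp hfac hk hkr
  have hlt := lt_of_mem_powerSupport_normalForm hm0 hp hfac hk hkr
  obtain ⟨hE, hcard⟩ := puiseuxExponents_of_powerSupport_eq hm0 hp hfac hk hkr hsupp
  obtain ⟨N, hN⟩ := PlaneBranch.exists_isPuiseuxParametrization hm0 (analyticAt_normalForm_snd hk)
    hlt (hasDistinctConjugates_normalForm hm0 hp hfac hk hkr)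
  have hNmem : N ∈ PlaneBranch.Lam m k :=
    ⟨hN.hasMultiplicity, _, ⟨_, m, φ, hN, rfl⟩, hcard⟩
  -- Among the branches with `k` characteristic exponents, the greatest common divisors of the
  -- normal form are the smallest ones.
  have hle : ∀ {X : PlaneBranch} {L : (ℂ × ℂ) ≃L[ℂ] (ℂ × ℂ)} {ψ : ℂ → ℂ},
      X.IsPuiseuxParametrization L m ψ → (puiseuxExponents m ψ).encard = k →
        ∀ n, gcdBelow m φ n ≤ gcdBelow m ψ n := by
    intro X L ψ hX hcardX n
    rcases le_or_gt n m with hn | hn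
    · rw [gcdBelow_of_le hlt hn, gcdBelow_of_le hX.lt_of_mem hn]
    · exact le_gcdBelow_of_encard hm0 hp hmono hfac hk hX.lt_of_mem hcardX
        (fun j hj n hn => gcdBelow_le_of_powerSupport_eq hm0 hp hfac hk hkr hsupp hj hn) hn
  refine ⟨N, hN.parametrizes, ⟨hNmem, fun Y hY => ?_⟩, fun X hX => ?_⟩
  · obtain ⟨L, ψ, hYpar, hYcard⟩ := PlaneBranch.exists_isPuiseuxParametrization_of_mem_Lam hY
    exact hN.milnor_le hYpar (hle hYpar hYcard)
  · obtain ⟨L, ψ, hXpar, hXcard⟩ := PlaneBranch.exists_isPuiseuxParametrization_of_mem_Lam hX.1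
    have hG := hN.gcdBelow_eq_of_milnor_le hXpar (hle hXpar hXcard) (hX.2 N hNmem)
    refine ⟨PlaneBranch.topEquivalent_of_curveEquivalent hXpar hN
      (curveEquivalent_of_gcdBelow_eq hm0 hXpar.analytic hN.analytic hXpar.lt_of_mem hlt hG.symm
        hXpar.hasDistinctConjugates), fun E => ?_⟩
    have hexp : ∀ ψ', gcdBelow m ψ' = gcdBelow m φ →
        puiseuxExponents m ψ' = puiseuxExponents m φ := by
      intro ψ' h
      rw [puiseuxExponents_eq, puiseuxExponents_eq, gcdDrops, gcdDrops, h]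
    rw [← hE]
    constructor
    · rintro ⟨L', m', ψ', hpar, rfl⟩
      obtain rfl := hpar.hasMultiplicity.unique hXpar.hasMultiplicity
      exact hexp ψ' ((hpar.gcdBelow_eq hXpar).trans hG.symm)
    · rintro rfl
      exact ⟨L, m, ψ, hXpar, (hexp ψ hG.symm).symm⟩
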